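/- **Setting.** Let $X,A$ be finite sets of states and actions. The states are partitioned into layers $X_0,\dots,X_L$ with $X_0=\{x_0\}$ and $X_L=\{x_L\}$. Let $P(x'\mid x,a)$ be a transition function, unknown to the learner, that moves from each layer to the next one. A policy $\pi$ induces the occupancy measure $q^{P,\pi}(x,a,x')$, the probability of reaching $x$, playing $a$ and moving to $x'$. For any $q(x,a,x')$ write $q(x,a)=\sum_{x'}q(x,a,x')$, $q(x)=\sum_a q(x,a)$, and $u^\top q=\sum_{x,a}u(x,a)q(x,a)$. Let $m,T\ge 1$ and $\alpha\in[0,L]^m$. In each episode $t=1,\dots,T$ an adversary, who may react to the past, chooses a law of a reward vector $r_t\in[0,1]^{X\times A}$ and a cost matrix $G_t=(g_{t,i})_{i\le m}$, $g_{t,i}\in[0,1]^{X\times A}$. The learner chooses a policy $\pi_t$. A trajectory from $x_0$ to $x_L$ is generated by $\pi_t$ and $P$, and, independently of it given the past, $(r_t,G_t)$ is drawn from the chosen law. The learner observes the trajectory and the values $r_t(x,a)$, $g_{t,i}(x,a)$ at the visited pairs only (bandit feedback). Let $\mathbb E[r_t],\mathbb E[g_{t,i}]$ be the means of the chosen laws,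 and define $$C_r=\min_{r\in[0,1]^{X\times A}}\sum_{t=1}^T\|\mathbb E[r_t]-r\|_1,\qquad C_G=\min_{g_1,\dots,g_m\in[0,1]^{X\times A}}\sum_{t=1}^T\max_{i\le m}\|\mathbb E[g_{t,i}]-g_i\|_1,$$ $$V_T=\max_{i\le m}\sum_{t=1}^T\max\{0,\ \mathbb E[g_{t,i}]^\top q^{P,\pi_t}-\alpha_i\}.$$ Let $C$ be a constant, known to the learner, with $\max\{C_G,C_r\}\le C$ almost surely (for instance, $C=\max\{C_G,C_r\}$ if the laws are fixed in advance). Assume that, almost surely, the offline problem is feasible: some policy $\pi$ has $\big(\frac1T\sum_{t}\mathbb E[g_{t,i}]\big)^\top q^{P,\pi}\le\alpha_i$ for all $i$. **Algorithm NS-SOPS** with parameters $C$ and $\delta\in(0,1)$. The policy $\pi_1$ is arbitrary. After episode $t<T$, let $N_t(x,a)$ be the number of the episodes $1,\dots,t$ in which $(x,a)$ was visited, and let $\overline P_t(x'\mid x,a)$ be the number of those followed by a transition to $x'$, divided by $\max\{1,N_t(x,a)\}$. Let $\widehat r_t(x,a)$ and $\widehat g_{t,i}(x,a)$ be the sums of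 the rewards and costs observed at $(x,a)$ in the episodes $1,\dots,t$, divided by $\max\{1,N_t(x,a)\}$. Put $\iota=\ln(T|X||A|/\delta)$ and $$\epsilon_t(x'|x,a)=2\sqrt{\frac{\overline P_t(x'|x,a)\,\iota}{\max\{1,N_t(x,a)-1\}}}+\frac{14\,\iota}{3\max\{1,N_t(x,a)-1\}},$$ $$\phi_t(x,a)=\min\Big\{1,\sqrt{\tfrac{\ln(2T|X||A|/\delta)}{2\max\{N_t(x,a),1\}}}+\tfrac{C}{\max\{N_t(x,a),1\}}+\tfrac CT\Big\},$$ $$\xi_t(x,a)=\min\Big\{1,\sqrt{\tfrac{\ln(2mT|X||A|/\delta)}{2\max\{N_t(x,a),1\}}}+\tfrac{C}{\max\{N_t(x,a),1\}}+\tfrac CT\Big\}.$$ Let $\Delta(\mathcal P_t)$ be the set of all $q\ge0$ on the triples $(x,a,x')\in X_k\times A\times X_{k+1}$, $0\le k<L$, that have total mass $1$ for each $k$, satisfy $q(x)=\sum_{x',a}q(x',a,x)$ for $x\in X_1\cup\dots\cup X_{L-1}$, and satisfy $(\overline P_t-\epsilon_t)(x'|x,a)\,q(x,a)\le q(x,a,x')\le(\overline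 P_t+\epsilon_t)(x'|x,a)\,q(x,a)$. Consider the linear program of maximizing $(\widehat r_t+\phi_t)^\top q$ over $q\in\Delta(\mathcal P_t)$ subject to $(\widehat g_{t,i}-\xi_t)^\top q\le\alpha_i$ for all $i\le m$. Let $\widehat q_{t+1}$ be any solution if the program is feasible, and any element of $\Delta(\mathcal P_t)$ otherwise. Then $\pi_{t+1}(a|x)=\widehat q_{t+1}(x,a)/\widehat q_{t+1}(x)$, with an arbitrary choice at states where $\widehat q_{t+1}(x)=0$. **Theorem.** There is a universal constant $K>0$ such that in every such setting, for every $\delta\in(0,1)$, NS-SOPS satisfies with probability at least $1-8\delta$ $$V_T\le K\Big(L|X||A|\sqrt{T\ln\frac{mT|X||A|}{\delta}}+\ln(T)\,|X||A|\,C\Big).$$ -/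

import Mathlib

open scoped BigOperators
open MeasureTheory

noncomputable section

namespace NSSOPS

/-- The layered state space and the transition function of an episodic loop-free MDP with
horizon `L`: the states are partitioned into layers `0, …, L`, the first and the last of which
are singletons, and transitions go from a layer to the next one. -/
structure LoopFreeMDP (X A : Type*) [Fintype X] (L : ℕ) where
  /-- the index of the layer that contains a state -/
  layer : X → ℕ
  /-- the initial state `x₀` -/
  start : X
  /-- the final state `x_L` -/
  terminal : X
  layer_le : ∀ x, layer x ≤ L
  layer_eq_zero_iff : ∀ x, layer x = 0 ↔ x = start
  layer_eq_top_iff : ∀ x, layer x = L ↔ x = terminal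
  /-- `P x a x'` is the probability `P(x' | x, a)` -/
  P : X → A → X → ℝ
  P_nonneg : ∀ x a x', 0 ≤ P x a x'
  P_sum : ∀ x a, layer x < L → ∑ x', P x a x' = 1
  P_layer : ∀ x a x', P x a x' ≠ 0 → layer x' = layer x + 1

/-- `π x a` is the probability of playing action `a` in state `x`. -/
def IsPolicy {X A : Type*} [Fintype A] (π : X → A → ℝ) : Prop :=
  (∀ x a, 0 ≤ π x a) ∧ ∀ x, ∑ a, π x a = 1

/-- Everything that happens in one episode: the visited states `x₀, …, x_L`, the played actions
`a₀, …, a_{L-1}`, the sampled reward vector and the sampled cost matrix. -/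
structure Episode (X A : Type*) (L m : ℕ) where
  state : Fin (L + 1) → X
  action : Fin L → A
  reward : X → A → ℝ
  cost : Fin m → X → A → ℝ

section Occupancy

variable {X A : Type*} [Fintype X] [Fintype A] {L : ℕ}

open Classical in
/-- The probability that the policy `π` produces the states `s` and the actions `b`. -/
def LoopFreeMDP.trajProb (M : LoopFreeMDP X A L) (π : X → A → ℝ)
    (s : Fin (L + 1) → X) (b : Fin L → A) : ℝ :=
  (if s 0 = M.start then 1 else 0) *
    ∏ k : Fin L, π (s k.castSucc) (b k) * M.P (s k.castSucc) (b k) (s k.succ)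

open Classical in
/-- The occupancy measure `q^{P,π}(x, a, x')`: the probability that `π` reaches `x`, plays `a`
there and then moves to `x'`. -/
def LoopFreeMDP.occ (M : LoopFreeMDP X A L) (π : X → A → ℝ) (x : X) (a : A) (x' : X) : ℝ :=
  ∑ s : Fin (L + 1) → X, ∑ b : Fin L → A,
    if ∃ k : Fin L, s k.castSucc = x ∧ b k = a ∧ s k.succ = x' then M.trajProb π s b else 0

end Occupancy

section Vectors

variable {X A : Type*} [Fintype X]

/-- The marginal `q(x, a) = ∑_{x'} q(x, a, x')`. -/
def pairMarginal (q : X → A → X → ℝ) (x : X) (a : A) : ℝ := ∑ x', q x a x'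

variable [Fintype A]

/-- The inner product of two vectors indexed by state-action pairs. -/
def dot (u v : X → A → ℝ) : ℝ := ∑ x, ∑ a, u x a * v x a

/-- The 1-norm of a vector indexed by state-action pairs. -/
def l1Norm (u : X → A → ℝ) : ℝ := ∑ x, ∑ a, |u x a|

/-- The reward corruption of the mean reward vectors `rbar 0, …, rbar (T - 1)`. -/
def rewardCorruption (T : ℕ) (rbar : ℕ → X → A → ℝ) : ℝ :=
  sInf ((fun r : X → A → ℝ => ∑ t ∈ Finset.range T, l1Norm (rbar t - r)) ''
    {r | ∀ x a, r x a ∈ Set.Icc (0 : ℝ) 1})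

/-- The cost corruption of the mean cost matrices `gbar 0, …, gbar (T - 1)`. -/
def costCorruption {m : ℕ} (T : ℕ) (gbar : ℕ → Fin m → X → A → ℝ) : ℝ :=
  sInf ((fun g : Fin m → X → A → ℝ =>
      ∑ t ∈ Finset.range T, ⨆ i : Fin m, l1Norm (gbar t i - g i)) ''
    {g | ∀ i x a, g i x a ∈ Set.Icc (0 : ℝ) 1})

/-- The positive cumulative constraint violation, for the mean cost matrices `gbar t` and the
policies `π t`, `t < T`. -/
def violation {L m : ℕ} (M : LoopFreeMDP X A L) (T : ℕ) (α : Fin m → ℝ)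
    (gbar : ℕ → Fin m → X → A → ℝ) (π : ℕ → X → A → ℝ) : ℝ :=
  ⨆ i : Fin m, ∑ t ∈ Finset.range T,
    max 0 (dot (gbar t i) (pairMarginal (M.occ (π t))) - α i)

end Vectors

/-! ### The statistics of the learner after `n` episodes

In all definitions below `h 0, h 1, …` are the episodes, and only the first `n` of them are
used; rewards and costs are read only at the visited state-action pairs. -/

section Statistics

variable {X A : Type*} {L m : ℕ}

open Classical in
/-- The indicator that `(x, a)` is visited in the episode `e`. -/
def Episode.visit (e : Episode X A L m) (x : X) (a : A) : ℝ :=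
  if ∃ k : Fin L, e.state k.castSucc = x ∧ e.action k = a then 1 else 0

open Classical in
/-- The indicator that `(x, a)` is visited in the episode `e` and followed by `x'`. -/
def Episode.transit (e : Episode X A L m) (x : X) (a : A) (x' : X) : ℝ :=
  if ∃ k : Fin L, e.state k.castSucc = x ∧ e.action k = a ∧ e.state k.succ = x' then 1 else 0

variable (h : ℕ → Episode X A L m) (n : ℕ)

/-- The counter `N(x, a)`. -/
def visitCount (x : X) (a : A) : ℝ := ∑ τ ∈ Finset.range n, (h τ).visit x a

/-- The counter `M(x, a, x')`. -/
def transitCount (x : X) (a : A) (x' : X) : ℝ := ∑ τ ∈ Finset.range n, (h τ).transit x a x'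

/-- The empirical transition probabilities. -/
def empTrans (x : X) (a : A) (x' : X) : ℝ := transitCount h n x a x' / max 1 (visitCount h n x a)

/-- The empirical rewards. -/
def empReward (x : X) (a : A) : ℝ :=
  (∑ τ ∈ Finset.range n, (h τ).visit x a * (h τ).reward x a) / max (visitCount h n x a) 1

/-- The empirical costs. -/
def empCost (i : Fin m) (x : X) (a : A) : ℝ :=
  (∑ τ ∈ Finset.range n, (h τ).visit x a * (h τ).cost i x a) / max (visitCount h n x a) 1

variable [Fintype X] [Fintype A] (T : ℕ) (δ C : ℝ)

/-- The confidence radius of the transition probabilities. -/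
def transRadius (x : X) (a : A) (x' : X) : ℝ :=
  2 * √(empTrans h n x a x' * Real.log (T * Fintype.card X * Fintype.card A / δ) /
      max 1 (visitCount h n x a - 1)) +
    14 * Real.log (T * Fintype.card X * Fintype.card A / δ) /
      (3 * max 1 (visitCount h n x a - 1))

/-- The corruption-enlarged confidence radius of the rewards. -/
def rewardRadius (x : X) (a : A) : ℝ :=
  min 1 (√(Real.log (2 * T * Fintype.card X * Fintype.card A / δ) /
      (2 * max (visitCount h n x a) 1)) + C / max (visitCount h n x a) 1 + C / T)

/-- The corruption-enlarged confidence radius of the costs. -/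
def costRadius (x : X) (a : A) : ℝ :=
  min 1 (√(Real.log (2 * m * T * Fintype.card X * Fintype.card A / δ) /
      (2 * max (visitCount h n x a) 1)) + C / max (visitCount h n x a) 1 + C / T)

/-- The upper confidence bounds of the rewards. -/
def upperReward (x : X) (a : A) : ℝ := empReward h n x a + rewardRadius h n T δ C x a

/-- The lower confidence bounds of the costs. -/
def lowerCost (i : Fin m) (x : X) (a : A) : ℝ := empCost h n i x a - costRadius h n T δ C x a

/-- The occupancy measures that are valid for some transition function in the confidence set. -/
structure IsConfOcc (M : LoopFreeMDP X A L) (q : X → A → X → ℝ) : Prop where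
  nonneg : ∀ x a x', 0 ≤ q x a x'
  /-- `q` lives on triples from consecutive layers -/
  support : ∀ x a x', M.layer x' ≠ M.layer x + 1 → q x a x' = 0
  mass : ∀ k < L, ∑ x with M.layer x = k, ∑ a, ∑ x', q x a x' = 1
  flow : ∀ x, 1 ≤ M.layer x → M.layer x < L →
    ∑ a, ∑ x', q x a x' = ∑ x', ∑ a, q x' a x
  upper : ∀ x a x', M.layer x' = M.layer x + 1 →
    q x a x' ≤ (empTrans h n x a x' + transRadius h n T δ x a x') * ∑ y, q x a y
  lower : ∀ x a x', M.layer x' = M.layer x + 1 →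
    (empTrans h n x a x' - transRadius h n T δ x a x') * ∑ y, q x a y ≤ q x a x'

/-- The feasible set of the optimistic linear program. -/
def feasibleSet (M : LoopFreeMDP X A L) (α : Fin m → ℝ) : Set (X → A → X → ℝ) :=
  {q | IsConfOcc h n T δ M q ∧ ∀ i, dot (lowerCost h n T δ C i) (pairMarginal q) ≤ α i}

/-- `q` is a solution of the optimistic linear program if that program is feasible, and any
occupancy measure that is valid for the confidence set otherwise. -/
def IsChoice (M : LoopFreeMDP X A L) (α : Fin m → ℝ) (q : X → A → X → ℝ) : Prop :=
  IsConfOcc h n T δ M q ∧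
    ((feasibleSet h n T δ C M α).Nonempty →
      q ∈ feasibleSet h n T δ C M α ∧
        IsMaxOn (fun q' => dot (upperReward h n T δ C) (pairMarginal q'))
          (feasibleSet h n T δ C M α) q)

end Statistics

/-- The policy `π` is induced by `q`, that is `π(a | x) = q(x, a) / q(x)` wherever `q(x) > 0`
(and `π` is arbitrary at the other states). -/
def IsInducedPolicy {X A : Type*} [Fintype X] [Fintype A] (q : X → A → X → ℝ)
    (π : X → A → ℝ) : Prop :=
  IsPolicy π ∧ ∀ x, (∑ a, pairMarginal q x a) ≠ 0 →
    ∀ a, π x a = pairMarginal q x a / ∑ a', pairMarginal q x a'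

/-! ### The interaction -/

section Interaction

variable {X A Ω : Type*} [Fintype X] [Fintype A] {L m : ℕ}

/-- The mean reward vector under a joint law of rewards and costs. -/
def meanReward (D : Measure ((X → A → ℝ) × (Fin m → X → A → ℝ))) (x : X) (a : A) : ℝ :=
  ∫ z, z.1 x a ∂D

/-- The mean cost matrix under a joint law of rewards and costs. -/
def meanCost (D : Measure ((X → A → ℝ) × (Fin m → X → A → ℝ))) (i : Fin m) (x : X) (a : A) : ℝ :=
  ∫ z, z.2 i x a ∂D

/-- The interaction of a learner and an adversary over `T` episodes, numbered `0, …, T - 1`.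
`ℱ t` is what has happened before episode `t`, including the choice of the policy `π t` by the
learner and of the law `D t` of the rewards and costs by the adversary. Given `ℱ t`, the
trajectory of episode `t` is generated by `π t` and the transition function, and, independently
of it, the rewards and costs of the episode are drawn from `D t`. -/
structure IsInteraction [MeasurableSpace Ω] (M : LoopFreeMDP X A L) (T : ℕ) (μ : Measure Ω)
    (ℱ : Filtration ℕ (inferInstance : MeasurableSpace Ω))
    (D : ℕ → Ω → Measure ((X → A → ℝ) × (Fin m → X → A → ℝ)))
    (π : ℕ → Ω → X → A → ℝ) (ep : ℕ → Ω → Episode X A L m) : Prop where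
  law_prob : ∀ t < T, ∀ ω, IsProbabilityMeasure (D t ω)
  law_range : ∀ t < T, ∀ ω, ∀ᵐ z ∂(D t ω),
    (∀ x a, z.1 x a ∈ Set.Icc (0 : ℝ) 1) ∧ ∀ i x a, z.2 i x a ∈ Set.Icc (0 : ℝ) 1
  law_meas : ∀ t < T, ∀ B, MeasurableSet B → Measurable[ℱ t] fun ω => D t ω B
  policy : ∀ t < T, ∀ ω, IsPolicy (π t ω)
  policy_meas : ∀ t < T, ∀ x a, Measurable[ℱ t] fun ω => π t ω x a
  traj_meas : ∀ t < T, ∀ s b,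
    MeasurableSet[ℱ (t + 1)] {ω | (ep t ω).state = s ∧ (ep t ω).action = b}
  reward_meas : ∀ t < T, ∀ x a, Measurable[ℱ (t + 1)] fun ω => (ep t ω).reward x a
  cost_meas : ∀ t < T, ∀ i x a, Measurable[ℱ (t + 1)] fun ω => (ep t ω).cost i x a
  episode_law : ∀ t < T, ∀ E, MeasurableSet[ℱ t] E → ∀ s b, ∀ B, MeasurableSet B →
    μ (E ∩ {ω | (ep t ω).state = s ∧ (ep t ω).action = b ∧
        ((ep t ω).reward, (ep t ω).cost) ∈ B}) =
      ∫⁻ ω in E, ENNReal.ofReal (M.trajProb (π t ω) s b) * D t ω B ∂μ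

/-- The policies are those of the algorithm with corruption parameter `C` and confidence
parameter `δ`: the first policy is arbitrary, and the policy of each later episode is computed
from the episodes before it. -/
def FollowsNSSOPS [MeasurableSpace Ω] (M : LoopFreeMDP X A L) (T : ℕ) (δ C : ℝ) (α : Fin m → ℝ)
    (μ : Measure Ω) (π : ℕ → Ω → X → A → ℝ) (ep : ℕ → Ω → Episode X A L m) : Prop :=
  ∀ t, t + 1 < T → ∀ᵐ ω ∂μ, ∃ q : X → A → X → ℝ,
    IsChoice (fun τ => ep τ ω) (t + 1) T δ C M α q ∧ IsInducedPolicy q (π (t + 1) ω)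

end Interaction

end NSSOPS

end

/-!
The violation is bounded on an event on which three families of estimates hold, and this event has
probability at least `1 - 4 δ`.

*The estimates.* Along the visits of a fixed pair `(x, a)`, the observed costs minus their
conditional means are martingale differences, and so are the indicators of a transition to `x'`
minus `P(x' | x, a)`. Their exponential moments are controlled episode by episode
(`setLIntegral_exp_cost_le`, `sum_trajProb_mul_exp_transit_le`). The number of visits is random,
so that Chernoff's bound is applied to the sum that is frozen at the `n`-th visit
(`measure_exists_clock_le`), and a union bound over `n` follows. This gives Hoeffding's inequality
for the costs (`measure_cost_tail_le`) and a Bernstein inequality for the transition counts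
(`measure_transit_tail_le`); since the transition indicators are Bernoulli variables, the latter
can be inverted into an interval around the empirical probability (`abs_empTrans_sub_le`) that is
contained in the one of the algorithm. The third estimate is an Azuma–Hoeffding inequality
(`measure_visit_deviation_le`): sums of past-measurable weights over the visited pairs are close to
the sums of the weights against the occupancy measures.

*The corruption.* The mean costs of all episodes are within total distance `C` of a fixed cost
matrix, so that averages over the visits of a pair deviate from the average over all episodes by
at most `C / N + C / T` (`abs_sum_mul_sub_avgCost_le`). Hence the lower confidence bounds of the
costs are below the average costs (`abs_empCost_sub_avgCost_le`), the occupancy measure of a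
feasible policy is feasible for the optimistic program, and the chosen `q` satisfies the optimistic
constraints.

*One episode* (`dot_sub_le`). The violation is at most the distance of the current mean costs to
the average ones, plus twice the confidence radius of the costs against the true occupancy measure
of the policy, plus the 1-norm distance of that occupancy measure to `q`. The last distance is at
most `L` times the transition errors weighted with the true occupancy measure, by induction over
the layers (`l1Norm_pairMarginal_sub_le`).

*Summation.* After Azuma–Hoeffding the radii are summed along the actual visits, where
`∑ 1 / √N ≤ 3 √T` and `∑ 1 / N ≤ 4 log T`. The lower-order term of the transition radius does not
contribute, since the 1-norm distance of two probability vectors is at most `2`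
(`transWidth`), and the sizes of consecutive layers are balanced by the arithmetic-geometric mean
inequality (`sum_sqrt_card_mul_visitCount_le`).
-/

namespace NSSOPS

set_option linter.unusedSectionVars false

/-! ### Occupancy measures of layered trajectories -/

section Chain

variable {X A : Type*} [Fintype X] [Fintype A] {L : ℕ}

open Classical in
/-- The probability that the first `n` steps under `π` produce the states `s` and actions `b`.
For `n = L` this is `LoopFreeMDP.trajProb`; the horizon is a free parameter so that paths can be
extended one step at a time. -/
noncomputable def LoopFreeMDP.pathWeight (M : LoopFreeMDP X A L) (π : X → A → ℝ) (n : ℕ)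
    (s : Fin (n + 1) → X) (b : Fin n → A) : ℝ :=
  (if s 0 = M.start then 1 else 0) *
    ∏ k : Fin n, π (s k.castSucc) (b k) * M.P (s k.castSucc) (b k) (s k.succ)

open Classical in
/-- The probability that `π` is in state `x` after `n` steps. -/
noncomputable def LoopFreeMDP.stateProb (M : LoopFreeMDP X A L) (π : X → A → ℝ) (n : ℕ)
    (x : X) : ℝ :=
  ∑ s : Fin (n + 1) → X, ∑ b : Fin n → A,
    M.pathWeight π n s b * if s (Fin.last n) = x then 1 else 0

variable (M : LoopFreeMDP X A L) {π : X → A → ℝ}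

lemma pathWeight_snoc (n : ℕ) (s : Fin (n + 1) → X) (b : Fin n → A) (a : A) (y : X) :
    M.pathWeight π (n + 1) (Fin.snoc (α := fun _ => X) s y) (Fin.snoc (α := fun _ => A) b a) =
      M.pathWeight π n s b * (π (s (Fin.last n)) a * M.P (s (Fin.last n)) a y) := by
  unfold LoopFreeMDP.pathWeight
  have h0 : (Fin.snoc (α := fun _ => X) s y : Fin (n + 2) → X) 0 = s 0 := by
    have : (0 : Fin (n + 2)) = Fin.castSucc 0 := rfl
    rw [this, Fin.snoc_castSucc]
  rw [Fin.prod_univ_castSucc, h0, mul_assoc]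
  congr 2
  · refine Finset.prod_congr rfl fun k _ => ?_
    rw [← Fin.castSucc_succ, Fin.snoc_castSucc, Fin.snoc_castSucc, Fin.snoc_castSucc]
  · rw [Fin.snoc_castSucc, Fin.snoc_last, Fin.succ_last, Fin.snoc_last]

lemma sum_snoc {B : Type*} [Fintype B] (n : ℕ) (f : (Fin (n + 1) → B) → ℝ) :
    ∑ s, f s = ∑ s : Fin n → B, ∑ y : B, f (Fin.snoc (α := fun _ => B) s y) := by
  rw [← (Fin.snocEquiv (fun _ : Fin (n + 1) => B)).sum_comp, Fintype.sum_prod_type,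
    Finset.sum_comm]
  rfl

lemma sum_path_succ (n : ℕ) (f : (Fin (n + 2) → X) → (Fin (n + 1) → A) → ℝ) :
    ∑ s, ∑ b, f s b = ∑ s : Fin (n + 1) → X, ∑ b : Fin n → A, ∑ a, ∑ y,
      f (Fin.snoc (α := fun _ => X) s y) (Fin.snoc (α := fun _ => A) b a) := by
  rw [sum_snoc]
  refine Finset.sum_congr rfl fun s _ => ?_
  rw [Finset.sum_comm, sum_snoc]

lemma pathWeight_nonneg (hπ : IsPolicy π) (n : ℕ) (s : Fin (n + 1) → X) (b : Fin n → A) :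
    0 ≤ M.pathWeight π n s b := by
  unfold LoopFreeMDP.pathWeight
  refine mul_nonneg (by split_ifs <;> norm_num) (Finset.prod_nonneg fun k _ => ?_)
  exact mul_nonneg (hπ.1 _ _) (M.P_nonneg _ _ _)

lemma layer_of_pathWeight_ne_zero {n : ℕ} {s : Fin (n + 1) → X} {b : Fin n → A}
    (h : M.pathWeight π n s b ≠ 0) (k : Fin (n + 1)) : M.layer (s k) = k := by
  unfold LoopFreeMDP.pathWeight at h
  have h1 := left_ne_zero_of_mul h
  have h2 := right_ne_zero_of_mul h
  rw [Finset.prod_ne_zero_iff] at h2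
  induction k using Fin.induction with
  | zero =>
    have : s 0 = M.start := by
      by_contra hc
      simp [hc] at h1
    rw [this, (M.layer_eq_zero_iff _).2 rfl]
    rfl
  | succ k ih =>
    rw [M.P_layer _ _ _ (right_ne_zero_of_mul (h2 k (Finset.mem_univ _))), ih]
    simp

lemma sum_step (hπ : IsPolicy π) {x : X} (hx : M.layer x < L) :
    ∑ a, ∑ y, π x a * M.P x a y = 1 := by
  simp_rw [← Finset.mul_sum, M.P_sum x _ hx, mul_one]
  exact hπ.2 x

/-- The last step of a path integrates out to one, because all layers before the last one are
left with total probability one. -/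
lemma sum_pathWeight_mul_step (hπ : IsPolicy π) {n : ℕ} (hn : n < L)
    (f : (Fin (n + 1) → X) → (Fin n → A) → ℝ) :
    ∑ s, ∑ b, ∑ a, ∑ y,
      M.pathWeight π n s b * (π (s (Fin.last n)) a * M.P (s (Fin.last n)) a y) * f s b =
    ∑ s, ∑ b, M.pathWeight π n s b * f s b := by
  refine Finset.sum_congr rfl fun s _ => Finset.sum_congr rfl fun b _ => ?_
  by_cases h : M.pathWeight π n s b = 0
  · simp [h]
  · have hl := layer_of_pathWeight_ne_zero M h (Fin.last n)
    have := sum_step M hπ (x := s (Fin.last n)) (by rw [hl]; simpa using hn)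
    rw [← mul_one (M.pathWeight π n s b * f s b), ← this]
    simp_rw [Finset.mul_sum]
    refine Finset.sum_congr rfl fun a _ => Finset.sum_congr rfl fun y _ => ?_
    ring

lemma sum_pathWeight (hπ : IsPolicy π) {n : ℕ} (hn : n ≤ L) :
    ∑ s, ∑ b, M.pathWeight π n s b = 1 := by
  induction n with
  | zero =>
    simp only [LoopFreeMDP.pathWeight, Finset.univ_eq_empty, Finset.prod_empty, mul_one,
      Finset.sum_const, Finset.card_univ, Fintype.card_unique, one_smul]
    rw [Finset.sum_eq_single (fun _ => M.start)]
    · simp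
    · intro s _ hs
      refine if_neg fun h => hs ?_
      ext i
      rw [Fin.fin_one_eq_zero i, h]
    · simp
  | succ n ih =>
    rw [sum_path_succ]
    simp_rw [pathWeight_snoc]
    have := sum_pathWeight_mul_step M hπ (n := n) (by omega) (fun _ _ => 1)
    simp only [mul_one] at this
    rw [this, ih (by omega)]

/-- The joint law of the state, the action and the next state at time `k`. -/
lemma sum_pathWeight_mul (hπ : IsPolicy π) (F : X → A → X → ℝ) (k : ℕ) {n : ℕ} (hk : k < n)
    (hn : n ≤ L) :
    ∑ s, ∑ b, M.pathWeight π n s b *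
        F (s ⟨k, by omega⟩) (b ⟨k, hk⟩) (s ⟨k + 1, by omega⟩) =
      ∑ x, M.stateProb π k x * ∑ a, π x a * ∑ y, M.P x a y * F x a y := by
  induction n with
  | zero => omega
  | succ n ih =>
    rw [sum_path_succ]
    simp_rw [pathWeight_snoc]
    rcases Nat.lt_succ_iff_lt_or_eq.1 hk with hk' | rfl
    · rw [← ih hk' (by omega), ← sum_pathWeight_mul_step M hπ (by omega)]
      refine Finset.sum_congr rfl fun s _ => Finset.sum_congr rfl fun b _ =>
        Finset.sum_congr rfl fun a _ => Finset.sum_congr rfl fun y _ => ?_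
      have e1 : (⟨k, by omega⟩ : Fin (n + 2)) = Fin.castSucc ⟨k, by omega⟩ := rfl
      have e2 : (⟨k + 1, by omega⟩ : Fin (n + 2)) = Fin.castSucc ⟨k + 1, by omega⟩ := rfl
      have e3 : (⟨k, hk⟩ : Fin (n + 1)) = Fin.castSucc ⟨k, hk'⟩ := rfl
      rw [e1, e2, e3, Fin.snoc_castSucc, Fin.snoc_castSucc, Fin.snoc_castSucc]
    · have e1 : (⟨k, by omega⟩ : Fin (k + 2)) = Fin.castSucc (Fin.last k) := rfl
      have e2 : (⟨k + 1, by omega⟩ : Fin (k + 2)) = Fin.last (k + 1) := rfl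
      have e3 : (⟨k, hk⟩ : Fin (k + 1)) = Fin.last k := rfl
      simp_rw [e1, e2, e3, Fin.snoc_castSucc, Fin.snoc_last]
      unfold LoopFreeMDP.stateProb
      simp_rw [Finset.sum_mul]
      rw [Finset.sum_comm (s := Finset.univ (α := X))]
      refine Finset.sum_congr rfl fun s _ => ?_
      rw [Finset.sum_comm (s := Finset.univ (α := X))]
      refine Finset.sum_congr rfl fun b _ => ?_
      rw [Finset.sum_eq_single (s (Fin.last k))]
      · simp_rw [if_true, Finset.mul_sum]
        refine Finset.sum_congr rfl fun a _ => Finset.sum_congr rfl fun y _ => ?_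
        ring
      · intro x _ hx
        simp [Ne.symm hx]
      · simp

lemma stateProb_nonneg (hπ : IsPolicy π) (n : ℕ) (x : X) : 0 ≤ M.stateProb π n x := by
  unfold LoopFreeMDP.stateProb
  refine Finset.sum_nonneg fun s _ => Finset.sum_nonneg fun b _ => ?_
  exact mul_nonneg (pathWeight_nonneg M hπ _ _ _) (by split_ifs <;> norm_num)

lemma stateProb_eq_zero {n : ℕ} {x : X} (h : M.layer x ≠ n) : M.stateProb π n x = 0 := by
  unfold LoopFreeMDP.stateProb
  refine Finset.sum_eq_zero fun s _ => Finset.sum_eq_zero fun b _ => ?_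
  by_cases hw : M.pathWeight π n s b = 0
  · simp [hw]
  · rw [if_neg, mul_zero]
    rintro rfl
    exact h (by rw [layer_of_pathWeight_ne_zero M hw]; simp)

lemma sum_stateProb (hπ : IsPolicy π) {n : ℕ} (hn : n ≤ L) : ∑ x, M.stateProb π n x = 1 := by
  classical
  unfold LoopFreeMDP.stateProb
  rw [Finset.sum_comm]
  refine Eq.trans ?_ (sum_pathWeight M hπ hn)
  refine Finset.sum_congr rfl fun s _ => ?_
  rw [Finset.sum_comm]
  simp

lemma stateProb_succ (n : ℕ) (y : X) :
    M.stateProb π (n + 1) y = ∑ x, M.stateProb π n x * ∑ a, π x a * M.P x a y := by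
  classical
  have h : M.stateProb π (n + 1) y = ∑ s : Fin (n + 1) → X, ∑ b : Fin n → A,
      M.pathWeight π n s b * ∑ a, π (s (Fin.last n)) a * M.P (s (Fin.last n)) a y := by
    rw [LoopFreeMDP.stateProb, sum_path_succ]
    simp_rw [pathWeight_snoc, Fin.snoc_last]
    refine Finset.sum_congr rfl fun s _ => Finset.sum_congr rfl fun b _ => ?_
    simp [Finset.mul_sum]
  rw [h]
  unfold LoopFreeMDP.stateProb
  simp_rw [Finset.sum_mul]
  symm
  rw [Finset.sum_comm]
  refine Finset.sum_congr rfl fun s _ => ?_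
  rw [Finset.sum_comm]
  refine Finset.sum_congr rfl fun b _ => ?_
  simp

lemma trajProb_nonneg (hπ : IsPolicy π) (s : Fin (L + 1) → X) (b : Fin L → A) :
    0 ≤ M.trajProb π s b := pathWeight_nonneg M hπ _ _ _

lemma sum_trajProb (hπ : IsPolicy π) : ∑ s, ∑ b, M.trajProb π s b = 1 :=
  sum_pathWeight M hπ le_rfl

lemma sum_trajProb_mul (hπ : IsPolicy π) (F : X → A → X → ℝ) {k : ℕ} (hk : k < L) :
    ∑ s, ∑ b, M.trajProb π s b *
        F (s (⟨k, hk⟩ : Fin L).castSucc) (b ⟨k, hk⟩) (s (⟨k, hk⟩ : Fin L).succ) =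
      ∑ x, M.stateProb π k x * ∑ a, π x a * ∑ y, M.P x a y * F x a y :=
  sum_pathWeight_mul M hπ F k hk le_rfl

/-- A trajectory that respects the layers can visit `x` only at the time given by the layer of
`x`. -/
lemma exists_visit_iff {s : Fin (L + 1) → X} (hs : ∀ k, M.layer (s k) = k) {x : X}
    (hx : M.layer x < L) (p : Fin L → Prop) :
    (∃ k : Fin L, s k.castSucc = x ∧ p k) ↔
      s (⟨M.layer x, hx⟩ : Fin L).castSucc = x ∧ p ⟨M.layer x, hx⟩ := by
  constructor
  · rintro ⟨k, rfl, h⟩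
    have : (⟨M.layer (s k.castSucc), hx⟩ : Fin L) = k := by
      ext
      simp [hs]
    rw [this]
    exact ⟨rfl, h⟩
  · exact fun h => ⟨_, h⟩

/-- The occupancy measure in product form. -/
lemma occ_eq (hπ : IsPolicy π) (x : X) (a : A) (x' : X) :
    M.occ π x a x' = M.stateProb π (M.layer x) x * π x a * M.P x a x' := by
  classical
  rcases (M.layer_le x).lt_or_eq with hx | hx
  · have h := sum_trajProb_mul M hπ (fun y c y' => if y = x ∧ c = a ∧ y' = x' then 1 else 0) hx
    have h2 : ∑ y, M.stateProb π (M.layer x) y * ∑ c, π y c * ∑ y', M.P y c y' *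
        (if y = x ∧ c = a ∧ y' = x' then 1 else 0) =
        M.stateProb π (M.layer x) x * π x a * M.P x a x' := by
      rw [Finset.sum_eq_single x, Finset.sum_eq_single a, Finset.sum_eq_single x']
      · simp [mul_assoc]
      all_goals simp +contextual
    rw [← h2, ← h]
    unfold LoopFreeMDP.occ
    refine Finset.sum_congr rfl fun s _ => Finset.sum_congr rfl fun b _ => ?_
    by_cases hw : M.trajProb π s b = 0
    · simp [hw]
    · have := exists_visit_iff M (layer_of_pathWeight_ne_zero M hw) hx
        (fun k => b k = a ∧ s k.succ = x')
      simp only [this]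
      simp
  · have hP : M.P x a x' = 0 := by
      by_contra h
      have := M.P_layer _ _ _ h
      have := M.layer_le x'
      omega
    rw [hP, mul_zero]
    unfold LoopFreeMDP.occ
    refine Finset.sum_eq_zero fun s _ => Finset.sum_eq_zero fun b _ => ?_
    rw [ite_eq_right_iff]
    rintro ⟨k, rfl, -, -⟩
    by_contra hw
    have := layer_of_pathWeight_ne_zero M hw k.castSucc
    simp at this
    omega

/-- The probability that `π` visits the pair `(x, a)` before the end of the episode. -/
noncomputable def LoopFreeMDP.pairProb (π : X → A → ℝ) (x : X) (a : A) : ℝ :=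
  if M.layer x < L then M.stateProb π (M.layer x) x * π x a else 0

lemma P_eq_zero_of_top {x : X} (hx : ¬ M.layer x < L) (a : A) (x' : X) : M.P x a x' = 0 := by
  by_contra h
  have := M.P_layer _ _ _ h
  have := M.layer_le x'
  omega

lemma pairMarginal_occ (hπ : IsPolicy π) :
    pairMarginal (M.occ π) = M.pairProb π := by
  ext x a
  unfold pairMarginal LoopFreeMDP.pairProb
  simp_rw [occ_eq M hπ]
  split_ifs with h
  · rw [← Finset.mul_sum, M.P_sum x a h, mul_one]
  · simp [P_eq_zero_of_top M h]

lemma occ_eq_pairProb_mul (hπ : IsPolicy π) (x : X) (a : A) (x' : X) :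
    M.occ π x a x' = M.pairProb π x a * M.P x a x' := by
  rw [occ_eq M hπ]
  unfold LoopFreeMDP.pairProb
  split_ifs with h
  · rfl
  · simp [P_eq_zero_of_top M h]

lemma pairProb_nonneg (hπ : IsPolicy π) (x : X) (a : A) : 0 ≤ M.pairProb π x a := by
  unfold LoopFreeMDP.pairProb
  split_ifs
  · exact mul_nonneg (stateProb_nonneg M hπ _ _) (hπ.1 _ _)
  · exact le_rfl

lemma sum_pairProb_action (hπ : IsPolicy π) {x : X} (hx : M.layer x < L) :
    ∑ a, M.pairProb π x a = M.stateProb π (M.layer x) x := by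
  unfold LoopFreeMDP.pairProb
  simp_rw [if_pos hx, ← Finset.mul_sum, hπ.2 x, mul_one]

open Classical in
lemma sum_layer_stateProb (hπ : IsPolicy π) {k : ℕ} (hk : k ≤ L) :
    ∑ x with M.layer x = k, M.stateProb π (M.layer x) x = 1 := by
  rw [← sum_stateProb M hπ hk, Finset.sum_filter]
  refine Finset.sum_congr rfl fun x _ => ?_
  split_ifs with h
  · rw [h]
  · rw [stateProb_eq_zero M h]

/-- Every episode visits `L` pairs. -/
lemma sum_pairProb (hπ : IsPolicy π) : ∑ x, ∑ a, M.pairProb π x a = L := by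
  classical
  have h : ∀ x, ∑ a, M.pairProb π x a =
      ∑ k ∈ Finset.range L, if M.layer x = k then M.stateProb π (M.layer x) x else 0 := by
    intro x
    rw [Finset.sum_ite_eq]
    by_cases hx : M.layer x < L
    · rw [sum_pairProb_action M hπ hx, if_pos (Finset.mem_range.2 hx)]
    · rw [if_neg (by simpa using hx)]
      simp [LoopFreeMDP.pairProb, hx]
  simp_rw [h]
  rw [Finset.sum_comm]
  rw [Finset.sum_congr rfl (g := fun _ => (1 : ℝ))]
  · simp
  · intro k hk
    rw [← Finset.sum_filter, sum_layer_stateProb M hπ (Finset.mem_range.1 hk).le]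

lemma pairProb_le_one (hπ : IsPolicy π) (x : X) (a : A) : M.pairProb π x a ≤ 1 := by
  classical
  by_cases hx : M.layer x < L
  · calc M.pairProb π x a ≤ ∑ a, M.pairProb π x a :=
          Finset.single_le_sum (fun a _ => pairProb_nonneg M hπ x a) (Finset.mem_univ a)
      _ = M.stateProb π (M.layer x) x := sum_pairProb_action M hπ hx
      _ ≤ ∑ y, M.stateProb π (M.layer x) y :=
          Finset.single_le_sum (f := fun y => M.stateProb π (M.layer x) y)
            (fun y _ => stateProb_nonneg M hπ _ y) (Finset.mem_univ x)
      _ = 1 := sum_stateProb M hπ hx.le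
  · simp [LoopFreeMDP.pairProb, hx]

/-- The state occupancies satisfy the flow equations. -/
lemma stateProb_flow {y : X} (hy : 1 ≤ M.layer y) :
    M.stateProb π (M.layer y) y = ∑ x, ∑ a, M.pairProb π x a * M.P x a y := by
  obtain ⟨n, hn⟩ : ∃ n, M.layer y = n + 1 := ⟨M.layer y - 1, by omega⟩
  rw [hn, stateProb_succ]
  refine Finset.sum_congr rfl fun x _ => ?_
  rw [Finset.mul_sum]
  refine Finset.sum_congr rfl fun a _ => ?_
  by_cases hP : M.P x a y = 0
  · simp [hP]
  · have h1 := M.P_layer _ _ _ hP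
    have h2 := M.layer_le y
    rw [LoopFreeMDP.pairProb, if_pos (by omega)]
    have : M.layer x = n := by omega
    rw [this]
    ring

lemma layer_nonempty [Nonempty A] {k : ℕ} (hk : k ≤ L) : ∃ x, M.layer x = k := by
  induction k with
  | zero => exact ⟨M.start, (M.layer_eq_zero_iff _).2 rfl⟩
  | succ k ih =>
    obtain ⟨x, hx⟩ := ih (by omega)
    obtain ⟨a⟩ := ‹Nonempty A›
    have h := M.P_sum x a (by omega)
    obtain ⟨y, -, hy⟩ := Finset.exists_ne_zero_of_sum_ne_zero (h.trans_ne one_ne_zero)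
    exact ⟨y, by rw [M.P_layer _ _ _ hy, hx]⟩

lemma LoopFreeMDP.succ_le_card [Nonempty A] (M : LoopFreeMDP X A L) : L + 1 ≤ Fintype.card X := by
  choose f hf using fun k : Fin (L + 1) => layer_nonempty M (Nat.lt_succ_iff.1 k.2)
  have : Function.Injective f := fun i j h => by
    ext
    rw [← hf i, ← hf j, h]
  simpa using Fintype.card_le_of_injective f this

end Chain

/-! ### Conditional laws and Chernoff bounds along a random clock -/

section Conditional

variable {Ω : Type*}

lemma lintegral_mul_le_of_setLIntegral_le {𝒢 mΩ : MeasurableSpace Ω} {μ : Measure Ω} (h𝒢 : 𝒢 ≤ mΩ)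
    {f g : Ω → ENNReal} (hf : Measurable f) (hg : Measurable[𝒢] g)
    (h : ∀ E, MeasurableSet[𝒢] E → ∫⁻ ω in E, f ω ∂μ ≤ μ E) :
    ∫⁻ ω, g ω * f ω ∂μ ≤ ∫⁻ ω, g ω ∂μ := by
  have hg' : Measurable g := hg.mono h𝒢 le_rfl
  have hle : (μ.withDensity f).trim h𝒢 ≤ μ.trim h𝒢 := by
    refine Measure.le_iff.2 fun E hE => ?_
    rw [trim_measurableSet_eq h𝒢 hE, trim_measurableSet_eq h𝒢 hE,
      withDensity_apply _ (h𝒢 E hE)]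
    exact h E hE
  calc ∫⁻ ω, g ω * f ω ∂μ = ∫⁻ ω, g ω ∂(μ.withDensity f) := by
        rw [lintegral_withDensity_eq_lintegral_mul μ hf hg']
        simp [mul_comm]
    _ = ∫⁻ ω, g ω ∂((μ.withDensity f).trim h𝒢) := (lintegral_trim h𝒢 hg).symm
    _ ≤ ∫⁻ ω, g ω ∂(μ.trim h𝒢) := lintegral_mono' hle le_rfl
    _ = ∫⁻ ω, g ω ∂μ := lintegral_trim h𝒢 hg

lemma lintegral_mul_eq_of_setLIntegral_eq {𝒢 mΩ : MeasurableSpace Ω} {μ : Measure Ω}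
    (h𝒢 : 𝒢 ≤ mΩ)
    {f₁ f₂ g : Ω → ENNReal} (hf₁ : Measurable f₁) (hf₂ : Measurable f₂) (hg : Measurable[𝒢] g)
    (h : ∀ E, MeasurableSet[𝒢] E → ∫⁻ ω in E, f₁ ω ∂μ = ∫⁻ ω in E, f₂ ω ∂μ) :
    ∫⁻ ω, g ω * f₁ ω ∂μ = ∫⁻ ω, g ω * f₂ ω ∂μ := by
  have hg' : Measurable g := hg.mono h𝒢 le_rfl
  have heq : (μ.withDensity f₁).trim h𝒢 = (μ.withDensity f₂).trim h𝒢 := by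
    refine @Measure.ext _ 𝒢 _ _ fun E hE => ?_
    rw [trim_measurableSet_eq h𝒢 hE, trim_measurableSet_eq h𝒢 hE,
      withDensity_apply _ (h𝒢 E hE), withDensity_apply _ (h𝒢 E hE)]
    exact h E hE
  have key : ∀ f : Ω → ENNReal, Measurable f →
      ∫⁻ ω, g ω * f ω ∂μ = ∫⁻ ω, g ω ∂((μ.withDensity f).trim h𝒢) := by
    intro f hf
    rw [lintegral_trim h𝒢 hg, lintegral_withDensity_eq_lintegral_mul μ hf hg']
    simp [mul_comm]
  rw [key f₁ hf₁, key f₂ hf₂, heq]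

variable [mΩ : MeasurableSpace Ω] {μ : Measure Ω}

/-- A product of conditional supermartingale factors has expectation at most one, and so has the
product of those factors that are selected by past events `S t`. -/
lemma lintegral_prod_le_one [IsProbabilityMeasure μ] (ℱ : Filtration ℕ mΩ) (T : ℕ)
    (f : ℕ → Ω → ENNReal) (S : ℕ → Set Ω)
    (hf : ∀ t < T, Measurable[ℱ (t + 1)] (f t))
    (hS : ∀ t < T, MeasurableSet[ℱ t] (S t))
    (h : ∀ t < T, ∀ E, MeasurableSet[ℱ t] E → ∫⁻ ω in E, f t ω ∂μ ≤ μ E) :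
    ∫⁻ ω, ∏ t ∈ Finset.range T, ((S t).indicator (f t) ω + (S t)ᶜ.indicator 1 ω) ∂μ ≤ 1 := by
  suffices H : ∀ n ≤ T,
      Measurable[ℱ n] (fun ω => ∏ t ∈ Finset.range n,
        ((S t).indicator (f t) ω + (S t)ᶜ.indicator 1 ω)) ∧
      ∫⁻ ω, ∏ t ∈ Finset.range n, ((S t).indicator (f t) ω + (S t)ᶜ.indicator 1 ω) ∂μ ≤ 1 from
    (H T le_rfl).2
  intro n
  induction n with
  | zero => simp
  | succ n ih =>
    intro hn
    obtain ⟨ihm, ihl⟩ := ih (by omega)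
    have hSn : MeasurableSet[ℱ (n + 1)] (S n) := ℱ.mono (Nat.le_succ n) _ (hS n hn)
    have hfac : Measurable[ℱ (n + 1)]
        (fun ω => (S n).indicator (f n) ω + (S n)ᶜ.indicator (1 : Ω → ENNReal) ω) :=
      ((hf n hn).indicator hSn).add (measurable_const.indicator hSn.compl)
    have hfm : Measurable (f n) := (hf n hn).mono (ℱ.le _) le_rfl
    have hSm : MeasurableSet (S n) := ℱ.le _ _ (hS n hn)
    simp_rw [Finset.prod_range_succ]
    refine ⟨(ihm.mono (ℱ.mono (Nat.le_succ n)) le_rfl).mul hfac, le_trans ?_ ihl⟩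
    refine lintegral_mul_le_of_setLIntegral_le (ℱ.le n) (hfac.mono (ℱ.le _) le_rfl) ihm
      fun E hE => ?_
    have hEm : MeasurableSet E := ℱ.le _ _ hE
    rw [lintegral_add_left (hfm.indicator hSm), lintegral_indicator hSm,
      lintegral_indicator hSm.compl, Measure.restrict_restrict hSm,
      Measure.restrict_restrict hSm.compl]
    have h1 := h n hn (S n ∩ E) (MeasurableSet.inter (hS n hn) hE)
    calc _ ≤ μ (S n ∩ E) + μ ((S n)ᶜ ∩ E) := by
          gcongr
          simp
      _ = μ E := by
          rw [Set.inter_comm, Set.inter_comm (S n)ᶜ, ← Set.sdiff_eq, measure_inter_add_sdiff _ hSm]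

/-- Chernoff's bound for a sum of increments `d t` whose exponentials are conditional
supermartingale factors. -/
lemma measure_sum_ge_le [IsProbabilityMeasure μ] (ℱ : Filtration ℕ mΩ) (T : ℕ)
    (d : ℕ → Ω → ℝ) (hd : ∀ t < T, Measurable[ℱ (t + 1)] (d t))
    (h : ∀ t < T, ∀ E, MeasurableSet[ℱ t] E →
      ∫⁻ ω in E, ENNReal.ofReal (Real.exp (d t ω)) ∂μ ≤ μ E)
    (S : ℕ → Set Ω) (hS : ∀ t < T, MeasurableSet[ℱ t] (S t)) (θ : ℝ) :
    μ {ω | θ ≤ ∑ t ∈ Finset.range T, (S t).indicator (d t) ω} ≤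
      ENNReal.ofReal (Real.exp (-θ)) := by
  have hm : ∀ t < T, Measurable[ℱ (t + 1)] fun ω => ENNReal.ofReal (Real.exp (d t ω)) :=
    fun t ht => (Real.measurable_exp.comp (hd t ht)).ennreal_ofReal
  have key := lintegral_prod_le_one (μ := μ) ℱ T
    (fun t ω => ENNReal.ofReal (Real.exp (d t ω))) S hm hS h
  have hprod : ∀ ω, ∏ t ∈ Finset.range T,
      ((S t).indicator (fun ω => ENNReal.ofReal (Real.exp (d t ω))) ω +
        (S t)ᶜ.indicator 1 ω) =
      ENNReal.ofReal (Real.exp (∑ t ∈ Finset.range T, (S t).indicator (d t) ω)) := by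
    intro ω
    rw [Real.exp_sum, ENNReal.ofReal_prod_of_nonneg fun _ _ => (Real.exp_pos _).le]
    refine Finset.prod_congr rfl fun t _ => ?_
    by_cases hω : ω ∈ S t <;> simp [hω]
  simp_rw [hprod] at key
  have hmeas : Measurable fun ω =>
      ENNReal.ofReal (Real.exp (∑ t ∈ Finset.range T, (S t).indicator (d t) ω)) := by
    refine (Real.measurable_exp.comp (Finset.measurable_sum _ fun t ht => ?_)).ennreal_ofReal
    have ht' := Finset.mem_range.1 ht
    exact ((hd t ht').mono (ℱ.le _) le_rfl).indicator (ℱ.le _ _ (hS t ht'))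
  have hpos : ENNReal.ofReal (Real.exp θ) ≠ 0 := by simp [Real.exp_pos]
  calc μ {ω | θ ≤ ∑ t ∈ Finset.range T, (S t).indicator (d t) ω}
      ≤ μ {ω | ENNReal.ofReal (Real.exp θ) ≤
          ENNReal.ofReal (Real.exp (∑ t ∈ Finset.range T, (S t).indicator (d t) ω))} := by
        refine measure_mono fun ω hω => ?_
        exact ENNReal.ofReal_le_ofReal (Real.exp_le_exp.2 hω)
    _ ≤ _ / ENNReal.ofReal (Real.exp θ) :=
        meas_ge_le_lintegral_div hmeas.aemeasurable hpos ENNReal.ofReal_ne_top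
    _ ≤ 1 / ENNReal.ofReal (Real.exp θ) := by gcongr
    _ = ENNReal.ofReal (Real.exp (-θ)) := by
        rw [one_div, ← ENNReal.ofReal_inv_of_pos (Real.exp_pos θ), Real.exp_neg]

/-- Chernoff's bound along a random clock. The clock `∑ τ < t, v τ` is nondecreasing, and the
increments `d` vanish when it stands still. Freezing the sum as soon as the clock shows `n` turns
the bound at a random time into one at the deterministic time `T`. -/
lemma measure_exists_clock_le [IsProbabilityMeasure μ] (ℱ : Filtration ℕ mΩ) (T : ℕ)
    (d v : ℕ → Ω → ℝ) (hd : ∀ t < T, Measurable[ℱ (t + 1)] (d t))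
    (h : ∀ t < T, ∀ E, MeasurableSet[ℱ t] E →
      ∫⁻ ω in E, ENNReal.ofReal (Real.exp (d t ω)) ∂μ ≤ μ E)
    (hv : ∀ t < T, Measurable[ℱ (t + 1)] (v t)) (hv0 : ∀ t ω, 0 ≤ v t ω)
    (hvd : ∀ t ω, v t ω = 0 → d t ω = 0) (n θ : ℝ) :
    μ {ω | ∃ t ≤ T, ∑ τ ∈ Finset.range t, v τ ω = n ∧ θ ≤ ∑ τ ∈ Finset.range t, d τ ω} ≤
      ENNReal.ofReal (Real.exp (-θ)) := by
  set S : ℕ → Set Ω := fun t => {ω | ∑ τ ∈ Finset.range t, v τ ω < n} with hSdef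
  have hS : ∀ t < T, MeasurableSet[ℱ t] (S t) := by
    intro t ht
    refine measurableSet_lt (Finset.measurable_sum _ fun τ hτ => ?_) measurable_const
    have hτ' := Finset.mem_range.1 hτ
    exact (hv τ (hτ'.trans ht)).mono (ℱ.mono (by omega)) le_rfl
  refine le_trans (measure_mono ?_) (measure_sum_ge_le ℱ T d hd h S hS θ)
  rintro ω ⟨t, htT, hn, hθ⟩
  refine hθ.trans_eq ?_
  have hmono : ∀ a b, a ≤ b →
      ∑ τ ∈ Finset.range a, v τ ω ≤ ∑ τ ∈ Finset.range b, v τ ω := fun a b hab =>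
    Finset.sum_le_sum_of_subset_of_nonneg (Finset.range_subset_range.2 hab)
      fun τ _ _ => hv0 τ ω
  obtain ⟨r, rfl⟩ := Nat.exists_eq_add_of_le htT
  rw [Finset.sum_range_add, Finset.sum_eq_zero (s := Finset.range r), add_zero]
  · refine Finset.sum_congr rfl fun τ hτ => ?_
    have hτ' := Finset.mem_range.1 hτ
    by_cases hω : ω ∈ S τ
    · rw [Set.indicator_of_mem hω]
    · rw [Set.indicator_of_notMem hω]
      refine hvd τ ω ?_
      have h1 : n ≤ ∑ τ ∈ Finset.range τ, v τ ω := not_lt.1 hω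
      have h2 := hmono (τ + 1) t hτ'
      rw [Finset.sum_range_succ, hn] at h2
      linarith [hv0 τ ω]
  · intro τ _
    refine Set.indicator_of_notMem (fun hω => ?_) _
    have h1 : ∑ τ ∈ Finset.range (t + τ), v τ ω < n := hω
    linarith [hmono t (t + τ) (by omega)]

end Conditional

section Law

variable {X A Ω : Type*} [Fintype X] [Fintype A] {L m T : ℕ} [mΩ : MeasurableSpace Ω]
  {M : LoopFreeMDP X A L} {μ : Measure Ω} {ℱ : Filtration ℕ mΩ}
  {D : ℕ → Ω → Measure ((X → A → ℝ) × (Fin m → X → A → ℝ))}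
  {π : ℕ → Ω → X → A → ℝ} {ep : ℕ → Ω → Episode X A L m}

lemma measurable_trajProb (hI : IsInteraction M T μ ℱ D π ep) {t : ℕ} (ht : t < T)
    (s : Fin (L + 1) → X) (b : Fin L → A) :
    Measurable[ℱ t] fun ω => M.trajProb (π t ω) s b := by
  unfold LoopFreeMDP.trajProb
  refine Measurable.const_mul (Finset.measurable_prod _ fun k _ => ?_) _
  exact (hI.policy_meas t ht _ _).mul_const _

lemma measurable_samples (hI : IsInteraction M T μ ℱ D π ep) {t : ℕ} (ht : t < T) :
    Measurable[ℱ (t + 1)] fun ω => ((ep t ω).reward, (ep t ω).cost) := by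
  refine Measurable.prodMk ?_ ?_
  · exact @measurable_pi_lambda _ _ _ (ℱ (t + 1)) _ _ fun x =>
      @measurable_pi_lambda _ _ _ (ℱ (t + 1)) _ _ fun a => hI.reward_meas t ht x a
  · exact @measurable_pi_lambda _ _ _ (ℱ (t + 1)) _ _ fun i =>
      @measurable_pi_lambda _ _ _ (ℱ (t + 1)) _ _ fun x =>
        @measurable_pi_lambda _ _ _ (ℱ (t + 1)) _ _ fun a => hI.cost_meas t ht i x a

lemma measurable_law (hI : IsInteraction M T μ ℱ D π ep) {t : ℕ} (ht : t < T) :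
    Measurable[ℱ t] (D t) :=
  Measure.measurable_of_measurable_coe _ fun B hB => hI.law_meas t ht B hB

/-- The event that the trajectory of the episode `t` is `(s, b)`. -/
def trajEvent (ep : ℕ → Ω → Episode X A L m) (t : ℕ) (s : Fin (L + 1) → X) (b : Fin L → A) :
    Set Ω := {ω | (ep t ω).state = s ∧ (ep t ω).action = b}

lemma measurableSet_trajEvent (hI : IsInteraction M T μ ℱ D π ep) {t : ℕ} (ht : t < T)
    (s : Fin (L + 1) → X) (b : Fin L → A) : MeasurableSet[ℱ (t + 1)] (trajEvent ep t s b) :=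
  hI.traj_meas t ht s b

/-- Given the past, the trajectory and the samples of an episode are independent, with laws
`trajProb` and `D t`: the version for sets from the past. -/
lemma setLIntegral_trajEvent (hI : IsInteraction M T μ ℱ D π ep) {t : ℕ} (ht : t < T)
    (s : Fin (L + 1) → X) (b : Fin L → A)
    {φ : (X → A → ℝ) × (Fin m → X → A → ℝ) → ENNReal} (hφ : Measurable φ)
    {E : Set Ω} (hE : MeasurableSet[ℱ t] E) :
    ∫⁻ ω in E ∩ trajEvent ep t s b, φ ((ep t ω).reward, (ep t ω).cost) ∂μ =
      ∫⁻ ω in E, ENNReal.ofReal (M.trajProb (π t ω) s b) * ∫⁻ z, φ z ∂(D t ω) ∂μ := by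
  have hZ := (measurable_samples hI ht).mono (ℱ.le _) le_rfl
  have hp : Measurable fun ω => ENNReal.ofReal (M.trajProb (π t ω) s b) :=
    ((measurable_trajProb hI ht s b).mono (ℱ.le _) le_rfl).ennreal_ofReal
  have hD : Measurable (D t) := (measurable_law hI ht).mono (ℱ.le _) le_rfl
  have hmeas : (μ.restrict (E ∩ trajEvent ep t s b)).map
        (fun ω => ((ep t ω).reward, (ep t ω).cost)) =
      ((μ.restrict E).withDensity fun ω => ENNReal.ofReal (M.trajProb (π t ω) s b)).bind
        (D t) := by
    ext B hB
    rw [Measure.map_apply hZ hB, Measure.restrict_apply (hZ hB),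
      Measure.bind_apply hB hD.aemeasurable,
      lintegral_withDensity_eq_lintegral_mul _ hp (g := fun ω => D t ω B)
        ((Measure.measurable_coe hB).comp hD)]
    have := hI.episode_law t ht E hE s b B hB
    refine Eq.trans ?_ this
    congr 1
    ext ω
    simp only [trajEvent, Set.mem_inter_iff, Set.mem_preimage, Set.mem_ofPred_eq]
    tauto
  rw [← lintegral_map hφ hZ, hmeas, Measure.lintegral_bind hD.aemeasurable hφ.aemeasurable,
    lintegral_withDensity_eq_lintegral_mul _ hp
      (g := fun ω => ∫⁻ z, φ z ∂(D t ω)) ((Measure.measurable_lintegral hφ).comp hD)]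
  rfl

/-- The version of `setLIntegral_trajEvent` with a random variable `h` from the past. -/
lemma lintegral_trajEvent [IsFiniteMeasure μ] (hI : IsInteraction M T μ ℱ D π ep) {t : ℕ}
    (ht : t < T) (s : Fin (L + 1) → X) (b : Fin L → A)
    {φ : (X → A → ℝ) × (Fin m → X → A → ℝ) → ENNReal} (hφ : Measurable φ)
    {h : Ω → ENNReal} (hh : Measurable[ℱ t] h) {E : Set Ω} (hE : MeasurableSet[ℱ t] E) :
    ∫⁻ ω in E ∩ trajEvent ep t s b, h ω * φ ((ep t ω).reward, (ep t ω).cost) ∂μ =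
      ∫⁻ ω in E, ENNReal.ofReal (M.trajProb (π t ω) s b) * (h ω * ∫⁻ z, φ z ∂(D t ω)) ∂μ := by
  have hZ := (measurable_samples hI ht).mono (ℱ.le _) le_rfl
  have hp : Measurable fun ω => ENNReal.ofReal (M.trajProb (π t ω) s b) :=
    ((measurable_trajProb hI ht s b).mono (ℱ.le _) le_rfl).ennreal_ofReal
  have hD : Measurable (D t) := (measurable_law hI ht).mono (ℱ.le _) le_rfl
  have hev : MeasurableSet (trajEvent ep t s b) :=
    ℱ.le _ _ (measurableSet_trajEvent hI ht s b)
  have hEm : MeasurableSet E := ℱ.le _ _ hE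
  have key := lintegral_mul_eq_of_setLIntegral_eq (μ := μ) (ℱ.le t)
    (f₁ := (trajEvent ep t s b).indicator fun ω => φ ((ep t ω).reward, (ep t ω).cost))
    (f₂ := fun ω => ENNReal.ofReal (M.trajProb (π t ω) s b) * ∫⁻ z, φ z ∂(D t ω))
    (g := E.indicator h) ((hφ.comp hZ).indicator hev)
    (hp.mul ((Measure.measurable_lintegral hφ).comp hD)) (hh.indicator hE)
    (fun F hF => by
      rw [setLIntegral_indicator hev, Set.inter_comm]
      exact setLIntegral_trajEvent hI ht s b hφ hF)
  rw [← lintegral_indicator (hEm.inter hev), ← lintegral_indicator hEm]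
  refine Eq.trans (lintegral_congr fun ω => ?_) (key.trans (lintegral_congr fun ω => ?_))
  · by_cases h1 : ω ∈ E <;> by_cases h2 : ω ∈ trajEvent ep t s b <;> simp [h1, h2]
  · by_cases h1 : ω ∈ E
    · simp only [h1, Set.indicator_of_mem]
      ring
    · simp [h1]

/-- Decomposition of an integral according to the trajectory of an episode. -/
lemma setLIntegral_eq_sum_trajEvent (hI : IsInteraction M T μ ℱ D π ep) {t : ℕ} (ht : t < T)
    {E : Set Ω} (hE : MeasurableSet E) (f : Ω → ENNReal) :
    ∫⁻ ω in E, f ω ∂μ = ∑ s, ∑ b, ∫⁻ ω in E ∩ trajEvent ep t s b, f ω ∂μ := by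
  have hU : E = ⋃ p : (Fin (L + 1) → X) × (Fin L → A), E ∩ trajEvent ep t p.1 p.2 := by
    ext ω
    simp [trajEvent]
  conv_lhs => rw [hU]
  rw [lintegral_iUnion, tsum_fintype, Fintype.sum_prod_type]
  · exact fun p => hE.inter (ℱ.le _ _ (measurableSet_trajEvent hI ht _ _))
  · rintro ⟨s, b⟩ ⟨s', b'⟩ hne
    refine Set.disjoint_left.2 fun ω h1 h2 => hne ?_
    obtain ⟨-, h1, h1'⟩ := h1
    obtain ⟨-, h2, h2'⟩ := h2
    simp only [Prod.mk.injEq]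
    exact ⟨h1.symm.trans h2, h1'.symm.trans h2'⟩

/-- A criterion for conditional supermartingale factors: on each trajectory `(s, b)` the factor
is a product of a random variable from the past and a function of the samples. -/
lemma setLIntegral_le_measure [IsFiniteMeasure μ] (hI : IsInteraction M T μ ℱ D π ep) {t : ℕ}
    (ht : t < T) {f : Ω → ENNReal} (g : (Fin (L + 1) → X) → (Fin L → A) → Ω → ENNReal)
    (φ : (Fin (L + 1) → X) → (Fin L → A) → (X → A → ℝ) × (Fin m → X → A → ℝ) → ENNReal)
    (hg : ∀ s b, Measurable[ℱ t] (g s b)) (hφ : ∀ s b, Measurable (φ s b))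
    (hfg : ∀ ω, f ω = g (ep t ω).state (ep t ω).action ω *
      φ (ep t ω).state (ep t ω).action ((ep t ω).reward, (ep t ω).cost))
    (hle : ∀ ω, ∑ s, ∑ b, ENNReal.ofReal (M.trajProb (π t ω) s b) *
      (g s b ω * ∫⁻ z, φ s b z ∂(D t ω)) ≤ 1)
    {E : Set Ω} (hE : MeasurableSet[ℱ t] E) :
    ∫⁻ ω in E, f ω ∂μ ≤ μ E := by
  have hEm : MeasurableSet E := ℱ.le _ _ hE
  have hD : Measurable (D t) := (measurable_law hI ht).mono (ℱ.le _) le_rfl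
  have hgm : ∀ s b, Measurable fun ω => ENNReal.ofReal (M.trajProb (π t ω) s b) *
      (g s b ω * ∫⁻ z, φ s b z ∂(D t ω)) := fun s b =>
    ((measurable_trajProb hI ht s b).mono (ℱ.le _) le_rfl).ennreal_ofReal.mul
      (((hg s b).mono (ℱ.le _) le_rfl).mul ((Measure.measurable_lintegral (hφ s b)).comp hD))
  have hstep : ∀ s b, ∫⁻ ω in E ∩ trajEvent ep t s b, f ω ∂μ =
      ∫⁻ ω in E, ENNReal.ofReal (M.trajProb (π t ω) s b) *
        (g s b ω * ∫⁻ z, φ s b z ∂(D t ω)) ∂μ := by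
    intro s b
    rw [← lintegral_trajEvent hI ht s b (hφ s b) (hg s b) hE]
    refine setLIntegral_congr_fun
      (hEm.inter (ℱ.le _ _ (measurableSet_trajEvent hI ht _ _))) fun ω hω => ?_
    rw [hfg, hω.2.1, hω.2.2]
  rw [setLIntegral_eq_sum_trajEvent hI ht hEm]
  simp_rw [hstep]
  calc _ = ∫⁻ ω in E, ∑ s, ∑ b, ENNReal.ofReal (M.trajProb (π t ω) s b) *
        (g s b ω * ∫⁻ z, φ s b z ∂(D t ω)) ∂μ := by
        rw [lintegral_finsetSum _ fun s _ => Finset.measurable_sum _ fun b _ => hgm s b]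
        refine Finset.sum_congr rfl fun s _ => ?_
        rw [lintegral_finsetSum _ fun b _ => hgm s b]
    _ ≤ ∫⁻ _ in E, 1 ∂μ := lintegral_mono hle
    _ = μ E := by simp

lemma sum_ofReal_trajProb_mul {ρ : X → A → ℝ} (hπ : IsPolicy ρ)
    (g : (Fin (L + 1) → X) → (Fin L → A) → ℝ) (hg : ∀ s b, 0 ≤ g s b) :
    ∑ s, ∑ b, ENNReal.ofReal (M.trajProb ρ s b) * ENNReal.ofReal (g s b) =
      ENNReal.ofReal (∑ s, ∑ b, M.trajProb ρ s b * g s b) := by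
  have h0 : ∀ s b, 0 ≤ M.trajProb ρ s b * g s b := fun s b =>
    mul_nonneg (trajProb_nonneg M hπ s b) (hg s b)
  rw [ENNReal.ofReal_sum_of_nonneg fun s _ => Finset.sum_nonneg fun b _ => h0 s b]
  refine Finset.sum_congr rfl fun s _ => ?_
  rw [ENNReal.ofReal_sum_of_nonneg fun b _ => h0 s b]
  refine Finset.sum_congr rfl fun b _ => ?_
  rw [ENNReal.ofReal_mul (trajProb_nonneg M hπ s b)]

/-- Conditional supermartingale factors that depend on the past and the trajectory only. -/
lemma setLIntegral_traj_le [IsFiniteMeasure μ] (hI : IsInteraction M T μ ℱ D π ep) {t : ℕ}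
    (ht : t < T) (g : (Fin (L + 1) → X) → (Fin L → A) → Ω → ℝ)
    (hg : ∀ s b, Measurable[ℱ t] (g s b)) (hg0 : ∀ s b ω, 0 ≤ g s b ω)
    (hle : ∀ ω, ∑ s, ∑ b, M.trajProb (π t ω) s b * g s b ω ≤ 1)
    {E : Set Ω} (hE : MeasurableSet[ℱ t] E) :
    ∫⁻ ω in E, ENNReal.ofReal (g (ep t ω).state (ep t ω).action ω) ∂μ ≤ μ E := by
  refine setLIntegral_le_measure hI ht (fun s b ω => ENNReal.ofReal (g s b ω)) (fun _ _ _ => 1)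
    (fun s b => (hg s b).ennreal_ofReal) (fun _ _ => measurable_const) (fun ω => by simp)
    (fun ω => ?_) hE
  have := hI.law_prob t ht ω
  simp only [lintegral_const, measure_univ, mul_one]
  rw [sum_ofReal_trajProb_mul (hI.policy t ht ω) _ fun s b => hg0 s b ω, ← ENNReal.ofReal_one]
  exact ENNReal.ofReal_le_ofReal (hle ω)

/-- Almost surely, the trajectory respects the layers. -/
lemma ae_layered [IsFiniteMeasure μ] (hI : IsInteraction M T μ ℱ D π ep) :
    ∀ᵐ ω ∂μ, ∀ t < T, ∀ k, M.layer ((ep t ω).state k) = k := by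
  rw [ae_all_iff]
  intro t
  rw [Filter.eventually_imp_distrib_left]
  intro ht
  classical
  have h : ∀ᵐ ω ∂μ, ∀ p : (Fin (L + 1) → X) × (Fin L → A),
      ω ∈ trajEvent ep t p.1 p.2 → ∀ k, M.layer (p.1 k) = k := by
    rw [ae_all_iff]
    rintro ⟨s, b⟩
    by_cases hs : ∀ k, M.layer (s k) = k
    · exact Filter.Eventually.of_forall fun _ _ => hs
    · have h0 : μ (trajEvent ep t s b) = 0 := by
        have := hI.episode_law t ht Set.univ MeasurableSet.univ s b Set.univ MeasurableSet.univ
        simp only [Set.univ_inter, Set.mem_univ, and_true] at this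
        refine this.trans ?_
        have hz : ∀ ω, M.trajProb (π t ω) s b = 0 := by
          intro ω
          by_contra hne
          exact hs (layer_of_pathWeight_ne_zero M hne)
        simp [hz]
      filter_upwards [measure_eq_zero_iff_ae_notMem.1 h0] with ω hω h
      exact absurd h hω
  filter_upwards [h] with ω hω
  exact hω ((ep t ω).state, (ep t ω).action) ⟨rfl, rfl⟩

/-- Almost surely, the sampled costs lie in `[0, 1]`. -/
lemma ae_cost_mem [IsFiniteMeasure μ] (hI : IsInteraction M T μ ℱ D π ep) :
    ∀ᵐ ω ∂μ, ∀ t < T, ∀ i x a, (ep t ω).cost i x a ∈ Set.Icc (0 : ℝ) 1 := by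
  rw [ae_all_iff]
  intro t
  rw [Filter.eventually_imp_distrib_left]
  intro ht
  simp only [ae_all_iff]
  intro i x a
  set B : Set ((X → A → ℝ) × (Fin m → X → A → ℝ)) := {z | z.2 i x a ∉ Set.Icc (0 : ℝ) 1} with hB
  have hBm : MeasurableSet B := by
    have : Measurable fun z : (X → A → ℝ) × (Fin m → X → A → ℝ) => z.2 i x a := by fun_prop
    exact this measurableSet_Icc.compl
  have h0 := setLIntegral_eq_sum_trajEvent (μ := μ) hI ht MeasurableSet.univ
    fun ω => B.indicator 1 ((ep t ω).reward, (ep t ω).cost)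
  have h1 : ∀ s b, ∫⁻ ω in Set.univ ∩ trajEvent ep t s b,
      B.indicator 1 ((ep t ω).reward, (ep t ω).cost) ∂μ = 0 := by
    intro s b
    rw [setLIntegral_trajEvent hI ht s b (measurable_one.indicator hBm) MeasurableSet.univ]
    have : ∀ ω, ∫⁻ z, B.indicator 1 z ∂(D t ω) = 0 := by
      intro ω
      rw [lintegral_indicator_one hBm]
      refine measure_mono_null ?_ (hI.law_range t ht ω)
      intro z hz h
      exact hz (h.2 i x a)
    simp [this]
  simp only [h1, Finset.sum_const_zero, Measure.restrict_univ] at h0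
  have hZ := (measurable_samples hI ht).mono (ℱ.le _) le_rfl
  have h2 := (lintegral_eq_zero_iff ((measurable_one.indicator hBm).comp hZ)).1 h0
  filter_upwards [h2] with ω hω
  by_contra hc
  have hmem : ((ep t ω).reward, (ep t ω).cost) ∈ B := hc
  simp [hmem] at hω

end Law

/-! ### Exponential moments of the visits and the transitions -/

section Visits

variable {X A : Type*} [Fintype X] [Fintype A] {L m : ℕ}

open Classical in
/-- The indicator that the trajectory `(s, b)` visits the pair `(x, a)`. -/
noncomputable def trajVisit (s : Fin (L + 1) → X) (b : Fin L → A) (x : X) (a : A) : ℝ :=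
  if ∃ k : Fin L, s k.castSucc = x ∧ b k = a then 1 else 0

open Classical in
/-- The indicator that the trajectory `(s, b)` visits the pair `(x, a)` and moves on to `x'`. -/
noncomputable def trajTransit (s : Fin (L + 1) → X) (b : Fin L → A) (x : X) (a : A) (x' : X) : ℝ :=
  if ∃ k : Fin L, s k.castSucc = x ∧ b k = a ∧ s k.succ = x' then 1 else 0

lemma visit_eq (e : Episode X A L m) (x : X) (a : A) :
    e.visit x a = trajVisit e.state e.action x a := rfl

lemma transit_eq (e : Episode X A L m) (x : X) (a : A) (x' : X) :
    e.transit x a x' = trajTransit e.state e.action x a x' := rfl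

lemma trajVisit_eq_zero_or_one (s : Fin (L + 1) → X) (b : Fin L → A) (x : X) (a : A) :
    trajVisit s b x a = 0 ∨ trajVisit s b x a = 1 := by
  unfold trajVisit
  split_ifs <;> simp

lemma trajVisit_nonneg (s : Fin (L + 1) → X) (b : Fin L → A) (x : X) (a : A) :
    0 ≤ trajVisit s b x a := by
  rcases trajVisit_eq_zero_or_one s b x a with h | h <;> simp [h]

lemma trajTransit_le_trajVisit (s : Fin (L + 1) → X) (b : Fin L → A) (x : X) (a : A) (x' : X) :
    trajTransit s b x a x' ≤ trajVisit s b x a := by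
  unfold trajTransit trajVisit
  split_ifs with h1 h2
  · exact le_rfl
  · obtain ⟨k, h⟩ := h1
    exact absurd ⟨k, h.1, h.2.1⟩ h2
  · exact zero_le_one
  · exact le_rfl

lemma trajTransit_nonneg (s : Fin (L + 1) → X) (b : Fin L → A) (x : X) (a : A) (x' : X) :
    0 ≤ trajTransit s b x a x' := by
  unfold trajTransit
  split_ifs <;> simp

lemma sum_trajVisit_le (s : Fin (L + 1) → X) (b : Fin L → A) :
    ∑ x, ∑ a, trajVisit s b x a ≤ L := by
  classical
  have h : ∀ x a, trajVisit s b x a ≤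
      ∑ k : Fin L, if s k.castSucc = x ∧ b k = a then (1 : ℝ) else 0 := by
    intro x a
    unfold trajVisit
    split_ifs with h
    · obtain ⟨k, hk⟩ := h
      refine le_trans ?_ (Finset.single_le_sum (fun k _ => ?_) (Finset.mem_univ k))
      · simp [hk]
      · split_ifs <;> norm_num
    · exact Finset.sum_nonneg fun k _ => by split_ifs <;> norm_num
  calc ∑ x, ∑ a, trajVisit s b x a
      ≤ ∑ x, ∑ a, ∑ k : Fin L, if s k.castSucc = x ∧ b k = a then (1 : ℝ) else 0 :=
        Finset.sum_le_sum fun x _ => Finset.sum_le_sum fun a _ => h x a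
    _ = ∑ k : Fin L, ∑ x, ∑ a, if s k.castSucc = x ∧ b k = a then (1 : ℝ) else 0 := by
        simp_rw [Finset.sum_comm (s := Finset.univ (α := A)) (t := Finset.univ (α := Fin L))]
        rw [Finset.sum_comm]
    _ = L := by simp [ite_and]

variable (M : LoopFreeMDP X A L) {π : X → A → ℝ}

lemma trajVisit_of_layered {s : Fin (L + 1) → X} (hs : ∀ k, M.layer (s k) = k) (b : Fin L → A)
    {x : X} (hx : M.layer x < L) (a : A) [Decidable (s (⟨M.layer x, hx⟩ : Fin L).castSucc = x ∧
      b ⟨M.layer x, hx⟩ = a)] :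
    trajVisit s b x a = if s (⟨M.layer x, hx⟩ : Fin L).castSucc = x ∧ b ⟨M.layer x, hx⟩ = a
      then 1 else 0 := by
  unfold trajVisit
  simp only [exists_visit_iff M hs hx (fun k => b k = a)]

lemma trajTransit_of_layered {s : Fin (L + 1) → X} (hs : ∀ k, M.layer (s k) = k) (b : Fin L → A)
    {x : X} (hx : M.layer x < L) (a : A) (x' : X)
    [Decidable (s (⟨M.layer x, hx⟩ : Fin L).castSucc = x ∧
      b ⟨M.layer x, hx⟩ = a ∧ s (⟨M.layer x, hx⟩ : Fin L).succ = x')] :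
    trajTransit s b x a x' = if s (⟨M.layer x, hx⟩ : Fin L).castSucc = x ∧
      b ⟨M.layer x, hx⟩ = a ∧ s (⟨M.layer x, hx⟩ : Fin L).succ = x' then 1 else 0 := by
  unfold trajTransit
  simp only [exists_visit_iff M hs hx (fun k => b k = a ∧ s k.succ = x')]

lemma trajVisit_of_top {s : Fin (L + 1) → X} (hs : ∀ k, M.layer (s k) = k) (b : Fin L → A)
    {x : X} (hx : ¬ M.layer x < L) (a : A) : trajVisit s b x a = 0 := by
  unfold trajVisit
  rw [if_neg]
  rintro ⟨k, rfl, -⟩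
  simp [hs] at hx

/-- The probability of visiting a pair is its occupancy. -/
lemma sum_trajProb_mul_trajVisit (hπ : IsPolicy π) (x : X) (a : A) :
    ∑ s, ∑ b, M.trajProb π s b * trajVisit s b x a = M.pairProb π x a := by
  classical
  by_cases hx : M.layer x < L
  · have h := sum_trajProb_mul M hπ (fun y c _ => if y = x ∧ c = a then 1 else 0) hx
    have h2 : ∑ y, M.stateProb π (M.layer x) y * ∑ c, π y c * ∑ y', M.P y c y' *
        (if y = x ∧ c = a then 1 else 0) = M.pairProb π x a := by
      rw [Finset.sum_eq_single x, Finset.sum_eq_single a]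
      · simp [LoopFreeMDP.pairProb, hx, M.P_sum x a hx]
      all_goals simp +contextual
    rw [← h2, ← h]
    refine Finset.sum_congr rfl fun s _ => Finset.sum_congr rfl fun b _ => ?_
    by_cases hw : M.trajProb π s b = 0
    · simp [hw]
    · rw [trajVisit_of_layered M (layer_of_pathWeight_ne_zero M hw) b hx]
  · rw [LoopFreeMDP.pairProb, if_neg hx]
    refine Finset.sum_eq_zero fun s _ => Finset.sum_eq_zero fun b _ => ?_
    by_cases hw : M.trajProb π s b = 0
    · simp [hw]
    · rw [trajVisit_of_top M (layer_of_pathWeight_ne_zero M hw) b hx, mul_zero]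

lemma P_le_one {x : X} (hx : M.layer x < L) (a : A) (x' : X) : M.P x a x' ≤ 1 := by
  rw [← M.P_sum x a hx]
  exact Finset.single_le_sum (fun y _ => M.P_nonneg x a y) (Finset.mem_univ x')

/-- The Poisson-type exponential factor of a transition, compensated by the visits. -/
lemma sum_trajProb_mul_exp_transit_le (hπ : IsPolicy π) {x : X} (hx : M.layer x < L) (a : A)
    (x' : X) (c : ℝ) :
    ∑ s, ∑ b, M.trajProb π s b * Real.exp (c * trajTransit s b x a x' -
      M.P x a x' * (Real.exp c - 1) * trajVisit s b x a) ≤ 1 := by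
  classical
  set p := M.P x a x' with hp
  let F : X → A → X → ℝ := fun y d y' => Real.exp
    (c * (if y = x ∧ d = a ∧ y' = x' then 1 else 0) -
      p * (Real.exp c - 1) * (if y = x ∧ d = a then 1 else 0))
  have h := sum_trajProb_mul M hπ F hx
  have h1 : ∑ s, ∑ b, M.trajProb π s b * Real.exp (c * trajTransit s b x a x' -
      p * (Real.exp c - 1) * trajVisit s b x a) =
      ∑ y, M.stateProb π (M.layer x) y * ∑ d, π y d * ∑ y', M.P y d y' * F y d y' := by
    rw [← h]
    refine Finset.sum_congr rfl fun s _ => Finset.sum_congr rfl fun b _ => ?_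
    by_cases hw : M.trajProb π s b = 0
    · simp [hw]
    · have hs := layer_of_pathWeight_ne_zero M hw
      rw [trajVisit_of_layered M hs b hx, trajTransit_of_layered M hs b hx]
  rw [h1, ← sum_stateProb M hπ hx.le]
  refine Finset.sum_le_sum fun y _ => ?_
  by_cases hy : M.layer y = M.layer x
  · refine mul_le_of_le_one_right (stateProb_nonneg M hπ _ _) ?_
    rw [← hπ.2 y]
    refine Finset.sum_le_sum fun d _ => mul_le_of_le_one_right (hπ.1 y d) ?_
    have hsum := M.P_sum y d (by omega)
    by_cases hyd : y = x ∧ d = a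
    · obtain ⟨rfl, rfl⟩ := hyd
      have hF : ∀ y', M.P y d y' * F y d y' = Real.exp (-(p * (Real.exp c - 1))) *
          (M.P y d y' + if y' = x' then p * (Real.exp c - 1) else 0) := by
        intro y'
        by_cases hy' : y' = x'
        · subst hy'
          simp only [F, and_self, if_true, ← hp]
          rw [sub_eq_add_neg, Real.exp_add]
          ring_nf
        · simp [F, hy', mul_comm]
      simp_rw [hF, ← Finset.mul_sum, Finset.sum_add_distrib, hsum]
      rw [Finset.sum_ite_eq', if_pos (Finset.mem_univ _), Real.exp_neg,
        inv_mul_le_one₀ (Real.exp_pos _)]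
      linarith [Real.add_one_le_exp (p * (Real.exp c - 1))]
    · rw [← hsum]
      refine Finset.sum_le_sum fun y' _ => le_of_eq ?_
      have : ¬ (y = x ∧ d = a ∧ y' = x') := fun h => hyd ⟨h.1, h.2.1⟩
      simp [F, hyd, this]
  · rw [stateProb_eq_zero M hy]
    simp

/-- Hoeffding's lemma for a weighted number of visits, in the form that results from
convexity: `exp y ≤ cosh b + (y / b) sinh b` for `|y| ≤ b`. -/
lemma sum_trajProb_mul_exp_visit_le (hπ : IsPolicy π) (u : X → A → ℝ) {c B : ℝ}
    (hu0 : ∀ x a, 0 ≤ u x a) (huc : ∀ x a, u x a ≤ c) (hB : 0 < B) (hcB : c * L ≤ B) (l : ℝ) :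
    ∑ s, ∑ b, M.trajProb π s b * Real.exp
      (l * (∑ x, ∑ a, u x a * (M.pairProb π x a - trajVisit s b x a)) - l ^ 2 * B ^ 2 / 2) ≤
      1 := by
  have hWle : ∀ v : X → A → ℝ, (∀ x a, 0 ≤ v x a) → ∑ x, ∑ a, v x a ≤ L →
      0 ≤ ∑ x, ∑ a, u x a * v x a ∧ ∑ x, ∑ a, u x a * v x a ≤ B := by
    intro v hv hvL
    refine ⟨Finset.sum_nonneg fun x _ => Finset.sum_nonneg fun a _ =>
      mul_nonneg (hu0 x a) (hv x a), ?_⟩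
    by_cases hX : Nonempty (X × A)
    · obtain ⟨x, a⟩ := hX
      have hc : 0 ≤ c := (hu0 x a).trans (huc x a)
      calc ∑ x, ∑ a, u x a * v x a ≤ ∑ x, ∑ a, c * v x a :=
            Finset.sum_le_sum fun x _ => Finset.sum_le_sum fun a _ =>
              mul_le_mul_of_nonneg_right (huc x a) (hv x a)
        _ = c * ∑ x, ∑ a, v x a := by simp_rw [Finset.mul_sum]
        _ ≤ c * L := mul_le_mul_of_nonneg_left hvL hc
        _ ≤ B := hcB
    · refine le_of_eq_of_le (Finset.sum_eq_zero fun x _ => Finset.sum_eq_zero fun a _ => ?_) hB.le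
      exact absurd ⟨(x, a)⟩ hX
  set q := M.pairProb π with hq
  have hqB := hWle q (pairProb_nonneg M hπ) (sum_pairProb M hπ).le
  have hvB := fun s b => hWle (trajVisit s b) (trajVisit_nonneg s b) (sum_trajVisit_le s b)
  have hY : ∀ (s : Fin (L + 1) → X) (b : Fin L → A), ∑ x, ∑ a, u x a * (q x a - trajVisit s b x a) =
      ∑ x, ∑ a, u x a * q x a - ∑ x, ∑ a, u x a * trajVisit s b x a := by
    intro s b
    simp_rw [mul_sub, Finset.sum_sub_distrib]
  have hmean : ∑ s, ∑ b, M.trajProb π s b * (∑ x, ∑ a, u x a * trajVisit s b x a) =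
      ∑ x, ∑ a, u x a * q x a := by
    simp_rw [hq, ← sum_trajProb_mul_trajVisit M hπ, Finset.mul_sum]
    calc _ = ∑ p : (Fin (L + 1) → X) × (Fin L → A), ∑ r : X × A,
          M.trajProb π p.1 p.2 * (u r.1 r.2 * trajVisit p.1 p.2 r.1 r.2) := by
          simp_rw [Fintype.sum_prod_type]
      _ = ∑ r : X × A, ∑ p : (Fin (L + 1) → X) × (Fin L → A),
          M.trajProb π p.1 p.2 * (u r.1 r.2 * trajVisit p.1 p.2 r.1 r.2) := Finset.sum_comm
      _ = _ := by
          simp_rw [Fintype.sum_prod_type]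
          refine Finset.sum_congr rfl fun _ _ => Finset.sum_congr rfl fun _ _ =>
            Finset.sum_congr rfl fun _ _ => Finset.sum_congr rfl fun _ _ => ?_
          ring
  have hconv : ∀ y, -B ≤ y → y ≤ B →
      Real.exp (l * y) ≤ Real.cosh (l * B) + y / B * Real.sinh (l * B) := by
    intro y h1 h2
    have hy1 : 0 ≤ (1 + y / B) / 2 := by
      have : -1 ≤ y / B := by rw [le_div_iff₀ hB]; linarith
      linarith
    have hy2 : 0 ≤ (1 - y / B) / 2 := by
      have : y / B ≤ 1 := by rw [div_le_iff₀ hB]; linarith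
      linarith
    have := convexOn_exp.2 (Set.mem_univ (l * B)) (Set.mem_univ (-(l * B))) hy1 hy2 (by ring)
    simp only [smul_eq_mul] at this
    rw [Real.cosh_eq, Real.sinh_eq]
    have e : (1 + y / B) / 2 * (l * B) + (1 - y / B) / 2 * -(l * B) = l * y := by
      field_simp
      ring
    rw [e] at this
    linarith
  have hterm : ∀ s b, M.trajProb π s b * Real.exp
      (l * (∑ x, ∑ a, u x a * (q x a - trajVisit s b x a)) - l ^ 2 * B ^ 2 / 2) ≤
      Real.exp (-(l ^ 2 * B ^ 2 / 2)) * ((Real.cosh (l * B) +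
        (∑ x, ∑ a, u x a * q x a) / B * Real.sinh (l * B)) * M.trajProb π s b -
        Real.sinh (l * B) / B * (M.trajProb π s b * ∑ x, ∑ a, u x a * trajVisit s b x a)) := by
    intro s b
    rw [hY, sub_eq_add_neg, Real.exp_add]
    have h1 := hconv (∑ x, ∑ a, u x a * q x a - ∑ x, ∑ a, u x a * trajVisit s b x a)
      (by linarith [hqB.1, (hvB s b).2]) (by linarith [hqB.2, (hvB s b).1])
    have h2 := mul_le_mul_of_nonneg_left h1
      (mul_nonneg (trajProb_nonneg M hπ s b) (Real.exp_pos (-(l ^ 2 * B ^ 2 / 2))).le)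
    refine le_of_eq_of_le ?_ (h2.trans_eq ?_) <;> ring
  refine (Finset.sum_le_sum fun s _ => Finset.sum_le_sum fun b _ => hterm s b).trans ?_
  simp_rw [← Finset.mul_sum, Finset.sum_sub_distrib, ← Finset.mul_sum]
  rw [sum_trajProb M hπ, hmean, Real.exp_neg, inv_mul_le_one₀ (Real.exp_pos _)]
  have := Real.cosh_le_exp_half_sq (l * B)
  rw [mul_pow] at this
  refine le_trans (le_of_eq ?_) this
  ring

end Visits

/-! ### Concentration inequalities -/

section Counts

variable {X A : Type*} [Fintype X] [Fintype A] {L m : ℕ} (h : ℕ → Episode X A L m)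

lemma visit_eq_zero_or_one (e : Episode X A L m) (x : X) (a : A) :
    e.visit x a = 0 ∨ e.visit x a = 1 := trajVisit_eq_zero_or_one _ _ _ _

lemma visit_nonneg (e : Episode X A L m) (x : X) (a : A) : 0 ≤ e.visit x a :=
  trajVisit_nonneg _ _ _ _

lemma exists_visitCount_eq (t : ℕ) (x : X) (a : A) : ∃ k ≤ t, visitCount h t x a = (k : ℝ) := by
  induction t with
  | zero => exact ⟨0, le_rfl, by simp [visitCount]⟩
  | succ t ih =>
    obtain ⟨k, hk, hc⟩ := ih
    have hs : visitCount h (t + 1) x a = visitCount h t x a + (h t).visit x a :=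
      Finset.sum_range_succ _ _
    rcases visit_eq_zero_or_one (h t) x a with hv | hv
    · exact ⟨k, by omega, by rw [hs, hv, hc, add_zero]⟩
    · exact ⟨k + 1, by omega, by rw [hs, hv, hc]; push_cast; rfl⟩

lemma visitCount_nonneg (t : ℕ) (x : X) (a : A) : 0 ≤ visitCount h t x a :=
  Finset.sum_nonneg fun _ _ => visit_nonneg _ _ _

lemma transitCount_nonneg (t : ℕ) (x : X) (a : A) (x' : X) : 0 ≤ transitCount h t x a x' :=
  Finset.sum_nonneg fun _ _ => trajTransit_nonneg _ _ _ _ _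

end Counts

section Factors

variable {X A Ω : Type*} [Fintype X] [Fintype A] {L m T : ℕ} [mΩ : MeasurableSpace Ω]
  {M : LoopFreeMDP X A L} {μ : Measure Ω} [IsProbabilityMeasure μ] {ℱ : Filtration ℕ mΩ}
  {D : ℕ → Ω → Measure ((X → A → ℝ) × (Fin m → X → A → ℝ))}
  {π : ℕ → Ω → X → A → ℝ} {ep : ℕ → Ω → Episode X A L m}

lemma measurable_traj (hI : IsInteraction M T μ ℱ D π ep) {t : ℕ} (ht : t < T)
    (g : (Fin (L + 1) → X) → (Fin L → A) → ℝ) :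
    Measurable[ℱ (t + 1)] fun ω => g (ep t ω).state (ep t ω).action := by
  classical
  have h : (fun ω => g (ep t ω).state (ep t ω).action) =
      fun ω => ∑ s, ∑ b, (trajEvent ep t s b).indicator (fun _ => g s b) ω := by
    ext ω
    rw [Finset.sum_eq_single (ep t ω).state, Finset.sum_eq_single (ep t ω).action]
    · simp [trajEvent]
    · intro b _ hb
      exact Set.indicator_of_notMem (fun hmem => hb hmem.2.symm) _
    · simp
    · intro s _ hs
      exact Finset.sum_eq_zero fun b _ =>
        Set.indicator_of_notMem (fun hmem => hs hmem.1.symm) _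
    · simp
  rw [h]
  exact Finset.measurable_sum _ fun s _ => Finset.measurable_sum _ fun b _ =>
    measurable_const.indicator (measurableSet_trajEvent hI ht s b)

lemma measurable_visit (hI : IsInteraction M T μ ℱ D π ep) {t : ℕ} (ht : t < T) (x : X) (a : A) :
    Measurable[ℱ (t + 1)] fun ω => (ep t ω).visit x a :=
  measurable_traj hI ht fun s b => trajVisit s b x a

lemma measurable_visitCount (hI : IsInteraction M T μ ℱ D π ep) {t : ℕ} (ht : t ≤ T)
    (x : X) (a : A) : Measurable[ℱ t] fun ω => visitCount (fun τ => ep τ ω) t x a := by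
  refine Finset.measurable_sum _ fun τ hτ => ?_
  have hτ' := Finset.mem_range.1 hτ
  exact (measurable_visit hI (by omega) x a).mono (ℱ.mono (by omega)) le_rfl

lemma ae_cost_law_mem (hI : IsInteraction M T μ ℱ D π ep) {t : ℕ} (ht : t < T) (ω : Ω)
    (i : Fin m) (x : X) (a : A) : ∀ᵐ z ∂(D t ω), z.2 i x a ∈ Set.Icc (0 : ℝ) 1 := by
  filter_upwards [hI.law_range t ht ω] with z hz using hz.2 i x a

lemma meanCost_mem (hI : IsInteraction M T μ ℱ D π ep) {t : ℕ} (ht : t < T) (ω : Ω)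
    (i : Fin m) (x : X) (a : A) : meanCost (D t ω) i x a ∈ Set.Icc (0 : ℝ) 1 := by
  have := hI.law_prob t ht ω
  have hm : Measurable fun z : (X → A → ℝ) × (Fin m → X → A → ℝ) => z.2 i x a := by fun_prop
  have h := ae_cost_law_mem hI ht ω i x a
  have hint := Integrable.of_mem_Icc 0 1 hm.aemeasurable h
  refine ⟨integral_nonneg_of_ae (h.mono fun z hz => hz.1), ?_⟩
  have := integral_mono_ae hint (integrable_const 1) (h.mono fun z hz => hz.2)
  simpa [meanCost] using this

lemma measurable_meanCost (hI : IsInteraction M T μ ℱ D π ep) {t : ℕ} (ht : t < T)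
    (i : Fin m) (x : X) (a : A) : Measurable[ℱ t] fun ω => meanCost (D t ω) i x a := by
  have hm : Measurable fun z : (X → A → ℝ) × (Fin m → X → A → ℝ) => z.2 i x a := by fun_prop
  have h : (fun ω => meanCost (D t ω) i x a) =
      fun ω => (∫⁻ z, ENNReal.ofReal (z.2 i x a) ∂(D t ω)).toReal := by
    ext ω
    exact integral_eq_lintegral_of_nonneg_ae
      ((ae_cost_law_mem hI ht ω i x a).mono fun z hz => hz.1) hm.aestronglyMeasurable
  rw [h]
  exact ((Measure.measurable_lintegral hm.ennreal_ofReal).comp (measurable_law hI ht)).ennreal_toReal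

/-- Hoeffding's lemma for the cost that is sampled at a visit. -/
lemma setLIntegral_exp_cost_le (hI : IsInteraction M T μ ℱ D π ep) {t : ℕ} (ht : t < T)
    (i : Fin m) (x : X) (a : A) (l : ℝ) {E : Set Ω} (hE : MeasurableSet[ℱ t] E) :
    ∫⁻ ω in E, ENNReal.ofReal (Real.exp ((ep t ω).visit x a *
      (l * ((ep t ω).cost i x a - meanCost (D t ω) i x a) - l ^ 2 / 8))) ∂μ ≤ μ E := by
  have hm : Measurable fun z : (X → A → ℝ) × (Fin m → X → A → ℝ) => z.2 i x a := by fun_prop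
  refine setLIntegral_le_measure hI ht
    (fun s b ω => ENNReal.ofReal (Real.exp (-(trajVisit s b x a *
      (l * meanCost (D t ω) i x a + l ^ 2 / 8)))))
    (fun s b z => ENNReal.ofReal (Real.exp (trajVisit s b x a * (l * z.2 i x a))))
    (fun s b => ?_) (fun s b => ?_) (fun ω => ?_) (fun ω => ?_) hE
  · exact (Real.measurable_exp.comp ((((measurable_meanCost hI ht i x a).const_mul l).add_const
      _).const_mul _).neg).ennreal_ofReal
  · exact (Real.measurable_exp.comp ((hm.const_mul l).const_mul _)).ennreal_ofReal
  · rw [← ENNReal.ofReal_mul (Real.exp_pos _).le, ← Real.exp_add, visit_eq]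
    congr 2
    ring
  · have hπ := hI.policy t ht ω
    have hprob := hI.law_prob t ht ω
    have hsum : ∑ s, ∑ b, ENNReal.ofReal (M.trajProb (π t ω) s b) * ENNReal.ofReal 1 = 1 := by
      rw [sum_ofReal_trajProb_mul hπ (fun _ _ => 1) (fun _ _ => zero_le_one)]
      simp [sum_trajProb M hπ]
    rw [← hsum]
    refine Finset.sum_le_sum fun s _ => Finset.sum_le_sum fun b _ => ?_
    gcongr
    rcases trajVisit_eq_zero_or_one s b x a with hv | hv
    · simp [hv]
    · have hsub := ProbabilityTheory.hasSubgaussianMGF_of_mem_Icc hm.aemeasurable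
        (ae_cost_law_mem hI ht ω i x a)
      have hmgf := hsub.mgf_le l
      have hint := hsub.integrable_exp_mul l
      rw [ProbabilityTheory.mgf] at hmgf
      have hmul : Measurable fun z : (X → A → ℝ) × (Fin m → X → A → ℝ) =>
          ENNReal.ofReal (Real.exp (trajVisit s b x a * (l * z.2 i x a))) :=
        (Real.measurable_exp.comp ((hm.const_mul l).const_mul _)).ennreal_ofReal
      rw [← lintegral_const_mul _ hmul]
      calc _ = ∫⁻ z, ENNReal.ofReal (Real.exp (-(l ^ 2 / 8)) *
            Real.exp (l * (z.2 i x a - ∫ z, z.2 i x a ∂(D t ω)))) ∂(D t ω) := by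
            refine lintegral_congr fun z => ?_
            rw [← ENNReal.ofReal_mul (Real.exp_pos _).le, ← Real.exp_add, ← Real.exp_add, hv,
              meanCost]
            congr 2
            ring
        _ = ENNReal.ofReal (Real.exp (-(l ^ 2 / 8)) *
            ∫ z, Real.exp (l * (z.2 i x a - ∫ z, z.2 i x a ∂(D t ω))) ∂(D t ω)) := by
            rw [← integral_const_mul, ofReal_integral_eq_lintegral_ofReal (hint.const_mul _)]
            exact Filter.Eventually.of_forall fun z =>
              mul_nonneg (Real.exp_pos _).le (Real.exp_pos _).le
        _ ≤ ENNReal.ofReal 1 := by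
            refine ENNReal.ofReal_le_ofReal ?_
            rw [Real.exp_neg, inv_mul_le_one₀ (Real.exp_pos _)]
            refine hmgf.trans (le_of_eq ?_)
            congr 1
            push_cast
            norm_num
            ring

/-- Hoeffding's inequality for the costs observed in the first `n` visits of a pair. -/
lemma measure_cost_deviation_le (hI : IsInteraction M T μ ℱ D π ep) (i : Fin m) (x : X) (a : A)
    {n : ℕ} (hn : 1 ≤ n) {σ : ℝ} (hσ : σ ^ 2 = 1) {c : ℝ} (hc : 0 ≤ c) :
    μ {ω | ∃ t ≤ T, visitCount (fun τ => ep τ ω) t x a = n ∧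
      √(n * c / 2) ≤ σ * ∑ τ ∈ Finset.range t, (ep τ ω).visit x a *
        ((ep τ ω).cost i x a - meanCost (D τ ω) i x a)} ≤ ENNReal.ofReal (Real.exp (-c)) := by
  have hn0 : (0 : ℝ) < n := by exact_mod_cast hn
  -- the minimizer of the Chernoff exponent `l ^ 2 n / 8 - l √(n c / 2)`
  set l := √(8 * c / n) with hl
  have hl2 : l ^ 2 = 8 * c / n := Real.sq_sqrt (by positivity)
  have hσl : (σ * l) ^ 2 = l ^ 2 := by rw [mul_pow, hσ, one_mul]
  refine le_trans (measure_mono ?_) (measure_exists_clock_le ℱ T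
    (fun t ω => (ep t ω).visit x a *
      (σ * l * ((ep t ω).cost i x a - meanCost (D t ω) i x a) - (σ * l) ^ 2 / 8))
    (fun t ω => (ep t ω).visit x a) (fun t ht => ?_)
    (fun t ht E hE => setLIntegral_exp_cost_le hI ht i x a (σ * l) hE)
    (fun t ht => measurable_visit hI ht x a) (fun t ω => visit_nonneg _ x a)
    (fun t ω hv => by simp [hv]) n c)
  · rintro ω ⟨t, ht, hN, hS⟩
    refine ⟨t, ht, hN, ?_⟩
    have hsum : ∑ τ ∈ Finset.range t, (ep τ ω).visit x a *
        (σ * l * ((ep τ ω).cost i x a - meanCost (D τ ω) i x a) - (σ * l) ^ 2 / 8) =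
        l * (σ * ∑ τ ∈ Finset.range t, (ep τ ω).visit x a *
          ((ep τ ω).cost i x a - meanCost (D τ ω) i x a)) - l ^ 2 / 8 * n := by
      rw [← hN, visitCount, hσl, Finset.mul_sum, Finset.mul_sum, Finset.mul_sum,
        ← Finset.sum_sub_distrib]
      exact Finset.sum_congr rfl fun τ _ => by ring
    rw [hsum]
    have h1 := mul_le_mul_of_nonneg_left hS (Real.sqrt_nonneg (8 * c / n))
    rw [← Real.sqrt_mul (by positivity)] at h1
    have h2 : 8 * c / n * (n * c / 2) = (2 * c) ^ 2 := by
      field_simp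
      ring
    rw [h2, Real.sqrt_sq (by positivity), ← hl] at h1
    have h3 : l ^ 2 / 8 * n = c := by
      rw [hl2]
      field_simp
    linarith
  · exact (measurable_visit hI ht x a).mul ((((hI.cost_meas t ht i x a).sub
      ((measurable_meanCost hI ht i x a).mono (ℱ.mono (Nat.le_succ t)) le_rfl)).const_mul
        _).sub_const _)

/-- Chernoff's bound for the transitions to `x'` in the first `n` visits of a pair. -/
lemma measure_transit_le (hI : IsInteraction M T μ ℱ D π ep) {x : X} (hx : M.layer x < L) (a : A)
    (x' : X) (n l c : ℝ) :
    μ {ω | ∃ t ≤ T, visitCount (fun τ => ep τ ω) t x a = n ∧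
      c ≤ l * transitCount (fun τ => ep τ ω) t x a x' - M.P x a x' * (Real.exp l - 1) * n} ≤
      ENNReal.ofReal (Real.exp (-c)) := by
  refine le_trans (measure_mono ?_) (measure_exists_clock_le ℱ T
    (fun t ω => l * (ep t ω).transit x a x' -
      M.P x a x' * (Real.exp l - 1) * (ep t ω).visit x a)
    (fun t ω => (ep t ω).visit x a) (fun t ht => ?_) (fun t ht E hE => ?_)
    (fun t ht => measurable_visit hI ht x a) (fun t ω => visit_nonneg _ x a)
    (fun t ω hv => ?_) n c)
  · rintro ω ⟨t, ht, hN, hS⟩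
    refine ⟨t, ht, hN, hS.trans_eq ?_⟩
    rw [← hN, visitCount, transitCount, Finset.mul_sum, Finset.mul_sum,
      ← Finset.sum_sub_distrib]
  · exact measurable_traj hI ht fun s b => l * trajTransit s b x a x' -
      M.P x a x' * (Real.exp l - 1) * trajVisit s b x a
  · exact setLIntegral_traj_le hI ht
      (fun s b _ => Real.exp (l * trajTransit s b x a x' -
        M.P x a x' * (Real.exp l - 1) * trajVisit s b x a))
      (fun s b => measurable_const) (fun s b ω => (Real.exp_pos _).le)
      (fun ω => sum_trajProb_mul_exp_transit_le M (hI.policy t ht ω) hx a x' l) hE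
  · have h1 : (ep t ω).transit x a x' = 0 :=
      le_antisymm ((trajTransit_le_trajVisit _ _ x a x').trans_eq hv)
        (trajTransit_nonneg _ _ x a x')
    simp [h1, hv]

lemma exp_neg_le_quadratic {y : ℝ} (hy : 0 ≤ y) : Real.exp (-y) ≤ 1 - y + y ^ 2 / 2 := by
  rw [Real.exp_neg]
  have h1 := Real.quadratic_le_exp_of_nonneg hy
  have h2 : 0 < 1 + y + y ^ 2 / 2 := by positivity
  refine (inv_anti₀ h2 h1).trans ?_
  rw [inv_le_iff_one_le_mul₀ h2]
  nlinarith [sq_nonneg (y ^ 2)]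

/-- The lower tail of the transition counts. -/
lemma measure_transit_lower_le (hI : IsInteraction M T μ ℱ D π ep) {x : X} (hx : M.layer x < L)
    (a : A) (x' : X) {n : ℕ} (hn : 1 ≤ n) {c : ℝ} (hc : 0 ≤ c) :
    μ {ω | ∃ t ≤ T, visitCount (fun τ => ep τ ω) t x a = n ∧
      transitCount (fun τ => ep τ ω) t x a x' < n * M.P x a x' - √(2 * c * (n * M.P x a x'))} ≤
      ENNReal.ofReal (Real.exp (-c)) := by
  have hn0 : (0 : ℝ) < n := by exact_mod_cast hn
  rcases (M.P_nonneg x a x').eq_or_lt with hp | hp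
  -- if `P(x' | x, a) = 0`, then the event is empty, because the counts are nonnegative
  · refine le_of_eq_of_le (measure_mono_null (fun ω hω => ?_) measure_empty) zero_le
    obtain ⟨t, -, -, h⟩ := hω
    have := transitCount_nonneg (fun τ => ep τ ω) t x a x'
    rw [← hp] at h
    simp at h
    linarith
  · set w := (n : ℝ) * M.P x a x' with hw
    have hw0 : 0 < w := by positivity
    set y := √(2 * c / w) with hy
    have hy0 : 0 ≤ y := Real.sqrt_nonneg _
    have hy2 : y ^ 2 * w = 2 * c := by
      rw [hy, Real.sq_sqrt (by positivity)]
      field_simp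
    have hyr : y * √(2 * c * w) = 2 * c := by
      rw [hy, ← Real.sqrt_mul (by positivity)]
      have : 2 * c / w * (2 * c * w) = (2 * c) ^ 2 := by field_simp
      rw [this, Real.sqrt_sq (by positivity)]
    refine le_trans (measure_mono ?_) (measure_transit_le hI hx a x' n (-y) c)
    rintro ω ⟨t, ht, hN, hS⟩
    refine ⟨t, ht, hN, ?_⟩
    have h1 := mul_le_mul_of_nonneg_left hS.le hy0
    have h2 := mul_le_mul_of_nonneg_right (exp_neg_le_quadratic hy0) hw0.le
    have h3 : M.P x a x' * (Real.exp (-y) - 1) * n = Real.exp (-y) * w - w := by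
      rw [hw]
      ring
    rw [h3]
    nlinarith

/-- The upper tail of the transition counts. -/
lemma measure_transit_upper_le (hI : IsInteraction M T μ ℱ D π ep) {x : X} (hx : M.layer x < L)
    (a : A) (x' : X) {n : ℕ} {c : ℝ} (hc : 0 ≤ c) :
    μ {ω | ∃ t ≤ T, visitCount (fun τ => ep τ ω) t x a = n ∧
      n * M.P x a x' + √(2 * c * (n * M.P x a x')) + c < transitCount (fun τ => ep τ ω) t x a x'} ≤
      ENNReal.ofReal (Real.exp (-c)) := by
  set w := (n : ℝ) * M.P x a x' with hw
  have hw0 : 0 ≤ w := mul_nonneg (Nat.cast_nonneg _) (M.P_nonneg _ _ _)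
  have h3 : ∀ l, M.P x a x' * (Real.exp l - 1) * n = Real.exp l * w - w := by
    intro l
    rw [hw]
    ring
  -- The optimal exponent `√(2 c / w)` is truncated at `1`: for small `w` the error `w (exp 1 - 2)`
  -- is dominated by `√(2 c w)`, and for large `w` the third-order term of `exp` by `c`.
  rcases lt_or_ge w (2 * c) with hwc | hwc
  · refine le_trans (measure_mono ?_) (measure_transit_le hI hx a x' n 1 c)
    rintro ω ⟨t, ht, hN, hS⟩
    refine ⟨t, ht, hN, ?_⟩
    rw [h3]
    have h1 : w ≤ √(2 * c * w) := Real.le_sqrt_of_sq_le (by nlinarith)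
    have h2 := Real.exp_one_lt_three
    nlinarith
  · rcases hc.eq_or_lt with rfl | hc
    · simpa using prob_le_one
    have hw0 : 0 < w := by linarith
    set y := √(2 * c / w) with hy
    have hy0 : 0 ≤ y := Real.sqrt_nonneg _
    have hy1 : y ≤ 1 := Real.sqrt_le_one.2 ((div_le_one hw0).2 hwc)
    have hy2 : y ^ 2 * w = 2 * c := by
      rw [hy, Real.sq_sqrt (by positivity)]
      field_simp
    have hyr : y * √(2 * c * w) = 2 * c := by
      rw [hy, ← Real.sqrt_mul (by positivity)]
      have : 2 * c / w * (2 * c * w) = (2 * c) ^ 2 := by field_simp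
      rw [this, Real.sqrt_sq (by positivity)]
    refine le_trans (measure_mono ?_) (measure_transit_le hI hx a x' n y c)
    rintro ω ⟨t, ht, hN, hS⟩
    refine ⟨t, ht, hN, ?_⟩
    rw [h3]
    have h1 := mul_le_mul_of_nonneg_left hS.le hy0
    have hexp : Real.exp y ≤ 1 + y + y ^ 2 / 2 + y ^ 3 / 4 := by
      have h := Real.exp_bound (x := y) (by rwa [abs_of_nonneg hy0]) (n := 3) (by norm_num)
      have h := (abs_le.1 h).2
      rw [abs_of_nonneg hy0] at h
      simp [Finset.sum_range_succ, Nat.factorial] at h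
      nlinarith [pow_nonneg hy0 3]
    have h4 := mul_le_mul_of_nonneg_right hexp hw0.le
    have h5 : y ^ 3 * w = y * (2 * c) := by rw [← hy2]; ring
    nlinarith [mul_nonneg hy0 hc.le]

lemma measurable_pairProb (hI : IsInteraction M T μ ℱ D π ep) {t : ℕ} (ht : t < T)
    (x : X) (a : A) : Measurable[ℱ t] fun ω => M.pairProb (π t ω) x a := by
  have h : (fun ω => M.pairProb (π t ω) x a) =
      fun ω => ∑ s, ∑ b, M.trajProb (π t ω) s b * trajVisit s b x a := by
    ext ω
    exact (sum_trajProb_mul_trajVisit M (hI.policy t ht ω) x a).symm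
  rw [h]
  exact Finset.measurable_sum _ fun s _ => Finset.measurable_sum _ fun b _ =>
    (measurable_trajProb hI ht s b).mul_const _

/-- The Azuma–Hoeffding inequality: the expected and the actual visits, with weights from the
past, are close. -/
lemma measure_visit_deviation_le (hI : IsInteraction M T μ ℱ D π ep) (hT : 1 ≤ T)
    (u : ℕ → Ω → X → A → ℝ) {c B : ℝ}
    (hum : ∀ t < T, ∀ x a, Measurable[ℱ t] fun ω => u t ω x a)
    (hu0 : ∀ t ω x a, 0 ≤ u t ω x a) (huc : ∀ t ω x a, u t ω x a ≤ c) (hB : 0 < B)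
    (hcB : c * L ≤ B) {r : ℝ} (hr : 0 ≤ r) :
    μ {ω | B * √(2 * T * r) ≤ ∑ t ∈ Finset.range T, ∑ x, ∑ a,
      u t ω x a * (M.pairProb (π t ω) x a - (ep t ω).visit x a)} ≤
      ENNReal.ofReal (Real.exp (-r)) := by
  have hT0 : (0 : ℝ) < T := by exact_mod_cast hT
  set l := √(2 * r / T) / B with hl
  have hlB : (l * B) ^ 2 * T = 2 * r := by
    rw [hl, div_mul_cancel₀ _ hB.ne', Real.sq_sqrt (by positivity)]
    field_simp
  have hg : ∀ t < T, ∀ v : X → A → ℝ, Measurable[ℱ t] fun ω =>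
      ∑ x, ∑ a, u t ω x a * (M.pairProb (π t ω) x a - v x a) := fun t ht v =>
    Finset.measurable_sum _ fun x _ => Finset.measurable_sum _ fun a _ =>
      (hum t ht x a).mul ((measurable_pairProb hI ht x a).sub_const _)
  refine le_trans (measure_mono ?_) (measure_sum_ge_le ℱ T
    (fun t ω => l * (∑ x, ∑ a, u t ω x a * (M.pairProb (π t ω) x a - (ep t ω).visit x a)) -
      l ^ 2 * B ^ 2 / 2) (fun t ht => ?_) (fun t ht E hE => ?_) (fun _ => Set.univ)
      (fun t _ => MeasurableSet.univ) r)
  · intro ω hω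
    simp only [Set.mem_ofPred_eq, Set.indicator_univ, Finset.sum_sub_distrib, ← Finset.mul_sum,
      Finset.sum_const, Finset.card_range, nsmul_eq_mul] at hω ⊢
    have hl0 : 0 ≤ l := by positivity
    have h1 := mul_le_mul_of_nonneg_left hω hl0
    have h2 : l * (B * √(2 * T * r)) = 2 * r := by
      rw [hl, ← mul_assoc, div_mul_cancel₀ _ hB.ne', ← Real.sqrt_mul (by positivity)]
      have : 2 * r / T * (2 * T * r) = (2 * r) ^ 2 := by field_simp
      rw [this, Real.sqrt_sq (by positivity)]
    rw [h2] at h1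
    nlinarith
  · refine Measurable.sub_const (Measurable.const_mul ?_ _) _
    refine Finset.measurable_sum _ fun x _ => Finset.measurable_sum _ fun a _ => ?_
    have hmono := ℱ.mono (Nat.le_succ t)
    exact ((hum t ht x a).mono hmono le_rfl).mul
      (((measurable_pairProb hI ht x a).mono hmono le_rfl).sub (measurable_visit hI ht x a))
  · exact setLIntegral_traj_le hI ht
      (fun s b ω => Real.exp (l * (∑ x, ∑ a, u t ω x a *
        (M.pairProb (π t ω) x a - trajVisit s b x a)) - l ^ 2 * B ^ 2 / 2))
      (fun s b => Real.measurable_exp.comp (((hg t ht _).const_mul l).sub_const _))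
      (fun s b ω => (Real.exp_pos _).le)
      (fun ω => sum_trajProb_mul_exp_visit_le M (hI.policy t ht ω) (u t ω) (hu0 t ω) (huc t ω)
        hB hcB l) hE

end Factors

/-! ### Perturbation of occupancy measures and the transition confidence set -/

section Perturbation

variable {X A : Type*} [Fintype X] [Fintype A] {L m : ℕ} (M : LoopFreeMDP X A L)
  {h : ℕ → Episode X A L m} {n T : ℕ} {δ : ℝ} {q : X → A → X → ℝ} {π : X → A → ℝ}

lemma pairMarginal_nonneg (hq : IsConfOcc h n T δ M q) (x : X) (a : A) : 0 ≤ pairMarginal q x a :=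
  Finset.sum_nonneg fun x' _ => hq.nonneg x a x'

lemma pairMarginal_of_top (hq : IsConfOcc h n T δ M q) {x : X} (hx : ¬ M.layer x < L) (a : A) :
    pairMarginal q x a = 0 := by
  refine Finset.sum_eq_zero fun x' _ => hq.support x a x' ?_
  have := M.layer_le x'
  omega

lemma pairMarginal_eq_mul (hq : IsConfOcc h n T δ M q) (hπ : IsInducedPolicy q π) (x : X) (a : A) :
    pairMarginal q x a = π x a * ∑ a', pairMarginal q x a' := by
  by_cases h0 : ∑ a', pairMarginal q x a' = 0
  · rw [h0, mul_zero]
    exact (Finset.sum_eq_zero_iff_of_nonneg fun a' _ => pairMarginal_nonneg M hq x a').1 h0 a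
      (Finset.mem_univ a)
  · rw [hπ.2 x h0 a, div_mul_cancel₀ _ h0]

lemma sum_abs_pairMarginal_sub (hq : IsConfOcc h n T δ M q) (hπ : IsInducedPolicy q π) {x : X}
    (hx : M.layer x < L) : ∑ a, |pairMarginal q x a - M.pairProb π x a| =
      |∑ a, pairMarginal q x a - M.stateProb π (M.layer x) x| := by
  have h1 : ∀ a, |pairMarginal q x a - M.pairProb π x a| =
      π x a * |∑ a, pairMarginal q x a - M.stateProb π (M.layer x) x| := by
    intro a
    rw [pairMarginal_eq_mul M hq hπ x a, LoopFreeMDP.pairProb, if_pos hx, mul_comm (M.stateProb _ _ _),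
      ← mul_sub, abs_mul, abs_of_nonneg (hπ.1.1 x a)]
  simp_rw [h1, ← Finset.sum_mul, hπ.1.2 x, one_mul]

/-- One step of the perturbation argument: the transitions of `q` are compared with those of the
true occupancy measure, and the error of the transition function is weighted with the latter. -/
lemma sum_abs_sub_le (hq : IsConfOcc h n T δ M q) (hπ : IsPolicy π) {x : X} (hx : M.layer x < L)
    (a : A) {w : ℝ}
    (hw : ∑ x', |q x a x' - pairMarginal q x a * M.P x a x'| ≤ pairMarginal q x a * w)
    (hw0 : 0 ≤ w) :
    ∑ x', |q x a x' - M.pairProb π x a * M.P x a x'| ≤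
      |pairMarginal q x a - M.pairProb π x a| + M.pairProb π x a * w := by
  set Q := pairMarginal q x a with hQ
  set r := M.pairProb π x a with hr
  have hr0 : 0 ≤ r := pairProb_nonneg M hπ x a
  rcases (pairMarginal_nonneg M hq x a).eq_or_lt with h0 | h0
  · have hq0 : ∀ x', q x a x' = 0 := fun x' =>
      (Finset.sum_eq_zero_iff_of_nonneg fun x' _ => hq.nonneg x a x').1 h0.symm x'
        (Finset.mem_univ x')
    have h1 : ∀ x', |q x a x' - r * M.P x a x'| = r * M.P x a x' := fun x' => by
      rw [hq0, zero_sub, abs_neg, abs_of_nonneg (mul_nonneg hr0 (M.P_nonneg _ _ _))]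
    simp_rw [h1, ← Finset.mul_sum, M.P_sum x a hx]
    rw [hQ, ← h0, zero_sub, abs_neg, abs_of_nonneg hr0]
    nlinarith [mul_nonneg hr0 hw0]
  · have hQ0 : Q ≠ 0 := h0.ne'
    have h1 : ∀ x', |q x a x' - r * M.P x a x'| ≤
        |Q - r| / Q * q x a x' + r / Q * |q x a x' - Q * M.P x a x'| := by
      intro x'
      have e : q x a x' - r * M.P x a x' =
          (Q - r) / Q * q x a x' + r / Q * (q x a x' - Q * M.P x a x') := by
        field_simp
        ring
      rw [e]
      refine (abs_add_le _ _).trans (le_of_eq ?_)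
      rw [abs_mul, abs_mul, abs_div, abs_div, abs_of_nonneg hr0, abs_of_pos h0,
        abs_of_nonneg (hq.nonneg x a x')]
    refine (Finset.sum_le_sum fun x' _ => h1 x').trans ?_
    rw [Finset.sum_add_distrib, ← Finset.mul_sum, ← Finset.mul_sum]
    have h2 : |Q - r| / Q * ∑ x', q x a x' = |Q - r| := div_mul_cancel₀ _ h0.ne'
    have h3 : r / Q * ∑ x', |q x a x' - Q * M.P x a x'| ≤ r / Q * (Q * w) :=
      mul_le_mul_of_nonneg_left hw (by positivity)
    have h4 : r / Q * (Q * w) = r * w := by field_simp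
    linarith

/-- The state-action occupancies of `q` in layer `k` differ from those of the induced policy by
at most the errors of the transition function that were made in the layers before. -/
lemma sum_layer_abs_sub_le (hq : IsConfOcc h n T δ M q) (hπ : IsInducedPolicy q π) {w : X → A → ℝ}
    (hw0 : ∀ x a, 0 ≤ w x a)
    (hw : ∀ x a, M.layer x < L →
      ∑ x', |q x a x' - pairMarginal q x a * M.P x a x'| ≤ pairMarginal q x a * w x a)
    {k : ℕ} (hk : k < L) :
    ∑ x with M.layer x = k, ∑ a, |pairMarginal q x a - M.pairProb π x a| ≤
      ∑ x with M.layer x < k, ∑ a, M.pairProb π x a * w x a := by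
  induction k with
  | zero =>
    refine le_of_eq_of_le ?_ (Finset.sum_nonneg fun x _ => Finset.sum_nonneg fun a _ =>
      mul_nonneg (pairProb_nonneg M hπ.1 x a) (hw0 x a))
    have hf : (Finset.univ.filter fun x => M.layer x = 0) = {M.start} := by
      ext x
      simp [M.layer_eq_zero_iff]
    have h1 := hq.mass 0 hk
    have h2 := sum_layer_stateProb M hπ.1 (Nat.zero_le L)
    have hs : M.layer M.start = 0 := (M.layer_eq_zero_iff _).2 rfl
    simp only [hf, Finset.sum_singleton] at h1 h2 ⊢
    rw [sum_abs_pairMarginal_sub M hq hπ (by omega), h2]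
    unfold pairMarginal
    rw [h1, sub_self, abs_zero]
  | succ k ih =>
    classical
    have hstep : ∀ x, M.layer x = k + 1 → ∑ a, |pairMarginal q x a - M.pairProb π x a| ≤
        ∑ y with M.layer y = k, ∑ a, |q y a x - M.pairProb π y a * M.P y a x| := by
      intro x hx
      rw [sum_abs_pairMarginal_sub M hq hπ (by omega), stateProb_flow M (by omega)]
      have hflow := hq.flow x (by omega) (by omega)
      unfold pairMarginal
      rw [hflow, ← Finset.sum_sub_distrib, Finset.sum_filter]
      refine (Finset.abs_sum_le_sum_abs _ _).trans (Finset.sum_le_sum fun y _ => ?_)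
      rw [← Finset.sum_sub_distrib]
      split_ifs with hy
      · exact Finset.abs_sum_le_sum_abs _ _
      · refine le_of_eq (abs_eq_zero.2 (Finset.sum_eq_zero fun a _ => ?_))
        have hP : M.P y a x = 0 := by
          by_contra hP
          have := M.P_layer _ _ _ hP
          omega
        rw [hq.support y a x (by omega), hP, mul_zero, sub_zero]
    calc _ ≤ ∑ x with M.layer x = k + 1, ∑ y with M.layer y = k, ∑ a,
          |q y a x - M.pairProb π y a * M.P y a x| :=
          Finset.sum_le_sum fun x hx => hstep x (Finset.mem_filter.1 hx).2
      _ ≤ ∑ x, ∑ y with M.layer y = k, ∑ a, |q y a x - M.pairProb π y a * M.P y a x| :=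
          Finset.sum_le_sum_of_subset_of_nonneg (Finset.filter_subset _ _) fun x _ _ =>
            Finset.sum_nonneg fun y _ => Finset.sum_nonneg fun a _ => abs_nonneg _
      _ = ∑ y with M.layer y = k, ∑ a, ∑ x, |q y a x - M.pairProb π y a * M.P y a x| := by
          rw [Finset.sum_comm]
          exact Finset.sum_congr rfl fun y _ => Finset.sum_comm
      _ ≤ ∑ y with M.layer y = k, ∑ a, (|pairMarginal q y a - M.pairProb π y a| +
          M.pairProb π y a * w y a) := by
          refine Finset.sum_le_sum fun y hy => Finset.sum_le_sum fun a _ => ?_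
          have hy' : M.layer y < L := by
            have := (Finset.mem_filter.1 hy).2
            omega
          exact sum_abs_sub_le M hq hπ.1 hy' a (hw y a hy') (hw0 y a)
      _ = ∑ y with M.layer y = k, ∑ a, |pairMarginal q y a - M.pairProb π y a| +
          ∑ y with M.layer y = k, ∑ a, M.pairProb π y a * w y a := by
          simp_rw [Finset.sum_add_distrib]
      _ ≤ ∑ x with M.layer x < k, ∑ a, M.pairProb π x a * w x a +
          ∑ y with M.layer y = k, ∑ a, M.pairProb π y a * w y a := by
          gcongr
          exact ih (by omega)
      _ = _ := by
          rw [← Finset.sum_union]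
          · refine Finset.sum_congr ?_ fun _ _ => rfl
            ext x
            simp only [Finset.mem_union, Finset.mem_filter, Finset.mem_univ, true_and]
            omega
          · rw [Finset.disjoint_filter]
            intro x _ h1 h2
            omega

/-- The occupancy measure of a policy that is induced by `q` is close to `q` if the transition
function of `q` is close to the true one. -/
lemma l1Norm_pairMarginal_sub_le (hq : IsConfOcc h n T δ M q) (hπ : IsInducedPolicy q π)
    {w : X → A → ℝ} (hw0 : ∀ x a, 0 ≤ w x a)
    (hw : ∀ x a, M.layer x < L →
      ∑ x', |q x a x' - pairMarginal q x a * M.P x a x'| ≤ pairMarginal q x a * w x a) :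
    ∑ x, ∑ a, |pairMarginal q x a - M.pairProb π x a| ≤
      L * ∑ x, ∑ a, M.pairProb π x a * w x a := by
  have h1 : ∀ x, ∑ a, |pairMarginal q x a - M.pairProb π x a| = ∑ k ∈ Finset.range L,
      if M.layer x = k then ∑ a, |pairMarginal q x a - M.pairProb π x a| else 0 := by
    intro x
    rw [Finset.sum_ite_eq]
    by_cases hx : M.layer x < L
    · rw [if_pos (Finset.mem_range.2 hx)]
    · rw [if_neg (by simpa using hx)]
      refine Finset.sum_eq_zero fun a _ => ?_
      rw [pairMarginal_of_top M hq hx, LoopFreeMDP.pairProb, if_neg hx, sub_zero, abs_zero]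
  rw [Finset.sum_congr rfl fun x _ => h1 x, Finset.sum_comm]
  calc _ ≤ ∑ k ∈ Finset.range L, ∑ x, ∑ a, M.pairProb π x a * w x a := by
        refine Finset.sum_le_sum fun k hk => ?_
        rw [← Finset.sum_filter]
        refine (sum_layer_abs_sub_le M hq hπ hw0 hw (Finset.mem_range.1 hk)).trans ?_
        exact Finset.sum_le_sum_of_subset_of_nonneg (Finset.filter_subset _ _) fun x _ _ =>
          Finset.sum_nonneg fun a _ => mul_nonneg (pairProb_nonneg M hπ.1 x a) (hw0 x a)
    _ = _ := by simp

end Perturbation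

section Confidence

variable {X A : Type*} [Fintype X] [Fintype A] {L m : ℕ} (M : LoopFreeMDP X A L)
  (h : ℕ → Episode X A L m) (n T : ℕ) (δ : ℝ)

/-- The true transition function lies in the confidence set after `n` episodes. -/
def InConfidenceSet : Prop := ∀ x a x', M.layer x < L →
  |empTrans h n x a x' - M.P x a x'| ≤ transRadius h n T δ x a x'

/-- The bound that the confidence set yields for the 1-norm distance between two transition
probabilities of the pair `(x, a)`. Because of the trivial bound `2`, the lower-order term of the
confidence radius can be absorbed into the square root. -/
noncomputable def transWidth (x : X) (a : A) : ℝ :=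
  min 2 (25 * √((Finset.univ.filter fun y => M.layer y = M.layer x + 1).card *
    Real.log (T * Fintype.card X * Fintype.card A / δ) / max 1 (visitCount h n x a)))

variable {h n T δ}

lemma transWidth_nonneg (x : X) (a : A) : 0 ≤ transWidth M h n T δ x a :=
  le_min zero_le_two (by positivity)

/-- If the true transition function lies in the confidence set, then its occupancy measures are
candidates of the learner. -/
lemma isConfOcc_occ {π : X → A → ℝ} (hπ : IsPolicy π) (hconf : InConfidenceSet M h n T δ) :
    IsConfOcc h n T δ M (M.occ π) := by
  have hpm : ∀ x a, ∑ y, M.occ π x a y = M.pairProb π x a := fun x a =>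
    congrFun (congrFun (pairMarginal_occ M hπ) x) a
  refine ⟨fun x a x' => ?_, fun x a x' hx => ?_, fun k hk => ?_, fun x h1 h2 => ?_,
    fun x a x' hx => ?_, fun x a x' hx => ?_⟩
  · rw [occ_eq_pairProb_mul M hπ]
    exact mul_nonneg (pairProb_nonneg M hπ x a) (M.P_nonneg x a x')
  · rw [occ_eq_pairProb_mul M hπ]
    by_cases hP : M.P x a x' = 0
    · rw [hP, mul_zero]
    · exact absurd (M.P_layer _ _ _ hP) hx
  · simp_rw [hpm]
    rw [← sum_layer_stateProb M hπ hk.le]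
    refine Finset.sum_congr (by congr) fun x hx => sum_pairProb_action M hπ ?_
    rw [(Finset.mem_filter.1 hx).2]
    exact hk
  · simp_rw [hpm]
    rw [sum_pairProb_action M hπ h2, stateProb_flow M h1]
    simp_rw [occ_eq_pairProb_mul M hπ]
  · have hx' : M.layer x < L := by
      have := M.layer_le x'
      omega
    rw [hpm, occ_eq_pairProb_mul M hπ, mul_comm]
    refine mul_le_mul_of_nonneg_right ?_ (pairProb_nonneg M hπ x a)
    linarith [(abs_le.1 (hconf x a x' hx')).1]
  · have hx' : M.layer x < L := by
      have := M.layer_le x'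
      omega
    rw [hpm, occ_eq_pairProb_mul M hπ, mul_comm (M.pairProb π x a)]
    refine mul_le_mul_of_nonneg_right ?_ (pairProb_nonneg M hπ x a)
    linarith [(abs_le.1 (hconf x a x' hx')).2]

lemma max_one_sub_one_ge (N : ℝ) : max 1 N / 2 ≤ max 1 (N - 1) := by
  rcases le_total N 2 with hN | hN
  · exact le_max_of_le_left (by linarith [max_le (by norm_num : (1 : ℝ) ≤ 2) hN])
  · refine le_max_of_le_right ?_
    rw [max_eq_right (by linarith)]
    linarith

lemma empTrans_nonneg (x : X) (a : A) (x' : X) : 0 ≤ empTrans h n x a x' :=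
  div_nonneg (transitCount_nonneg h n x a x') (le_trans zero_le_one (le_max_left _ _))

/-- On trajectories that respect the layers, a pair is visited at most once per episode. -/
lemma sum_empTrans_le_one (hlay : ∀ τ < n, ∀ k, M.layer ((h τ).state k) = k) {x : X}
    (hx : M.layer x < L) (a : A) : ∑ x', empTrans h n x a x' ≤ 1 := by
  classical
  unfold empTrans
  rw [← Finset.sum_div, div_le_one (lt_of_lt_of_le one_pos (le_max_left _ _))]
  refine le_trans ?_ (le_max_right _ _)
  unfold transitCount visitCount
  rw [Finset.sum_comm]
  refine Finset.sum_le_sum fun τ hτ => le_of_eq ?_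
  have hs := hlay τ (Finset.mem_range.1 hτ)
  simp_rw [transit_eq, visit_eq]
  rw [trajVisit_of_layered M hs _ hx]
  simp_rw [trajTransit_of_layered M hs _ hx]
  simp [← and_assoc, ite_and]

lemma sum_transRadius_le (hlay : ∀ τ < n, ∀ k, M.layer ((h τ).state k) = k) {x : X}
    (hx : M.layer x < L) (a : A)
    (hι : 0 ≤ Real.log (T * Fintype.card X * Fintype.card A / δ)) :
    min 2 (2 * ∑ x' with M.layer x' = M.layer x + 1, transRadius h n T δ x a x') ≤
      transWidth M h n T δ x a := by
  unfold transWidth transRadius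
  set ι := Real.log (T * Fintype.card X * Fintype.card A / δ) with hιdef
  set S := Finset.univ.filter fun y => M.layer y = M.layer x + 1 with hS
  set N := visitCount h n x a with hN
  set K := max 1 (N - 1) with hK
  have hK0 : 0 < K := lt_of_lt_of_le one_pos (le_max_left _ _)
  have hN0 : 0 < max 1 N := lt_of_lt_of_le one_pos (le_max_left _ _)
  set z := √(S.card * ι / max 1 N) with hz
  have hz0 : 0 ≤ z := Real.sqrt_nonneg _
  have hz2 : z ^ 2 = S.card * ι / max 1 N := Real.sq_sqrt (by positivity)
  have hι2 : ι / K ≤ 2 * (ι / max 1 N) := by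
    have h1 : ι / K ≤ ι / (max 1 N / 2) :=
      div_le_div_of_nonneg_left hι (by positivity) (max_one_sub_one_ge N)
    refine h1.trans (le_of_eq ?_)
    field_simp
  have hsq : ∑ x' ∈ S, √(empTrans h n x a x' * ι / K) ≤ 3 / 2 * z := by
    have h1 : ∀ x', √(empTrans h n x a x' * ι / K) = √(empTrans h n x a x') * √(ι / K) := by
      intro x'
      rw [mul_div_assoc, Real.sqrt_mul (empTrans_nonneg x a x')]
    simp_rw [h1]
    calc _ ≤ √(∑ x' ∈ S, empTrans h n x a x') * √(∑ _x' ∈ S, ι / K) :=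
          Real.sum_sqrt_mul_sqrt_le _ (fun x' => empTrans_nonneg x a x') fun _ => by positivity
      _ ≤ 1 * √((9 / 4) * (S.card * ι / max 1 N)) := by
          gcongr
          · rw [← Real.sqrt_one]
            refine Real.sqrt_le_sqrt (le_trans ?_ (sum_empTrans_le_one M hlay hx a))
            exact Finset.sum_le_sum_of_subset_of_nonneg (Finset.filter_subset _ _)
              fun x' _ _ => empTrans_nonneg x a x'
          · rw [Finset.sum_const, nsmul_eq_mul, mul_div_assoc]
            have : (0 : ℝ) ≤ S.card * (ι / max 1 N) := by positivity
            nlinarith [mul_le_mul_of_nonneg_left hι2 (Nat.cast_nonneg (α := ℝ) S.card)]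
      _ = 3 / 2 * z := by
          rw [one_mul, Real.sqrt_mul (by norm_num)]
          congr 1
          rw [show (9 / 4 : ℝ) = (3 / 2) ^ 2 by norm_num, Real.sqrt_sq (by norm_num)]
  have hlin : (S.card : ℝ) * (14 * ι / (3 * K)) ≤ 28 / 3 * z ^ 2 := by
    rw [hz2]
    have : 14 * ι / (3 * K) = 14 / 3 * (ι / K) := by
      field_simp
    rw [this, mul_div_assoc]
    nlinarith [mul_le_mul_of_nonneg_left hι2 (Nat.cast_nonneg (α := ℝ) S.card)]
  have htot : 2 * ∑ x' ∈ S, (2 * √(empTrans h n x a x' * ι / K) + 14 * ι / (3 * K)) ≤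
      6 * z + 56 / 3 * z ^ 2 := by
    rw [Finset.sum_add_distrib, ← Finset.mul_sum, Finset.sum_const, nsmul_eq_mul]
    linarith
  refine le_min (min_le_left _ _) ?_
  -- either `z ^ 2 ≤ z`, or the trivial bound `2` is below `25 z`
  rcases le_total z 1 with h1 | h1
  · refine (min_le_right _ _).trans (htot.trans ?_)
    nlinarith
  · refine (min_le_left _ _).trans ?_
    linarith

/-- A candidate of the learner and the true transition function differ by at most the width of
the confidence set. -/
lemma sum_abs_sub_mul_le (hlay : ∀ τ < n, ∀ k, M.layer ((h τ).state k) = k)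
    (hconf : InConfidenceSet M h n T δ)
    (hι : 0 ≤ Real.log (T * Fintype.card X * Fintype.card A / δ))
    {q : X → A → X → ℝ} (hq : IsConfOcc h n T δ M q) {x : X} (hx : M.layer x < L) (a : A) :
    ∑ x', |q x a x' - pairMarginal q x a * M.P x a x'| ≤
      pairMarginal q x a * transWidth M h n T δ x a := by
  have hQ0 := pairMarginal_nonneg M hq x a
  refine le_trans ?_ (mul_le_mul_of_nonneg_left (sum_transRadius_le M hlay hx a hι) hQ0)
  rw [mul_min_of_nonneg _ _ hQ0]
  refine le_min ?_ ?_
  · calc _ ≤ ∑ x', (q x a x' + pairMarginal q x a * M.P x a x') := by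
          refine Finset.sum_le_sum fun x' _ => ?_
          have h1 := hq.nonneg x a x'
          have h2 := mul_nonneg hQ0 (M.P_nonneg x a x')
          rw [abs_le]
          constructor <;> linarith
      _ = pairMarginal q x a * 2 := by
          rw [Finset.sum_add_distrib, ← Finset.mul_sum, M.P_sum x a hx]
          change pairMarginal q x a + _ = _
          ring
  · rw [mul_left_comm, Finset.mul_sum, Finset.mul_sum, Finset.sum_filter]
    refine Finset.sum_le_sum fun x' _ => ?_
    split_ifs with hx'
    · have h1 := hq.upper x a x' hx'
      have h2 := hq.lower x a x' hx'
      change _ ≤ _ * pairMarginal q x a at h1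
      change _ * pairMarginal q x a ≤ _ at h2
      obtain ⟨h3, h4⟩ := abs_le.1 (hconf x a x' hx)
      rw [abs_le]
      constructor <;> nlinarith
    · rw [hq.support x a x' hx']
      have hP : M.P x a x' = 0 := by
        by_contra hP
        exact hx' (M.P_layer _ _ _ hP)
      simp [hP]

/-- The tails of the transition counts, with confidence `2 ι`, put the true transition
probability into the confidence set. The square root of the unknown probability is exchanged for
that of its estimate by solving a quadratic inequality. -/
lemma abs_empTrans_sub_le {x : X} {a : A} {x' : X} (hp1 : M.P x a x' ≤ 1)
    (hι : 1 / 2 ≤ Real.log (T * Fintype.card X * Fintype.card A / δ))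
    (htail : 1 ≤ visitCount h n x a →
      visitCount h n x a * M.P x a x' - √(2 * (2 * Real.log (T * Fintype.card X * Fintype.card A / δ))
        * (visitCount h n x a * M.P x a x')) ≤ transitCount h n x a x' ∧
      transitCount h n x a x' ≤ visitCount h n x a * M.P x a x' +
        √(2 * (2 * Real.log (T * Fintype.card X * Fintype.card A / δ)) *
          (visitCount h n x a * M.P x a x')) +
        2 * Real.log (T * Fintype.card X * Fintype.card A / δ)) :
    |empTrans h n x a x' - M.P x a x'| ≤ transRadius h n T δ x a x' := by
  unfold transRadius
  set ι := Real.log (T * Fintype.card X * Fintype.card A / δ) with hιdef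
  have hι0 : 0 < ι := by linarith
  set p := M.P x a x' with hp
  have hp0 : 0 ≤ p := M.P_nonneg x a x'
  obtain ⟨k, -, hk⟩ := exists_visitCount_eq h n x a
  rcases Nat.eq_zero_or_pos k with rfl | hkpos
  -- without visits the radius is `14 ι / 3`, which exceeds one
  · have hN : visitCount h n x a = 0 := by rw [hk]; simp
    have hM : transitCount h n x a x' = 0 := by
      refine le_antisymm ?_ (transitCount_nonneg h n x a x')
      rw [← hN]
      exact Finset.sum_le_sum fun τ _ => trajTransit_le_trajVisit _ _ x a x'
    unfold empTrans
    rw [hM, hN, zero_div, zero_sub, abs_neg, abs_of_nonneg hp0]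
    norm_num
    linarith
  · have hN1 : 1 ≤ visitCount h n x a := by rw [hk]; exact_mod_cast hkpos
    obtain ⟨hlo, hup⟩ := htail hN1
    unfold empTrans
    set N := visitCount h n x a with hN
    set S := transitCount h n x a x' with hS
    have hN0 : 0 < N := by linarith
    have hS0 : 0 ≤ S := transitCount_nonneg h n x a x'
    rw [max_eq_right hN1]
    set p' := S / N with hp'
    have hp'0 : 0 ≤ p' := by positivity
    have hSp : S = N * p' := by rw [hp']; field_simp
    set b := ι / N with hb
    have hb0 : 0 < b := by positivity
    have hιb : ι = N * b := by rw [hb]; field_simp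
    have hroot : √(2 * (2 * ι) * (N * p)) = N * (2 * √(p * b)) := by
      have : 2 * (2 * ι) * (N * p) = (2 * N) ^ 2 * (p * b) := by
        rw [hιb]
        ring
      rw [this, Real.sqrt_mul (by positivity), Real.sqrt_sq (by positivity)]
      ring
    rw [hroot, hSp] at hlo hup
    rw [hιb] at hup
    have hlo' : p - 2 * √(p * b) ≤ p' := by
      have : N * (p - 2 * √(p * b)) ≤ N * p' := by linarith
      exact le_of_mul_le_mul_left this hN0
    have hup' : p' ≤ p + 2 * √(p * b) + 2 * b := by
      have : N * p' ≤ N * (p + 2 * √(p * b) + 2 * b) := by linarith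
      exact le_of_mul_le_mul_left this hN0
    set r := √(p' * b) with hr
    have hr0 : 0 ≤ r := Real.sqrt_nonneg _
    have hr2 : r ^ 2 = p' * b := Real.sq_sqrt (by positivity)
    have hs2 : √(p * b) ^ 2 = p * b := Real.sq_sqrt (by positivity)
    have hs0 : 0 ≤ √(p * b) := Real.sqrt_nonneg _
    have hmain : |p' - p| ≤ 2 * r + 4 * b := by
      rw [abs_le]
      constructor
      · by_contra hc
        push Not at hc
        have h1 : (p - p') ^ 2 ≤ 4 * (p * b) := by
          rw [← hs2]
          nlinarith
        nlinarith [mul_nonneg hr0 hb0.le]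
      · rcases le_total p p' with hpp | hpp
        · have : √(p * b) ≤ r := Real.sqrt_le_sqrt (by gcongr)
          linarith
        · linarith
    have hK : max 1 (N - 1) ≤ N := max_le hN1 (by linarith)
    have hK0 : 0 < max 1 (N - 1) := lt_of_lt_of_le one_pos (le_max_left _ _)
    have h1 : r ≤ √(p' * ι / max 1 (N - 1)) := by
      refine Real.sqrt_le_sqrt ?_
      rw [hb, ← mul_div_assoc]
      gcongr
    have h2 : 4 * b ≤ 14 * ι / (3 * max 1 (N - 1)) := by
      have h3 : ι / N ≤ ι / max 1 (N - 1) := by gcongr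
      have h4 : 14 * ι / (3 * max 1 (N - 1)) = 14 / 3 * (ι / max 1 (N - 1)) := by
        field_simp
      rw [h4, hb]
      have : 0 ≤ ι / max 1 (N - 1) := by positivity
      linarith
    linarith

end Confidence

/-! ### Corruption, cost confidence intervals and sums along the visits -/

section Corruption

variable {X A : Type*} [Fintype X] [Fintype A] {m : ℕ}

lemma l1Norm_nonneg (u : X → A → ℝ) : 0 ≤ l1Norm u :=
  Finset.sum_nonneg fun _ _ => Finset.sum_nonneg fun _ _ => abs_nonneg _

lemma abs_le_l1Norm (u : X → A → ℝ) (x : X) (a : A) : |u x a| ≤ l1Norm u :=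
  (Finset.single_le_sum (f := fun a => |u x a|) (fun _ _ => abs_nonneg _)
    (Finset.mem_univ a)).trans
    (Finset.single_le_sum (f := fun x => ∑ a, |u x a|)
      (fun _ _ => Finset.sum_nonneg fun _ _ => abs_nonneg _) (Finset.mem_univ x))

lemma costCorruption_nonneg (T : ℕ) (gbar : ℕ → Fin m → X → A → ℝ) :
    0 ≤ costCorruption T gbar := by
  refine Real.sInf_nonneg ?_
  rintro _ ⟨g, -, rfl⟩
  exact Finset.sum_nonneg fun t _ => Real.iSup_nonneg fun i => l1Norm_nonneg _

lemma exists_near_costs {T : ℕ} {gbar : ℕ → Fin m → X → A → ℝ} {C η : ℝ}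
    (hC : costCorruption T gbar ≤ C) (hη : 0 < η) :
    ∃ g : Fin m → X → A → ℝ, ∀ i, ∑ t ∈ Finset.range T, l1Norm (gbar t i - g i) ≤ C + η := by
  have hne : ((fun g : Fin m → X → A → ℝ =>
      ∑ t ∈ Finset.range T, ⨆ i : Fin m, l1Norm (gbar t i - g i)) ''
    {g | ∀ i x a, g i x a ∈ Set.Icc (0 : ℝ) 1}).Nonempty :=
    ⟨_, ⟨fun _ _ _ => 0, by simp, rfl⟩⟩
  obtain ⟨_, ⟨g, -, rfl⟩, hg⟩ := exists_lt_of_csInf_lt hne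
    (lt_of_le_of_lt hC (lt_add_of_pos_right C hη))
  refine ⟨g, fun i => le_trans (Finset.sum_le_sum fun t _ => ?_) hg.le⟩
  exact le_ciSup (f := fun i => l1Norm (gbar t i - g i)) (Set.finite_range _).bddAbove i

/-- The average of the mean costs. -/
noncomputable def avgCost (T : ℕ) (gbar : ℕ → Fin m → X → A → ℝ) (i : Fin m) (x : X) (a : A) : ℝ :=
  (1 / (T : ℝ)) * ∑ t ∈ Finset.range T, gbar t i x a

lemma abs_avgCost_sub_le {T : ℕ} (hT : 1 ≤ T) (gbar : ℕ → Fin m → X → A → ℝ) (i : Fin m) (x : X)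
    (a : A) (c : ℝ) :
    T * |c - avgCost T gbar i x a| ≤ ∑ t ∈ Finset.range T, |gbar t i x a - c| := by
  have hT0 : (0 : ℝ) < T := by exact_mod_cast hT
  have h : T * (c - avgCost T gbar i x a) = ∑ t ∈ Finset.range T, (c - gbar t i x a) := by
    rw [Finset.sum_sub_distrib, Finset.sum_const, Finset.card_range, nsmul_eq_mul, avgCost]
    field_simp
  rw [← abs_of_pos hT0, ← abs_mul, h]
  refine (Finset.abs_sum_le_sum_abs _ _).trans (le_of_eq ?_)
  exact Finset.sum_congr rfl fun t _ => abs_sub_comm _ _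

/-- The mean costs stay close to their average. -/
lemma sum_l1Norm_sub_avgCost_le {T : ℕ} (hT : 1 ≤ T) {gbar : ℕ → Fin m → X → A → ℝ} {C : ℝ}
    (hC : costCorruption T gbar ≤ C) (i : Fin m) :
    ∑ t ∈ Finset.range T, ∑ x, ∑ a, |gbar t i x a - avgCost T gbar i x a| ≤ 2 * C := by
  refine le_of_forall_pos_le_add fun η hη => ?_
  obtain ⟨g, hg⟩ := exists_near_costs hC (half_pos hη)
  have h1 : ∑ t ∈ Finset.range T, ∑ x, ∑ a, |gbar t i x a - avgCost T gbar i x a| ≤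
      ∑ t ∈ Finset.range T, ∑ x, ∑ a,
        (|gbar t i x a - g i x a| + |g i x a - avgCost T gbar i x a|) :=
    Finset.sum_le_sum fun t _ => Finset.sum_le_sum fun x _ => Finset.sum_le_sum fun a _ =>
      abs_sub_le _ _ _
  have h2 : ∑ t ∈ Finset.range T, ∑ x, ∑ a, |gbar t i x a - g i x a| ≤ C + η / 2 := hg i
  have h3 : ∑ t ∈ Finset.range T, ∑ x, ∑ a, |g i x a - avgCost T gbar i x a| ≤
      ∑ t ∈ Finset.range T, ∑ x, ∑ a, |gbar t i x a - g i x a| := by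
    rw [Finset.sum_const, Finset.card_range, nsmul_eq_mul, Finset.mul_sum, Finset.sum_comm]
    refine Finset.sum_le_sum fun x _ => ?_
    rw [Finset.mul_sum, Finset.sum_comm]
    exact Finset.sum_le_sum fun a _ => abs_avgCost_sub_le hT gbar i x a (g i x a)
  simp_rw [Finset.sum_add_distrib] at h1
  linarith

/-- Along a selection `v` of the episodes, the mean costs stay close to their average. -/
lemma abs_sum_mul_sub_avgCost_le {T : ℕ} (hT : 1 ≤ T) {gbar : ℕ → Fin m → X → A → ℝ} {C : ℝ}
    (hC : costCorruption T gbar ≤ C) (i : Fin m) (x : X) (a : A) {v : ℕ → ℝ} (hv0 : ∀ t, 0 ≤ v t)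
    (hv1 : ∀ t, v t ≤ 1) {n : ℕ} (hn : n ≤ T) :
    |∑ t ∈ Finset.range n, v t * (gbar t i x a - avgCost T gbar i x a)| ≤
      C + (∑ t ∈ Finset.range n, v t) * C / T := by
  have hT0 : (0 : ℝ) < T := by exact_mod_cast hT
  set V := ∑ t ∈ Finset.range n, v t with hV
  have hV0 : 0 ≤ V := Finset.sum_nonneg fun t _ => hv0 t
  have key : ∀ η > 0, |∑ t ∈ Finset.range n, v t * (gbar t i x a - avgCost T gbar i x a)| ≤
      (C + η) + V * (C + η) / T := by
    intro η hη
    obtain ⟨g, hg⟩ := exists_near_costs hC hη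
    have h1 : ∑ t ∈ Finset.range T, |gbar t i x a - g i x a| ≤ C + η :=
      (Finset.sum_le_sum fun t _ => abs_le_l1Norm (gbar t i - g i) x a).trans (hg i)
    have h2 : |g i x a - avgCost T gbar i x a| ≤ (C + η) / T := by
      rw [le_div_iff₀ hT0, mul_comm]
      exact (abs_avgCost_sub_le hT gbar i x a (g i x a)).trans h1
    calc _ ≤ ∑ t ∈ Finset.range n, (|gbar t i x a - g i x a| +
          v t * |g i x a - avgCost T gbar i x a|) := by
          refine (Finset.abs_sum_le_sum_abs _ _).trans (Finset.sum_le_sum fun t _ => ?_)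
          rw [abs_mul, abs_of_nonneg (hv0 t)]
          have h3 := abs_sub_le (gbar t i x a) (g i x a) (avgCost T gbar i x a)
          nlinarith [hv0 t, hv1 t, abs_nonneg (gbar t i x a - g i x a)]
      _ = ∑ t ∈ Finset.range n, |gbar t i x a - g i x a| +
          V * |g i x a - avgCost T gbar i x a| := by
          rw [Finset.sum_add_distrib, ← Finset.sum_mul]
      _ ≤ ∑ t ∈ Finset.range T, |gbar t i x a - g i x a| + V * ((C + η) / T) := by
          gcongr
      _ ≤ _ := by
          rw [mul_div_assoc]
          linarith
  refine le_of_forall_pos_le_add fun η hη => ?_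
  have h1 : 0 < 1 + V / T := by positivity
  refine (key (η / (1 + V / T)) (by positivity)).trans (le_of_eq ?_)
  field_simp

end Corruption

section CostConfidence

variable {X A : Type*} [Fintype X] [Fintype A] {L m : ℕ} {h : ℕ → Episode X A L m} {n T : ℕ}
  {δ C : ℝ}

lemma empCost_mem (hcost : ∀ τ < n, ∀ i x a, (h τ).cost i x a ∈ Set.Icc (0 : ℝ) 1) (i : Fin m)
    (x : X) (a : A) : empCost h n i x a ∈ Set.Icc (0 : ℝ) 1 := by
  unfold empCost
  have hK : 0 < max (visitCount h n x a) 1 := lt_of_lt_of_le one_pos (le_max_right _ _)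
  constructor
  · exact div_nonneg (Finset.sum_nonneg fun τ hτ => mul_nonneg (visit_nonneg _ _ _)
      (hcost τ (Finset.mem_range.1 hτ) i x a).1) hK.le
  · rw [div_le_one hK]
    refine le_trans (Finset.sum_le_sum fun τ hτ => ?_) (le_max_left _ _)
    exact mul_le_of_le_one_right (visit_nonneg _ _ _) (hcost τ (Finset.mem_range.1 hτ) i x a).2

lemma costRadius_nonneg (hC : 0 ≤ C) (x : X) (a : A) : 0 ≤ costRadius h n T δ C x a := by
  unfold costRadius
  have hK : 0 < max (visitCount h n x a) 1 := lt_of_lt_of_le one_pos (le_max_right _ _)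
  exact le_min zero_le_one (by positivity)

lemma costRadius_le_one (x : X) (a : A) : costRadius h n T δ C x a ≤ 1 := min_le_left _ _

/-- Hoeffding's inequality for the observed costs, together with the corruption bound, yields
the confidence interval of the average costs. -/
lemma abs_empCost_sub_avgCost_le (hT : 1 ≤ T) (hn : n ≤ T) {gbar : ℕ → Fin m → X → A → ℝ}
    (hC : costCorruption T gbar ≤ C)
    (hcost : ∀ τ < n, ∀ i x a, (h τ).cost i x a ∈ Set.Icc (0 : ℝ) 1)
    (hgbar : ∀ t < T, ∀ i x a, gbar t i x a ∈ Set.Icc (0 : ℝ) 1) (i : Fin m) (x : X) (a : A)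
    (hι : 2 ≤ Real.log (2 * m * T * Fintype.card X * Fintype.card A / δ))
    (htail : 1 ≤ visitCount h n x a →
      |∑ τ ∈ Finset.range n, (h τ).visit x a * ((h τ).cost i x a - gbar τ i x a)| ≤
        √(visitCount h n x a * Real.log (2 * m * T * Fintype.card X * Fintype.card A / δ) / 2)) :
    |empCost h n i x a - avgCost T gbar i x a| ≤ costRadius h n T δ C x a := by
  have hT0 : (0 : ℝ) < T := by exact_mod_cast hT
  have hC0 : 0 ≤ C := (costCorruption_nonneg T gbar).trans hC
  have havg : avgCost T gbar i x a ∈ Set.Icc (0 : ℝ) 1 := by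
    unfold avgCost
    rw [one_div, inv_mul_eq_div]
    constructor
    · exact div_nonneg (Finset.sum_nonneg fun t ht => (hgbar t (Finset.mem_range.1 ht) i x a).1)
        hT0.le
    · rw [div_le_one hT0]
      refine (Finset.sum_le_sum fun t ht => (hgbar t (Finset.mem_range.1 ht) i x a).2).trans ?_
      simp
  have hemp := empCost_mem hcost i x a
  unfold costRadius
  set ι := Real.log (2 * m * T * Fintype.card X * Fintype.card A / δ) with hιdef
  refine le_min ?_ ?_
  · rw [abs_le]
    constructor <;> linarith [havg.1, havg.2, hemp.1, hemp.2]
  · obtain ⟨k, -, hk⟩ := exists_visitCount_eq h n x a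
    rcases Nat.eq_zero_or_pos k with rfl | hkpos
    -- without visits the square root in the radius is at least one
    · have h1 : |empCost h n i x a - avgCost T gbar i x a| ≤ 1 := by
        rw [abs_le]
        constructor <;> linarith [havg.1, havg.2, hemp.1, hemp.2]
      have h2 : 1 ≤ √(ι / (2 * max (visitCount h n x a) 1)) := by
        rw [hk]
        simp only [Nat.cast_zero, zero_le_one, max_eq_right]
        rw [Real.one_le_sqrt]
        linarith
      have h3 : 0 < max (visitCount h n x a) 1 := lt_of_lt_of_le one_pos (le_max_right _ _)
      have h4 : 0 ≤ C / max (visitCount h n x a) 1 := by positivity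
      have h5 : 0 ≤ C / T := by positivity
      linarith
    · have hN1 : 1 ≤ visitCount h n x a := by rw [hk]; exact_mod_cast hkpos
      have htail := htail hN1
      have hcor := abs_sum_mul_sub_avgCost_le hT hC i x a (v := fun τ => (h τ).visit x a)
        (fun τ => visit_nonneg _ x a)
        (fun τ => by rcases visit_eq_zero_or_one (h τ) x a with h | h <;> simp [h]) hn
      change _ ≤ C + visitCount h n x a * C / T at hcor
      unfold empCost
      rw [max_eq_left hN1]
      have hNdef : visitCount h n x a = ∑ τ ∈ Finset.range n, (h τ).visit x a := rfl
      set N := visitCount h n x a with hN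
      have hN0 : 0 < N := by linarith
      have e : N * ((∑ τ ∈ Finset.range n, (h τ).visit x a * (h τ).cost i x a) / N -
          avgCost T gbar i x a) =
          ∑ τ ∈ Finset.range n, (h τ).visit x a * ((h τ).cost i x a - gbar τ i x a) +
          ∑ τ ∈ Finset.range n, (h τ).visit x a * (gbar τ i x a - avgCost T gbar i x a) := by
        rw [mul_sub, mul_div_cancel₀ _ hN0.ne', ← Finset.sum_add_distrib, hNdef, Finset.sum_mul,
          ← Finset.sum_sub_distrib]
        exact Finset.sum_congr rfl fun τ _ => by ring
      have hroot : √(N * ι / 2) = N * √(ι / (2 * N)) := by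
        have : N * ι / 2 = N ^ 2 * (ι / (2 * N)) := by field_simp
        rw [this, Real.sqrt_mul (by positivity), Real.sqrt_sq hN0.le]
      rw [hroot] at htail
      refine le_of_mul_le_mul_left ?_ hN0
      rw [← abs_of_pos hN0, ← abs_mul, abs_of_pos hN0, e]
      refine (abs_add_le _ _).trans ((add_le_add htail hcor).trans (le_of_eq ?_))
      field_simp
      ring

end CostConfidence

section Sums

variable {X A : Type*} [Fintype X] [Fintype A] {L m : ℕ} (h : ℕ → Episode X A L m)

lemma visitCount_succ (t : ℕ) (x : X) (a : A) :
    visitCount h (t + 1) x a = visitCount h t x a + (h t).visit x a :=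
  Finset.sum_range_succ _ _

lemma visitCount_le (t : ℕ) (x : X) (a : A) : visitCount h t x a ≤ t := by
  obtain ⟨k, hk, e⟩ := exists_visitCount_eq h t x a
  rw [e]
  exact_mod_cast hk

lemma sum_visit_div_sqrt_le (T : ℕ) (x : X) (a : A) :
    ∑ t ∈ Finset.range T, (h t).visit x a * √(1 / max 1 (visitCount h t x a)) ≤
      3 * √(visitCount h T x a) := by
  induction T with
  | zero => simp
  | succ T ih =>
    rw [Finset.sum_range_succ, visitCount_succ]
    rcases visit_eq_zero_or_one (h T) x a with hv | hv
    · simpa [hv] using ih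
    · rw [hv, one_mul]
      obtain ⟨k, -, hk⟩ := exists_visitCount_eq h T x a
      rw [hk] at ih ⊢
      rcases Nat.eq_zero_or_pos k with rfl | hkpos
      · simp at ih ⊢
        linarith
      · have hk1 : (1 : ℝ) ≤ k := by exact_mod_cast hkpos
        rw [max_eq_right hk1, Real.sqrt_div zero_le_one, Real.sqrt_one]
        set r := √(k : ℝ) with hr
        set z := √((k : ℝ) + 1) with hz
        have hr2 : r ^ 2 = k := Real.sq_sqrt (by positivity)
        have hz2 : z ^ 2 = k + 1 := Real.sq_sqrt (by positivity)
        have hr0 : 0 < r := Real.sqrt_pos.2 (by linarith)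
        have hz0 : 0 ≤ z := Real.sqrt_nonneg _
        have h1 : z ≤ 2 * r := by nlinarith
        have h2 : 1 / r ≤ 3 * (z - r) := by
          rw [div_le_iff₀ hr0]
          nlinarith
        linarith

lemma sum_visit_div_le (T : ℕ) (x : X) (a : A) :
    ∑ t ∈ Finset.range T, (h t).visit x a * (1 / max 1 (visitCount h t x a)) ≤
      2 * Real.log (max 1 (visitCount h T x a)) + min 1 (visitCount h T x a) := by
  induction T with
  | zero => simp [visitCount]
  | succ T ih =>
    rw [Finset.sum_range_succ, visitCount_succ]
    rcases visit_eq_zero_or_one (h T) x a with hv | hv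
    · simpa [hv] using ih
    · rw [hv, one_mul]
      obtain ⟨k, -, hk⟩ := exists_visitCount_eq h T x a
      rw [hk] at ih ⊢
      rcases Nat.eq_zero_or_pos k with rfl | hkpos
      · simp at ih ⊢
        linarith
      · have hk1 : (1 : ℝ) ≤ k := by exact_mod_cast hkpos
        rw [max_eq_right hk1, min_eq_left hk1] at ih
        rw [max_eq_right hk1, max_eq_right (by linarith), min_eq_left (by linarith)]
        have h1 := Real.one_sub_inv_le_log_of_pos (x := ((k : ℝ) + 1) / k) (by positivity)
        rw [Real.log_div (by positivity) (by positivity)] at h1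
        have h2 : 1 / (k : ℝ) ≤ 2 * (1 - (((k : ℝ) + 1) / k)⁻¹) := by
          rw [inv_div, div_le_iff₀ (by positivity)]
          have : (1 - (k : ℝ) / (k + 1)) = 1 / (k + 1) := by field_simp; ring
          rw [this]
          field_simp
          linarith
        linarith

lemma half_lt_log_two : 1 / 2 < Real.log 2 := by linarith [Real.log_two_gt_d9]

lemma sum_visit_div_le_log {T : ℕ} (hT : 2 ≤ T) (x : X) (a : A) :
    ∑ t ∈ Finset.range T, (h t).visit x a * (1 / max 1 (visitCount h t x a)) ≤
      4 * Real.log T := by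
  have hT2 : (2 : ℝ) ≤ T := by exact_mod_cast hT
  have h1 : Real.log (max 1 (visitCount h T x a)) ≤ Real.log T := by
    refine Real.log_le_log (lt_of_lt_of_le one_pos (le_max_left _ _)) (max_le (by linarith) ?_)
    exact visitCount_le h T x a
  have h2 := Real.log_le_log (by norm_num) hT2
  have h3 := min_le_left 1 (visitCount h T x a)
  linarith [sum_visit_div_le h T x a, half_lt_log_two]

/-- In every episode, each layer before the last one is visited once. -/
lemma sum_layer_visit_le (M : LoopFreeMDP X A L) {e : Episode X A L m}
    (he : ∀ k, M.layer (e.state k) = k) (k : ℕ) :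
    ∑ x with M.layer x = k, ∑ a, e.visit x a ≤ 1 := by
  classical
  by_cases hk : k < L
  · calc _ ≤ ∑ x with M.layer x = k, ∑ a,
          if e.state (⟨k, hk⟩ : Fin L).castSucc = x ∧ e.action ⟨k, hk⟩ = a then (1 : ℝ) else 0 := by
          refine Finset.sum_le_sum fun x hx => Finset.sum_le_sum fun a _ => ?_
          have hx' := (Finset.mem_filter.1 hx).2
          subst hx'
          rw [visit_eq, trajVisit_of_layered M he _ hk]
      _ ≤ ∑ x, ∑ a,
          if e.state (⟨k, hk⟩ : Fin L).castSucc = x ∧ e.action ⟨k, hk⟩ = a then (1 : ℝ) else 0 := by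
          refine Finset.sum_le_sum_of_subset_of_nonneg (Finset.filter_subset _ _) fun x _ _ =>
            Finset.sum_nonneg fun a _ => ?_
          split_ifs <;> norm_num
      _ = 1 := by simp [ite_and]
  · refine le_of_eq_of_le (Finset.sum_eq_zero fun x hx => Finset.sum_eq_zero fun a _ => ?_)
      zero_le_one
    have hx' := (Finset.mem_filter.1 hx).2
    exact trajVisit_of_top M he _ (by omega) a

/-- The numbers of visits, weighted with the sizes of the next layers. The geometric mean of
the size of the next layer and the number of visits is split by the arithmetic-geometric mean
inequality, with the size of the layer itself as the parameter. -/
lemma sum_sqrt_card_mul_visitCount_le [Nonempty A] (M : LoopFreeMDP X A L) {T : ℕ}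
    (hlay : ∀ t < T, ∀ k, M.layer ((h t).state k) = k) :
    ∑ x, ∑ a, √((Finset.univ.filter fun y => M.layer y = M.layer x + 1).card *
      visitCount h T x a) ≤ Fintype.card X * Fintype.card A * √T := by
  classical
  set d : X → ℝ := fun x => (Finset.univ.filter fun y => M.layer y = M.layer x + 1).card with hd
  set e : X → ℝ := fun x => (Finset.univ.filter fun y => M.layer y = M.layer x).card with he
  have he1 : ∀ x, 0 < e x := fun x => by
    have : 0 < (Finset.univ.filter fun y => M.layer y = M.layer x).card :=
      Finset.card_pos.2 ⟨x, by simp⟩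
    exact Nat.cast_pos.2 this
  have hA : (1 : ℝ) ≤ Fintype.card A := by exact_mod_cast Fintype.card_pos
  have hpt : ∀ x a, √(d x * visitCount h T x a) ≤
      (d x / e x * √T + e x * visitCount h T x a / √T) / 2 := by
    intro x a
    have hN := visitCount_nonneg h T x a
    rcases Nat.eq_zero_or_pos T with rfl | hT
    · simp [visitCount]
    have hT0 : (0 : ℝ) < T := by exact_mod_cast hT
    have hs : 0 < √(T : ℝ) := Real.sqrt_pos.2 hT0
    have hd0 : 0 ≤ d x := Nat.cast_nonneg _
    have h1 := he1 x
    refine Real.sqrt_le_iff.2 ⟨by positivity, ?_⟩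
    have h2 : d x * visitCount h T x a =
        (d x / e x * √T) * (e x * visitCount h T x a / √T) := by
      field_simp
    rw [h2]
    nlinarith [sq_nonneg (d x / e x * √T - e x * visitCount h T x a / √T)]
  have hde : ∑ x, d x / e x ≤ Fintype.card X := by
    have h1 : ∀ x, d x / e x = ∑ y, if M.layer y = M.layer x + 1 then 1 / e x else 0 := by
      intro x
      rw [← Finset.sum_filter, Finset.sum_const, nsmul_eq_mul, mul_one_div]
    simp_rw [h1]
    rw [Finset.sum_comm]
    calc _ ≤ ∑ _y : X, (1 : ℝ) := by
          refine Finset.sum_le_sum fun y _ => ?_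
          rw [← Finset.sum_filter]
          rcases (Finset.univ.filter fun x => M.layer y = M.layer x + 1).eq_empty_or_nonempty with
            h0 | ⟨z, hz⟩
          · rw [h0]
            simp
          · have hz' := (Finset.mem_filter.1 hz).2
            have hset : (Finset.univ.filter fun x => M.layer y = M.layer x + 1) =
                Finset.univ.filter fun x => M.layer x = M.layer z := by
              ext x
              simp only [Finset.mem_filter, Finset.mem_univ, true_and]
              omega
            rw [hset, Finset.sum_congr rfl (g := fun _ => 1 / e z)]
            · rw [Finset.sum_const, nsmul_eq_mul, mul_one_div]
              exact (div_self (he1 z).ne').le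
            · intro x hx
              simp only [he, (Finset.mem_filter.1 hx).2]
      _ = _ := by simp
  have heN : ∑ x, ∑ a, e x * visitCount h T x a ≤ Fintype.card X * T := by
    have h1 : ∀ x, ∑ a, e x * visitCount h T x a =
        ∑ y, if M.layer y = M.layer x then ∑ a, visitCount h T x a else 0 := by
      intro x
      rw [← Finset.sum_filter, Finset.sum_const, nsmul_eq_mul, Finset.mul_sum]
    simp_rw [h1]
    rw [Finset.sum_comm]
    calc _ ≤ ∑ _y : X, (T : ℝ) := by
          refine Finset.sum_le_sum fun y _ => ?_
          rw [← Finset.sum_filter]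
          simp_rw [visitCount]
          calc _ = ∑ t ∈ Finset.range T, ∑ x with M.layer x = M.layer y, ∑ a, (h t).visit x a := by
                simp_rw [Finset.sum_comm (s := Finset.univ (α := A)) (t := Finset.range T)]
                rw [Finset.sum_comm]
                exact Finset.sum_congr rfl fun t _ =>
                  Finset.sum_congr (by ext; simp [eq_comm]) fun _ _ => rfl
            _ ≤ ∑ t ∈ Finset.range T, (1 : ℝ) := Finset.sum_le_sum fun t ht =>
                sum_layer_visit_le M (hlay t (Finset.mem_range.1 ht)) _
            _ = T := by simp
      _ = _ := by simp
  have hX0 : (0 : ℝ) ≤ Fintype.card X := Nat.cast_nonneg _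
  calc _ ≤ ∑ x, ∑ a : A, (d x / e x * √T + e x * visitCount h T x a / √T) / 2 :=
        Finset.sum_le_sum fun x _ => Finset.sum_le_sum fun a _ => hpt x a
    _ = (Fintype.card A * (∑ x, d x / e x) * √T +
        (∑ x, ∑ a, e x * visitCount h T x a) / √T) / 2 := by
        simp_rw [← Finset.sum_div, Finset.sum_add_distrib, Finset.sum_const, nsmul_eq_mul,
          ← Finset.sum_div]
        rw [← Finset.mul_sum, ← Finset.sum_mul, Finset.card_univ, mul_assoc]
    _ ≤ (Fintype.card A * Fintype.card X * √T + (Fintype.card X * T) / √T) / 2 := by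
        gcongr
    _ ≤ _ := by
        rw [mul_div_assoc, Real.div_sqrt]
        nlinarith [mul_nonneg hX0 (Real.sqrt_nonneg (T : ℝ))]

end Sums

/-! ### The violation on the good event and the probability of that event -/

section Regret

variable {X A : Type*} [Fintype X] [Fintype A] {L m : ℕ} (M : LoopFreeMDP X A L)
  (h : ℕ → Episode X A L m) (T : ℕ) (δ C : ℝ)

/-- The weight with which a visit of a pair after `t` episodes enters the violation: twice the
confidence radius of the costs, and the width of the transition confidence set, which acts on the
whole rest of the episode. -/
noncomputable def visitWeight (t : ℕ) (x : X) (a : A) : ℝ :=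
  2 * costRadius h t T δ C x a + L * transWidth M h t T δ x a

variable {h T δ C}

lemma visitWeight_nonneg (hC : 0 ≤ C) (t : ℕ) (x : X) (a : A) :
    0 ≤ visitWeight M h T δ C t x a := by
  have h1 := costRadius_nonneg (h := h) (n := t) (T := T) (δ := δ) hC x a
  have h2 := transWidth_nonneg M (h := h) (n := t) (T := T) (δ := δ) x a
  unfold visitWeight
  positivity

lemma visitWeight_le (hL : 1 ≤ L) (t : ℕ) (x : X) (a : A) :
    visitWeight M h T δ C t x a ≤ 4 * L := by
  have h1 := costRadius_le_one (h := h) (n := t) (T := T) (δ := δ) (C := C) x a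
  have h2 : transWidth M h t T δ x a ≤ 2 := min_le_left _ _
  have h3 : (1 : ℝ) ≤ L := by exact_mod_cast hL
  unfold visitWeight
  nlinarith

/-- The violation in a single episode. Feasibility of the optimistic program replaces the
threshold by the lower confidence bounds at `q`, and these are compared with the mean costs at the
true occupancy measure. -/
lemma dot_sub_le {n : ℕ} {α : Fin m → ℝ} {q : X → A → X → ℝ} {π ρ : X → A → ℝ}
    {g avg : Fin m → X → A → ℝ}
    (hq : IsChoice h n T δ C M α q) (hπ : IsInducedPolicy q π) (hρ : IsPolicy ρ)
    (hρα : ∀ i, dot (avg i) (pairMarginal (M.occ ρ)) ≤ α i)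
    (hlay : ∀ τ < n, ∀ k, M.layer ((h τ).state k) = k)
    (hcost : ∀ τ < n, ∀ i x a, (h τ).cost i x a ∈ Set.Icc (0 : ℝ) 1)
    (hconf : InConfidenceSet M h n T δ)
    (hι : 0 ≤ Real.log (T * Fintype.card X * Fintype.card A / δ)) (hC : 0 ≤ C)
    (hest : ∀ i x a, |empCost h n i x a - avg i x a| ≤ costRadius h n T δ C x a) (i : Fin m) :
    dot (g i) (pairMarginal (M.occ π)) - α i ≤
      ∑ x, ∑ a, |g i x a - avg i x a| +
        ∑ x, ∑ a, visitWeight M h T δ C n x a * M.pairProb π x a := by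
  have hfeas : M.occ ρ ∈ feasibleSet h n T δ C M α := by
    refine ⟨isConfOcc_occ M hρ hconf, fun j => le_trans ?_ (hρα j)⟩
    rw [pairMarginal_occ M hρ]
    refine Finset.sum_le_sum fun x _ => Finset.sum_le_sum fun a _ => ?_
    refine mul_le_mul_of_nonneg_right ?_ (pairProb_nonneg M hρ x a)
    unfold lowerCost
    linarith [(abs_le.1 (hest j x a)).2]
  have hqα := (hq.2 ⟨_, hfeas⟩).1.2 i
  have hdist := l1Norm_pairMarginal_sub_le M hq.1 hπ
    (fun x a => transWidth_nonneg M (h := h) (n := n) (T := T) (δ := δ) x a)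
    (fun x a hx => sum_abs_sub_mul_le M hlay hconf hι hq.1 hx a)
  rw [pairMarginal_occ M hπ.1]
  have hpt : ∀ x a, g i x a * M.pairProb π x a ≤
      lowerCost h n T δ C i x a * pairMarginal q x a + |g i x a - avg i x a| +
        2 * costRadius h n T δ C x a * M.pairProb π x a +
        |pairMarginal q x a - M.pairProb π x a| := by
    intro x a
    set r := M.pairProb π x a with hr
    have hr0 : 0 ≤ r := pairProb_nonneg M hπ.1 x a
    have hr1 : r ≤ 1 := pairProb_le_one M hπ.1 x a
    set Q := pairMarginal q x a with hQ
    have hξ0 := costRadius_nonneg (h := h) (n := n) (T := T) (δ := δ) hC x a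
    have hξ1 := costRadius_le_one (h := h) (n := n) (T := T) (δ := δ) (C := C) x a
    have hemp := empCost_mem hcost i x a
    have hesti := abs_le.1 (hest i x a)
    have h1 : (g i x a - avg i x a) * r ≤ |g i x a - avg i x a| :=
      (mul_le_mul_of_nonneg_right (le_abs_self _) hr0).trans
        (mul_le_of_le_one_right (abs_nonneg _) hr1)
    have h2 : (avg i x a - lowerCost h n T δ C i x a) * r ≤ 2 * costRadius h n T δ C x a * r := by
      refine mul_le_mul_of_nonneg_right ?_ hr0
      unfold lowerCost
      linarith
    have h3 : lowerCost h n T δ C i x a * (r - Q) ≤ |Q - r| := by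
      refine (le_abs_self _).trans ?_
      rw [abs_mul, abs_sub_comm]
      refine mul_le_of_le_one_left (abs_nonneg _) ?_
      unfold lowerCost
      rw [abs_le]
      constructor <;> linarith [hemp.1, hemp.2]
    linarith
  have hsum := Finset.sum_le_sum fun x (_ : x ∈ Finset.univ) =>
    Finset.sum_le_sum fun a (_ : a ∈ Finset.univ) => hpt x a
  simp_rw [Finset.sum_add_distrib] at hsum
  have hw : ∑ x, ∑ a, visitWeight M h T δ C n x a * M.pairProb π x a =
      ∑ x, ∑ a, 2 * costRadius h n T δ C x a * M.pairProb π x a +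
        L * ∑ x, ∑ a, M.pairProb π x a * transWidth M h n T δ x a := by
    unfold visitWeight
    simp_rw [Finset.mul_sum, ← Finset.sum_add_distrib]
    exact Finset.sum_congr rfl fun x _ => Finset.sum_congr rfl fun a _ => by ring
  rw [hw]
  change ∑ x, ∑ a, lowerCost h n T δ C i x a * pairMarginal q x a ≤ α i at hqα
  change ∑ x, ∑ a, g i x a * M.pairProb π x a - α i ≤ _
  linarith

/-- The sum of the weights along the actual visits. -/
lemma sum_visitWeight_mul_visit_le [Nonempty A] (hT : 2 ≤ T)
    (hlay : ∀ t < T, ∀ k, M.layer ((h t).state k) = k) (hC : 0 ≤ C) {ι : ℝ}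
    (hι : Real.log (T * Fintype.card X * Fintype.card A / δ) ≤ ι)
    (hι0 : 0 ≤ Real.log (T * Fintype.card X * Fintype.card A / δ))
    (hι2 : Real.log (2 * m * T * Fintype.card X * Fintype.card A / δ) ≤ 2 * ι) :
    ∑ t ∈ Finset.range T, ∑ x, ∑ a, visitWeight M h T δ C t x a * (h t).visit x a ≤
      Fintype.card X * Fintype.card A * (6 * √(T * ι) + 8 * (C * Real.log T) + 2 * C) +
        L * (75 * (Fintype.card X * Fintype.card A * √(T * ι))) := by
  have hT0 : (0 : ℝ) < T := by exact_mod_cast (by omega : 0 < T)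
  have hιnn : 0 ≤ ι := hι0.trans hι
  have hcost : ∀ x a, ∑ t ∈ Finset.range T, costRadius h t T δ C x a * (h t).visit x a ≤
      3 * √(T * ι) + 4 * (C * Real.log T) + C := by
    intro x a
    have h1 : ∀ t, costRadius h t T δ C x a * (h t).visit x a ≤
        √ι * ((h t).visit x a * √(1 / max 1 (visitCount h t x a))) +
        C * ((h t).visit x a * (1 / max 1 (visitCount h t x a))) + C / T * (h t).visit x a := by
      intro t
      have hv := visit_nonneg (h t) x a
      have hK : 0 < max 1 (visitCount h t x a) := lt_of_lt_of_le one_pos (le_max_left _ _)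
      have h2 : costRadius h t T δ C x a ≤ √ι * √(1 / max 1 (visitCount h t x a)) +
          C * (1 / max 1 (visitCount h t x a)) + C / T := by
        unfold costRadius
        refine (min_le_right _ _).trans ?_
        rw [max_comm (visitCount h t x a) 1, mul_one_div]
        gcongr
        rw [← Real.sqrt_mul hιnn]
        refine Real.sqrt_le_sqrt ?_
        rw [mul_one_div, div_le_div_iff₀ (by positivity) hK]
        nlinarith
      nlinarith [mul_le_mul_of_nonneg_right h2 hv]
    refine (Finset.sum_le_sum fun t _ => h1 t).trans ?_
    rw [Finset.sum_add_distrib, Finset.sum_add_distrib, ← Finset.mul_sum, ← Finset.mul_sum,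
      ← Finset.mul_sum]
    have h2 : √ι * ∑ t ∈ Finset.range T, (h t).visit x a * √(1 / max 1 (visitCount h t x a)) ≤
        3 * √(T * ι) := by
      have h4 : √(visitCount h T x a) ≤ √(T : ℝ) := Real.sqrt_le_sqrt (visitCount_le h T x a)
      rw [Real.sqrt_mul hT0.le]
      nlinarith [mul_le_mul_of_nonneg_left (sum_visit_div_sqrt_le h T x a) (Real.sqrt_nonneg ι),
        mul_le_mul_of_nonneg_left h4 (Real.sqrt_nonneg ι)]
    have h3 := mul_le_mul_of_nonneg_left (sum_visit_div_le_log h hT x a) hC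
    have h5 : C / T * ∑ t ∈ Finset.range T, (h t).visit x a ≤ C := by
      have := mul_le_mul_of_nonneg_left (visitCount_le h T x a) (div_nonneg hC hT0.le)
      rwa [div_mul_cancel₀ _ hT0.ne'] at this
    linarith
  have htrans : ∑ x, ∑ a, ∑ t ∈ Finset.range T, transWidth M h t T δ x a * (h t).visit x a ≤
      75 * (Fintype.card X * Fintype.card A * √(T * ι)) := by
    have h1 : ∀ x a, ∑ t ∈ Finset.range T, transWidth M h t T δ x a * (h t).visit x a ≤
        75 * √ι * √((Finset.univ.filter fun y => M.layer y = M.layer x + 1).card *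
          visitCount h T x a) := by
      intro x a
      set d : ℝ := ((Finset.univ.filter fun y => M.layer y = M.layer x + 1).card : ℝ) with hd
      have hd0 : 0 ≤ d := Nat.cast_nonneg _
      have h2 : ∀ t, transWidth M h t T δ x a * (h t).visit x a ≤
          25 * √ι * √d * ((h t).visit x a * √(1 / max 1 (visitCount h t x a))) := by
        intro t
        have hK : 0 < max 1 (visitCount h t x a) := lt_of_lt_of_le one_pos (le_max_left _ _)
        have h3 : transWidth M h t T δ x a ≤
            25 * √ι * √d * √(1 / max 1 (visitCount h t x a)) := by
          refine (min_le_right _ _).trans ?_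
          have e : 25 * √ι * √d * √(1 / max 1 (visitCount h t x a)) =
              25 * √(d * ι * (1 / max 1 (visitCount h t x a))) := by
            rw [Real.sqrt_mul (by positivity), Real.sqrt_mul hd0]
            ring
          rw [e, mul_one_div]
          gcongr
        nlinarith [mul_le_mul_of_nonneg_right h3 (visit_nonneg (h t) x a)]
      refine (Finset.sum_le_sum fun t _ => h2 t).trans ?_
      rw [← Finset.mul_sum, Real.sqrt_mul hd0]
      have h4 := mul_le_mul_of_nonneg_left (sum_visit_div_sqrt_le h T x a)
        (by positivity : 0 ≤ 25 * √ι * √d)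
      linarith
    refine (Finset.sum_le_sum fun x _ => Finset.sum_le_sum fun a _ => h1 x a).trans ?_
    simp_rw [← Finset.mul_sum]
    have h2 := mul_le_mul_of_nonneg_left (sum_sqrt_card_mul_visitCount_le h M hlay)
      (by positivity : 0 ≤ 75 * √ι)
    refine h2.trans (le_of_eq ?_)
    rw [Real.sqrt_mul hT0.le]
    ring
  have hswap : ∑ t ∈ Finset.range T, ∑ x, ∑ a, visitWeight M h T δ C t x a * (h t).visit x a =
      2 * ∑ x, ∑ a, ∑ t ∈ Finset.range T, costRadius h t T δ C x a * (h t).visit x a +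
      L * ∑ x, ∑ a, ∑ t ∈ Finset.range T, transWidth M h t T δ x a * (h t).visit x a := by
    rw [Finset.sum_comm]
    simp_rw [Finset.sum_comm (s := Finset.range T) (t := Finset.univ (α := A)), Finset.mul_sum,
      ← Finset.sum_add_distrib]
    refine Finset.sum_congr rfl fun x _ => Finset.sum_congr rfl fun a _ =>
      Finset.sum_congr rfl fun t _ => ?_
    unfold visitWeight
    ring
  rw [hswap]
  have hc : ∑ x, ∑ a, ∑ t ∈ Finset.range T, costRadius h t T δ C x a * (h t).visit x a ≤
      Fintype.card X * Fintype.card A * (3 * √(T * ι) + 4 * (C * Real.log T) + C) := by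
    refine (Finset.sum_le_sum fun x _ => Finset.sum_le_sum fun a _ => hcost x a).trans
      (le_of_eq ?_)
    simp only [Finset.sum_const, Finset.card_univ, nsmul_eq_mul]
    ring
  have := mul_le_mul_of_nonneg_left htrans (Nat.cast_nonneg (α := ℝ) L)
  linarith

end Regret

section Violation

variable {X A : Type*} [Fintype X] [Fintype A] {L m T : ℕ} (M : LoopFreeMDP X A L)

/-- The violation of a single episode is at most its length. -/
lemma max_dot_sub_le {g π : X → A → ℝ} (hg : ∀ x a, g x a ∈ Set.Icc (0 : ℝ) 1) (hπ : IsPolicy π)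
    {α : ℝ} (hα : 0 ≤ α) : max 0 (dot g (pairMarginal (M.occ π)) - α) ≤ L := by
  refine max_le (Nat.cast_nonneg _) ?_
  have : dot g (pairMarginal (M.occ π)) ≤ L := by
    rw [pairMarginal_occ M hπ, ← sum_pairProb M hπ]
    exact Finset.sum_le_sum fun x _ => Finset.sum_le_sum fun a _ =>
      mul_le_of_le_one_left (pairProb_nonneg M hπ x a) (hg x a).2
  linarith

lemma violation_le_horizon_mul {gbar : ℕ → Fin m → X → A → ℝ} {π : ℕ → X → A → ℝ} {α : Fin m → ℝ}
    (hm : 1 ≤ m) (hg : ∀ t < T, ∀ i x a, gbar t i x a ∈ Set.Icc (0 : ℝ) 1)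
    (hπ : ∀ t < T, IsPolicy (π t)) (hα : ∀ i, 0 ≤ α i) :
    violation M T α gbar π ≤ T * L := by
  have : Nonempty (Fin m) := ⟨⟨0, hm⟩⟩
  refine ciSup_le fun i => ?_
  calc _ ≤ ∑ t ∈ Finset.range T, (L : ℝ) := Finset.sum_le_sum fun t ht => by
        have ht' := Finset.mem_range.1 ht
        exact max_dot_sub_le M (hg t ht' i) (hπ t ht') (hα i)
    _ = T * L := by simp

/-- Collecting the terms of the violation bound, with `l`, `n` and `a` for the numbers of layers,
states and actions. -/
lemma violation_arithmetic {l n a E C r : ℝ} (hl : 1 ≤ l) (hln : l + 1 ≤ n) (ha : 1 ≤ a)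
    (hE : 1 ≤ E) (hC : 0 ≤ C) (hr : 1 / 2 ≤ r) :
    l + 2 * C + (4 * l * l * (3 / 2 * E) + (n * a * (6 * E + 8 * (C * r) + 2 * C) +
      l * (75 * (n * a * E)))) ≤ 100 * (l * n * a * E + r * n * a * C) := by
  have hna : l ≤ n * a := by nlinarith
  have b1 : l * E * l ≤ l * E * (n * a) := by gcongr
  have b2 : l * E * 1 ≤ l * E * (n * a) := mul_le_mul_of_nonneg_left (by linarith) (by positivity)
  have b3 : l * 1 ≤ l * E := by gcongr
  have b4 : 1 * (n * a * E) ≤ l * (n * a * E) :=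
    mul_le_mul_of_nonneg_right hl (mul_nonneg (by linarith) (by linarith))
  have b5 : C * (1 / 2) ≤ C * r := by gcongr
  have b6 : C * r * 1 ≤ C * r * (n * a) :=
    mul_le_mul_of_nonneg_left (by linarith) (mul_nonneg hC (by linarith))
  have b7 : n * a * (C * (1 / 2)) ≤ n * a * (C * r) :=
    mul_le_mul_of_nonneg_left b5 (by linarith)
  have b8 : 0 ≤ l * (n * a * E) :=
    mul_nonneg (by linarith) (mul_nonneg (by linarith) (by linarith))
  have b9 : 0 ≤ C * r * (n * a) := mul_nonneg (mul_nonneg hC (by linarith)) (by linarith)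
  linarith

/-- The violation on the event that all confidence bounds hold. -/
lemma violation_le [Nonempty A] {h : ℕ → Episode X A L m} {δ C ι : ℝ} {α : Fin m → ℝ}
    {gbar : ℕ → Fin m → X → A → ℝ} {π : ℕ → X → A → ℝ} {ρ : X → A → ℝ}
    (hm : 1 ≤ m) (hT : 2 ≤ T) (hL : 1 ≤ L)
    (hg : ∀ t < T, ∀ i x a, gbar t i x a ∈ Set.Icc (0 : ℝ) 1)
    (hC : costCorruption T gbar ≤ C)
    (hπ : ∀ t < T, IsPolicy (π t)) (hα : ∀ i, 0 ≤ α i)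
    (hρ : IsPolicy ρ) (hρα : ∀ i, dot (avgCost T gbar i) (pairMarginal (M.occ ρ)) ≤ α i)
    (hchoice : ∀ t, t + 1 < T → ∃ q, IsChoice h (t + 1) T δ C M α q ∧ IsInducedPolicy q (π (t + 1)))
    (hlay : ∀ t < T, ∀ k, M.layer ((h t).state k) = k)
    (hcost : ∀ t < T, ∀ i x a, (h t).cost i x a ∈ Set.Icc (0 : ℝ) 1)
    (hconf : ∀ t < T, InConfidenceSet M h t T δ)
    (hest : ∀ t < T, ∀ i x a,
      |empCost h t i x a - avgCost T gbar i x a| ≤ costRadius h t T δ C x a)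
    (hazuma : ∑ t ∈ Finset.range T, ∑ x, ∑ a,
      visitWeight M h T δ C t x a * (M.pairProb (π t) x a - (h t).visit x a) ≤
        4 * L * L * √(2 * T * ι))
    (hι : Real.log (T * Fintype.card X * Fintype.card A / δ) ≤ ι)
    (hι0 : 0 ≤ Real.log (T * Fintype.card X * Fintype.card A / δ))
    (hι1 : 1 / 2 ≤ ι)
    (hι2 : Real.log (2 * m * T * Fintype.card X * Fintype.card A / δ) ≤ 2 * ι) :
    violation M T α gbar π ≤ 100 * (L * Fintype.card X * Fintype.card A * √(T * ι) +
      Real.log T * Fintype.card X * Fintype.card A * C) := by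
  have : Nonempty (Fin m) := ⟨⟨0, hm⟩⟩
  have hC0 : 0 ≤ C := (costCorruption_nonneg T gbar).trans hC
  have hT2 : (2 : ℝ) ≤ T := by exact_mod_cast hT
  refine ciSup_le fun i => ?_
  have hep : ∀ t ∈ Finset.range T, max 0 (dot (gbar t i) (pairMarginal (M.occ (π t))) - α i) ≤
      (if t = 0 then (L : ℝ) else 0) + ∑ x, ∑ a, |gbar t i x a - avgCost T gbar i x a| +
        ∑ x, ∑ a, visitWeight M h T δ C t x a * M.pairProb (π t) x a := by
    intro t ht
    have ht' := Finset.mem_range.1 ht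
    have h1 : 0 ≤ ∑ x, ∑ a, |gbar t i x a - avgCost T gbar i x a| :=
      Finset.sum_nonneg fun _ _ => Finset.sum_nonneg fun _ _ => abs_nonneg _
    have h2 : 0 ≤ ∑ x, ∑ a, visitWeight M h T δ C t x a * M.pairProb (π t) x a :=
      Finset.sum_nonneg fun x _ => Finset.sum_nonneg fun a _ =>
        mul_nonneg (visitWeight_nonneg M hC0 t x a) (pairProb_nonneg M (hπ t ht') x a)
    rcases t with _ | t
    -- the first policy is arbitrary
    · have := max_dot_sub_le M (hg 0 ht' i) (hπ 0 ht') (hα i)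
      rw [if_pos rfl]
      linarith
    · rw [if_neg (Nat.succ_ne_zero t), zero_add]
      refine max_le (by positivity) ?_
      obtain ⟨q, hq, hqπ⟩ := hchoice t ht'
      exact dot_sub_le M (g := gbar (t + 1)) hq hqπ hρ hρα (fun τ hτ => hlay τ (by omega))
        (fun τ hτ => hcost τ (by omega)) (hconf _ ht') hι0 hC0 (hest _ ht') i
  refine (Finset.sum_le_sum hep).trans ?_
  rw [Finset.sum_add_distrib, Finset.sum_add_distrib, Finset.sum_ite_eq' (Finset.range T) 0,
    if_pos (Finset.mem_range.2 (by omega))]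
  have hcor := sum_l1Norm_sub_avgCost_le (by omega) hC i
  have hvis := sum_visitWeight_mul_visit_le M hT hlay hC0 hι hι0 hι2
  have hsplit : ∑ t ∈ Finset.range T, ∑ x, ∑ a,
      visitWeight M h T δ C t x a * M.pairProb (π t) x a =
      ∑ t ∈ Finset.range T, ∑ x, ∑ a,
        visitWeight M h T δ C t x a * (M.pairProb (π t) x a - (h t).visit x a) +
      ∑ t ∈ Finset.range T, ∑ x, ∑ a, visitWeight M h T δ C t x a * (h t).visit x a := by
    simp_rw [← Finset.sum_add_distrib]
    exact Finset.sum_congr rfl fun t _ => Finset.sum_congr rfl fun x _ =>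
      Finset.sum_congr rfl fun a _ => by ring
  rw [hsplit]
  have hE1 : 1 ≤ √(T * ι) := Real.one_le_sqrt.2 (by nlinarith)
  have hsq : √(2 * T * ι) ≤ 3 / 2 * √(T * ι) := by
    rw [mul_assoc, Real.sqrt_mul zero_le_two]
    gcongr
    exact Real.sqrt_le_iff.2 ⟨by norm_num, by norm_num⟩
  have hlogT : 1 / 2 ≤ Real.log T :=
    half_lt_log_two.le.trans (Real.log_le_log zero_lt_two hT2)
  have hA : (1 : ℝ) ≤ Fintype.card A := by exact_mod_cast Fintype.card_pos
  have hLX : (L : ℝ) + 1 ≤ Fintype.card X := by exact_mod_cast M.succ_le_card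
  have hL1 : (1 : ℝ) ≤ L := by exact_mod_cast hL
  have hfin := violation_arithmetic hL1 hLX hA hE1 hC0 hlogT
  have h1 : 4 * L * L * √(2 * T * ι) ≤ 4 * L * L * (3 / 2 * √(T * ι)) := by gcongr
  linarith

end Violation

section Events

variable {X A Ω : Type*} [Fintype X] [Fintype A] {L m T : ℕ} [mΩ : MeasurableSpace Ω]
  {M : LoopFreeMDP X A L} {μ : Measure Ω} [IsProbabilityMeasure μ] {ℱ : Filtration ℕ mΩ}
  {D : ℕ → Ω → Measure ((X → A → ℝ) × (Fin m → X → A → ℝ))}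
  {π : ℕ → Ω → X → A → ℝ} {ep : ℕ → Ω → Episode X A L m} {δ : ℝ}

lemma measure_iUnion_le_card_mul {ι : Type*} [Fintype ι] {s : ι → Set Ω} {r : ℝ}
    (hs : ∀ i, μ (s i) ≤ ENNReal.ofReal r) :
    μ (⋃ i, s i) ≤ ENNReal.ofReal (Fintype.card ι * r) := by
  refine (measure_iUnion_fintype_le μ s).trans ((Finset.sum_le_sum fun i _ => hs i).trans ?_)
  rw [Finset.sum_const, Finset.card_univ, nsmul_eq_mul, ENNReal.ofReal_mul (Nat.cast_nonneg _),
    ENNReal.ofReal_natCast]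

/-- The cost observations concentrate, simultaneously for all pairs, costs and times. -/
lemma measure_cost_tail_le (hI : IsInteraction M T μ ℱ D π ep) (hδ0 : 0 < δ) (hm : 1 ≤ m)
    (hT : 1 ≤ T) (hX : 1 ≤ Fintype.card X) (hA : 1 ≤ Fintype.card A)
    (hι : 0 ≤ Real.log (2 * m * T * Fintype.card X * Fintype.card A / δ)) :
    μ {ω | ¬ ∀ t ≤ T, ∀ i x a, 1 ≤ visitCount (fun τ => ep τ ω) t x a →
      |∑ τ ∈ Finset.range t, (ep τ ω).visit x a *
        ((ep τ ω).cost i x a - meanCost (D τ ω) i x a)| ≤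
        √(visitCount (fun τ => ep τ ω) t x a *
          Real.log (2 * m * T * Fintype.card X * Fintype.card A / δ) / 2)} ≤
      ENNReal.ofReal δ := by
  set ι := Real.log (2 * m * T * Fintype.card X * Fintype.card A / δ) with hιdef
  have hbound := measure_iUnion_le_card_mul (μ := μ)
    (s := fun p : (Fin m × X × A × Fin T) × Bool =>
      {ω | ∃ t ≤ T, visitCount (fun τ => ep τ ω) t p.1.2.1 p.1.2.2.1 =
          ((p.1.2.2.2 : ℕ) + 1 : ℕ) ∧
        √(((p.1.2.2.2 : ℕ) + 1 : ℕ) * ι / 2) ≤ (if p.2 then 1 else -1) *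
          ∑ τ ∈ Finset.range t, (ep τ ω).visit p.1.2.1 p.1.2.2.1 *
            ((ep τ ω).cost p.1.1 p.1.2.1 p.1.2.2.1 -
              meanCost (D τ ω) p.1.1 p.1.2.1 p.1.2.2.1)})
    (fun p => measure_cost_deviation_le hI p.1.1 p.1.2.1 p.1.2.2.1 (Nat.succ_pos _)
      (by split_ifs <;> norm_num) hι)
  refine (measure_mono fun ω hω => ?_).trans (hbound.trans (le_of_eq ?_))
  · simp only [Set.mem_ofPred_eq] at hω
    push Not at hω
    obtain ⟨t, ht, i, x, a, hN, hbad⟩ := hω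
    obtain ⟨k, hk, hkN⟩ := exists_visitCount_eq (fun τ => ep τ ω) t x a
    rw [hkN] at hN hbad
    have hk1 : 1 ≤ k := by exact_mod_cast hN
    have hk2 : k - 1 + 1 = k := by omega
    refine Set.mem_iUnion.2 ?_
    rcases le_abs.1 hbad.le with hb | hb
    · refine ⟨((i, x, a, ⟨k - 1, by omega⟩), true), t, ht, ?_, ?_⟩
      · simp only [hk2, hkN]
      · simpa [hk2] using hb
    · refine ⟨((i, x, a, ⟨k - 1, by omega⟩), false), t, ht, ?_, ?_⟩
      · simp only [hk2, hkN]
      · simpa [hk2] using hb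
  · congr 1
    have h1 : (0 : ℝ) < m := by exact_mod_cast hm
    have h2 : (0 : ℝ) < T := by exact_mod_cast hT
    have h3 : (0 : ℝ) < Fintype.card X := by exact_mod_cast hX
    have h4 : (0 : ℝ) < Fintype.card A := by exact_mod_cast hA
    rw [Real.exp_neg, hιdef, Real.exp_log (by positivity)]
    simp only [Fintype.card_prod, Fintype.card_fin, Fintype.card_bool]
    push_cast
    field_simp

/-- The transition counts concentrate, simultaneously for all transitions and times. -/
lemma measure_transit_tail_le (hI : IsInteraction M T μ ℱ D π ep) (hδ0 : 0 < δ) (hδ1 : δ < 1)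
    (hT : 1 ≤ T) (hX : 1 ≤ Fintype.card X) (hA : 1 ≤ Fintype.card A)
    (hι : 0 ≤ Real.log (T * Fintype.card X * Fintype.card A / δ)) :
    μ {ω | ¬ ∀ t ≤ T, ∀ x a x', M.layer x < L → 1 ≤ visitCount (fun τ => ep τ ω) t x a →
      visitCount (fun τ => ep τ ω) t x a * M.P x a x' -
        √(2 * (2 * Real.log (T * Fintype.card X * Fintype.card A / δ)) *
          (visitCount (fun τ => ep τ ω) t x a * M.P x a x')) ≤
        transitCount (fun τ => ep τ ω) t x a x' ∧
      transitCount (fun τ => ep τ ω) t x a x' ≤ visitCount (fun τ => ep τ ω) t x a * M.P x a x' +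
        √(2 * (2 * Real.log (T * Fintype.card X * Fintype.card A / δ)) *
          (visitCount (fun τ => ep τ ω) t x a * M.P x a x')) +
        2 * Real.log (T * Fintype.card X * Fintype.card A / δ)} ≤
      ENNReal.ofReal (2 * δ) := by
  set ι := Real.log (T * Fintype.card X * Fintype.card A / δ) with hιdef
  have h2ι : 0 ≤ 2 * ι := by linarith
  have hlo := measure_iUnion_le_card_mul (μ := μ)
    (s := fun p : {x : X // M.layer x < L} × A × X × Fin T =>
      {ω | ∃ t ≤ T, visitCount (fun τ => ep τ ω) t p.1 p.2.1 = ((p.2.2.2 : ℕ) + 1 : ℕ) ∧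
        transitCount (fun τ => ep τ ω) t p.1 p.2.1 p.2.2.1 <
          ((p.2.2.2 : ℕ) + 1 : ℕ) * M.P p.1 p.2.1 p.2.2.1 -
          √(2 * (2 * ι) * (((p.2.2.2 : ℕ) + 1 : ℕ) * M.P p.1 p.2.1 p.2.2.1))})
    (fun p => measure_transit_lower_le hI p.1.2 p.2.1 p.2.2.1 (Nat.succ_pos _) h2ι)
  have hup := measure_iUnion_le_card_mul (μ := μ)
    (s := fun p : {x : X // M.layer x < L} × A × X × Fin T =>
      {ω | ∃ t ≤ T, visitCount (fun τ => ep τ ω) t p.1 p.2.1 = ((p.2.2.2 : ℕ) + 1 : ℕ) ∧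
        ((p.2.2.2 : ℕ) + 1 : ℕ) * M.P p.1 p.2.1 p.2.2.1 +
          √(2 * (2 * ι) * (((p.2.2.2 : ℕ) + 1 : ℕ) * M.P p.1 p.2.1 p.2.2.1)) + 2 * ι <
        transitCount (fun τ => ep τ ω) t p.1 p.2.1 p.2.2.1})
    (fun p => measure_transit_upper_le hI p.1.2 p.2.1 p.2.2.1 h2ι)
  have hcard : Fintype.card ({x : X // M.layer x < L} × A × X × Fin T) *
      Real.exp (-(2 * ι)) ≤ δ := by
    have h2 : (1 : ℝ) ≤ T := by exact_mod_cast hT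
    have h3 : (0 : ℝ) < Fintype.card X := by exact_mod_cast hX
    have h4 : (1 : ℝ) ≤ Fintype.card A := by exact_mod_cast hA
    have hexp : Real.exp (-(2 * ι)) = (δ / (T * Fintype.card X * Fintype.card A)) ^ 2 := by
      rw [Real.exp_neg, two_mul, Real.exp_add, hιdef, Real.exp_log (by positivity)]
      field_simp
    have hsub : (Fintype.card {x : X // M.layer x < L} : ℝ) ≤ Fintype.card X := by
      exact_mod_cast Fintype.card_subtype_le _
    rw [hexp]
    simp only [Fintype.card_prod, Fintype.card_fin]
    push_cast
    calc _ ≤ (Fintype.card X : ℝ) * (Fintype.card A * (Fintype.card X * T)) *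
          (δ / (T * Fintype.card X * Fintype.card A)) ^ 2 := by gcongr
      _ = δ * (δ / (T * Fintype.card A)) := by field_simp
      _ ≤ δ * 1 := by
          gcongr
          rw [div_le_one (by positivity)]
          nlinarith
      _ = δ := mul_one δ
  have hboth := (measure_union_le _ _).trans
    (add_le_add (hlo.trans (ENNReal.ofReal_le_ofReal hcard))
      (hup.trans (ENNReal.ofReal_le_ofReal hcard)))
  rw [← ENNReal.ofReal_add hδ0.le hδ0.le, ← two_mul] at hboth
  refine (measure_mono fun ω hω => ?_).trans hboth
  simp only [Set.mem_ofPred_eq] at hω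
  push Not at hω
  obtain ⟨t, ht, x, a, x', hx, hN, hbad⟩ := hω
  obtain ⟨k, hk, hkN⟩ := exists_visitCount_eq (fun τ => ep τ ω) t x a
  rw [hkN] at hN hbad
  have hk1 : 1 ≤ k := by exact_mod_cast hN
  have hk2 : k - 1 + 1 = k := by omega
  by_cases hb : (k : ℝ) * M.P x a x' - √(2 * (2 * ι) * (k * M.P x a x')) ≤
      transitCount (fun τ => ep τ ω) t x a x'
  · refine Or.inr (Set.mem_iUnion.2
      ⟨(⟨x, hx⟩, a, x', ⟨k - 1, by omega⟩), t, ht, ?_, ?_⟩)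
    · simp only [hk2, hkN]
    · simpa only [hk2] using hbad hb
  · refine Or.inl (Set.mem_iUnion.2
      ⟨(⟨x, hx⟩, a, x', ⟨k - 1, by omega⟩), t, ht, ?_, ?_⟩)
    · simp only [hk2, hkN]
    · simpa only [hk2] using not_le.1 hb

lemma measurable_visitWeight (hI : IsInteraction M T μ ℱ D π ep) (C : ℝ) {t : ℕ} (ht : t < T)
    (x : X) (a : A) :
    Measurable[ℱ t] fun ω => visitWeight M (fun τ => ep τ ω) T δ C t x a := by
  have hF : Measurable fun N : ℝ =>
      2 * min 1 (√(Real.log (2 * m * T * Fintype.card X * Fintype.card A / δ) / (2 * max N 1)) +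
        C / max N 1 + C / T) +
      L * min 2 (25 * √((Finset.univ.filter fun y => M.layer y = M.layer x + 1).card *
        Real.log (T * Fintype.card X * Fintype.card A / δ) / max 1 N)) := by
    fun_prop
  exact hF.comp (measurable_visitCount hI ht.le x a)

end Events

end NSSOPS

/-! ### The violation bound -/

theorem theorem1 :
    ∃ K : ℝ, 0 < K ∧
      ∀ (X A : Type*) [Fintype X] [Fintype A] [Nonempty A]
        (Ω : Type*) [MeasurableSpace Ω] (μ : Measure Ω) [IsProbabilityMeasure μ]
        (L m T : ℕ) (_ : 1 ≤ m) (_ : 1 ≤ T)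
        (M : NSSOPS.LoopFreeMDP X A L)
        (α : Fin m → ℝ) (_ : ∀ i, α i ∈ Set.Icc (0 : ℝ) L)
        (δ : ℝ) (_ : 0 < δ) (_ : δ < 1) (C : ℝ)
        (ℱ : Filtration ℕ (inferInstance : MeasurableSpace Ω))
        (D : ℕ → Ω → Measure ((X → A → ℝ) × (Fin m → X → A → ℝ)))
        (π : ℕ → Ω → X → A → ℝ) (ep : ℕ → Ω → NSSOPS.Episode X A L m)
        -- the learner and the adversary interact as prescribed
        (_ : NSSOPS.IsInteraction M T μ ℱ D π ep)
        -- the known value `C` bounds the total corruption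
        (_ : ∀ᵐ ω ∂μ, max (NSSOPS.costCorruption T fun t => NSSOPS.meanCost (D t ω))
          (NSSOPS.rewardCorruption T fun t => NSSOPS.meanReward (D t ω)) ≤ C)
        -- the offline problem with the average costs is feasible
        (_ : ∀ᵐ ω ∂μ, ∃ ρ : X → A → ℝ, NSSOPS.IsPolicy ρ ∧ ∀ i,
          NSSOPS.dot
            (fun x a => (1 / (T : ℝ)) * ∑ t ∈ Finset.range T, NSSOPS.meanCost (D t ω) i x a)
            (NSSOPS.pairMarginal (M.occ ρ)) ≤ α i)
        -- the learner runs the algorithm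
        (_ : NSSOPS.FollowsNSSOPS M T δ C α μ π ep),
        ENNReal.ofReal (1 - 8 * δ) ≤
          μ {ω | NSSOPS.violation M T α (fun t => NSSOPS.meanCost (D t ω)) (fun t => π t ω) ≤
            K * (L * Fintype.card X * Fintype.card A *
                √(T * Real.log (m * T * Fintype.card X * Fintype.card A / δ)) +
              Real.log T * Fintype.card X * Fintype.card A * C)} := by
  refine ⟨100, by norm_num, ?_⟩
  intro X A _ _ _ Ω _ μ _ L m T hm hT M α hα δ hδ0 hδ1 C ℱ D π ep hI hcorr hfeas hrun
  have hC : ∀ᵐ ω ∂μ, NSSOPS.costCorruption T (fun t => NSSOPS.meanCost (D t ω)) ≤ C :=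
    hcorr.mono fun ω hω => (le_max_left _ _).trans hω
  have hC0 : 0 ≤ C := by
    obtain ⟨ω, hω⟩ := hC.exists
    exact (NSSOPS.costCorruption_nonneg _ _).trans hω
  have hm1 : (1 : ℝ) ≤ m := by exact_mod_cast hm
  have hT1 : (1 : ℝ) ≤ T := by exact_mod_cast hT
  have hA1 : (1 : ℝ) ≤ Fintype.card A := by exact_mod_cast Fintype.card_pos
  have hLX : (L : ℝ) + 1 ≤ Fintype.card X := by exact_mod_cast M.succ_le_card
  have hmean := fun ω t (ht : t < T) i x a => NSSOPS.meanCost_mem hI ht ω i x a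
  have hpol := fun ω t (ht : t < T) => hI.policy t ht ω
  have htriv := fun ω => NSSOPS.violation_le_horizon_mul (T := T) M
    (gbar := fun t => NSSOPS.meanCost (D t ω)) (π := fun t => π t ω) hm (hmean ω) (hpol ω)
    fun i => (hα i).1
  have hall : ∀ S : Set Ω, (∀ ω, ω ∈ S) → ENNReal.ofReal (1 - 8 * δ) ≤ μ S := by
    intro S hS
    rw [Set.eq_univ_of_forall hS, measure_univ, ← ENNReal.ofReal_one]
    exact ENNReal.ofReal_le_ofReal (by linarith)
  have hlogT0 : 0 ≤ Real.log T := Real.log_nonneg hT1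
  -- For `L = 0` and for `T = 1`, where the logarithms may vanish, the bound `T L` suffices.
  rcases Nat.eq_zero_or_pos L with hL0 | hLpos
  · refine hall _ fun ω => (htriv ω).trans ?_
    rw [hL0]
    push_cast
    have : 0 ≤ Real.log T * Fintype.card X * Fintype.card A * C := by positivity
    simp only [mul_zero, zero_mul, zero_add]
    linarith
  have hL1 : (1 : ℝ) ≤ L := by exact_mod_cast hLpos
  have hX2 : (2 : ℝ) ≤ Fintype.card X := by linarith
  have hX1 : 1 ≤ Fintype.card X := by
    have := M.succ_le_card
    omega
  -- all logarithms are bounded below because there are at least two states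
  set B : ℝ := T * Fintype.card X * Fintype.card A / δ with hB
  have hB2 : 2 * T ≤ B := by
    rw [hB, le_div_iff₀ hδ0]
    have h1 : 2 * (T : ℝ) ≤ T * Fintype.card X := by nlinarith
    have h2 : (T : ℝ) * Fintype.card X ≤ T * Fintype.card X * Fintype.card A :=
      le_mul_of_one_le_right (by positivity) hA1
    nlinarith
  have hB0 : 0 < B := by linarith
  have hBm : (m : ℝ) * T * Fintype.card X * Fintype.card A / δ = m * B := by
    rw [hB]
    ring
  have hBm2 : 2 * (m : ℝ) * T * Fintype.card X * Fintype.card A / δ = 2 * (m * B) := by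
    rw [hB]
    ring
  have hmB : B ≤ m * B := le_mul_of_one_le_left hB0.le hm1
  have hlog2 := NSSOPS.half_lt_log_two
  have hι : 1 / 2 ≤ Real.log B :=
    hlog2.le.trans (Real.log_le_log zero_lt_two (by linarith))
  have hιm : Real.log B ≤ Real.log (m * B) := Real.log_le_log hB0 hmB
  rw [hBm]
  rcases hT.eq_or_lt with hT' | hT2
  · refine hall _ fun ω => (htriv ω).trans ?_
    rw [← hT']
    push_cast
    have h1 : 1 / 2 ≤ √(Real.log (m * B)) := by
      refine Real.le_sqrt_of_sq_le ?_
      linarith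
    have h2 : 1 ≤ (Fintype.card X : ℝ) * Fintype.card A := by nlinarith
    have h3 : (L : ℝ) * 1 ≤ L * (Fintype.card X * Fintype.card A) := by gcongr
    have h4 : (L : ℝ) * (1 / 2) ≤
        L * (Fintype.card X * Fintype.card A) * √(Real.log (m * B)) := by
      gcongr
      linarith
    rw [Real.log_one, one_mul, one_mul]
    linarith
  have hT2' : (2 : ℝ) ≤ T := by exact_mod_cast hT2
  have hι2 : Real.log (2 * (m * B)) ≤ 2 * Real.log (m * B) := by
    rw [Real.log_mul two_ne_zero (by positivity)]
    linarith [Real.log_le_log zero_lt_two (by linarith : 2 ≤ m * B)]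
  have hι3 : 2 ≤ Real.log (2 * (m * B)) := by
    have h8 : (2 : ℝ) ^ 3 ≤ 2 * (m * B) := by nlinarith
    have := Real.log_le_log (by norm_num) h8
    rw [Real.log_pow] at this
    push_cast at this
    linarith [Real.log_two_gt_d9]
  -- the three events on which the confidence bounds fail
  have hev1 := NSSOPS.measure_cost_tail_le hI hδ0 hm hT hX1 Fintype.card_pos
    (by rw [hBm2]; linarith)
  have hev2 := NSSOPS.measure_transit_tail_le hI hδ0 hδ1 hT hX1 Fintype.card_pos
    (by rw [← hB]; linarith)
  have hev3 := NSSOPS.measure_visit_deviation_le hI hT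
    (fun t ω => NSSOPS.visitWeight M (fun τ => ep τ ω) T δ C t) (c := 4 * L) (B := 4 * L * L)
    (r := Real.log (1 / δ))
    (fun t ht x a => NSSOPS.measurable_visitWeight hI C ht x a)
    (fun t ω x a => NSSOPS.visitWeight_nonneg M hC0 t x a)
    (fun t ω x a => NSSOPS.visitWeight_le M hLpos t x a) (by positivity) le_rfl
    (Real.log_nonneg (by rw [le_div_iff₀ hδ0]; linarith))
  rw [Real.exp_neg, Real.exp_log (by positivity), inv_div, div_one] at hev3
  have hbad := (measure_union_le _ _).trans
    (add_le_add ((measure_union_le _ _).trans (add_le_add hev1 hev2)) hev3)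
  rw [← ENNReal.ofReal_add hδ0.le (by linarith), ← ENNReal.ofReal_add (by linarith) hδ0.le]
    at hbad
  set G : Set Ω := {ω | NSSOPS.violation M T α (fun t => NSSOPS.meanCost (D t ω))
    (fun t => π t ω) ≤ 100 * (L * Fintype.card X * Fintype.card A *
      √(T * Real.log (m * B)) + Real.log T * Fintype.card X * Fintype.card A * C)} with hG
  have hrun' : ∀ᵐ ω ∂μ, ∀ t, t + 1 < T → ∃ q : X → A → X → ℝ,
      NSSOPS.IsChoice (fun τ => ep τ ω) (t + 1) T δ C M α q ∧
        NSSOPS.IsInducedPolicy q (π (t + 1) ω) := by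
    rw [ae_all_iff]
    intro t
    rw [Filter.eventually_imp_distrib_left]
    exact hrun t
  have hcompl : μ Gᶜ ≤ ENNReal.ofReal (δ + 2 * δ + δ) := by
    refine (measure_mono_ae ?_).trans hbad
    filter_upwards [hC, hfeas, hrun', NSSOPS.ae_layered hI, NSSOPS.ae_cost_mem hI] with
      ω hCω hfeasω hrunω hlay hcost hω
    by_contra hgood
    have htail1 := not_not.1 fun hc => hgood (Or.inl (Or.inl hc))
    have htail2 := not_not.1 fun hc => hgood (Or.inl (Or.inr hc))
    obtain ⟨ρ, hρ, hρα⟩ := hfeasω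
    refine hω (NSSOPS.violation_le M (h := fun τ => ep τ ω) (δ := δ) (ρ := ρ) hm hT2 hLpos
      (hmean ω) hCω (hpol ω) (fun i => (hα i).1) hρ hρα hrunω hlay hcost
      (fun t ht x a x' hx => ?_) (fun t ht i x a => ?_) ?_ ?_ ?_ ?_ ?_)
    · exact NSSOPS.abs_empTrans_sub_le M (NSSOPS.P_le_one M hx a x') hι
        (htail2 t ht.le x a x' hx)
    · exact NSSOPS.abs_empCost_sub_avgCost_le hT ht.le hCω (fun τ hτ => hcost τ (hτ.trans ht))
        (hmean ω) i x a (by rw [hBm2]; exact hι3) (htail1 t ht.le i x a)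
    · have hazuma := le_of_not_ge fun hc : 4 * L * L * √(2 * T * Real.log (1 / δ)) ≤ _ =>
        hgood (Or.inr hc)
      refine hazuma.trans ?_
      have hδB : 1 / δ ≤ m * B := by
        refine le_trans ?_ hmB
        rw [hB]
        gcongr
        have : 1 ≤ (T : ℝ) * Fintype.card X := by nlinarith
        nlinarith
      have := Real.log_le_log (by positivity) hδB
      gcongr
    · rw [← hB]
      exact hιm
    · rw [← hB]
      linarith
    · linarith
    · rw [hBm2]
      exact hι2
  have huniv : 1 ≤ μ G + μ Gᶜ := by
    rw [← measure_univ (μ := μ), ← Set.union_compl_self G]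
    exact measure_union_le _ _
  calc ENNReal.ofReal (1 - 8 * δ) ≤ ENNReal.ofReal (1 - (δ + 2 * δ + δ)) :=
        ENNReal.ofReal_le_ofReal (by linarith)
    _ = 1 - ENNReal.ofReal (δ + 2 * δ + δ) := by
        rw [ENNReal.ofReal_sub _ (by linarith), ENNReal.ofReal_one]
    _ ≤ μ G := by
        rw [tsub_le_iff_right]
        exact huniv.trans (by gcongr)
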